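/- **Setting.** Let $\mathbb k=\mathbb R$ or $\mathbb C$. Let $(\mathcal F,d)$ and $(\mathcal F',d')$ be finite-dimensional $\mathbb Z$-graded cochain complexes over $\mathbb k$ with symplectic forms $\omega,\omega'$ of degree $-1$ with which $d,d'$ are compatible (i.e. $d,d'$ are the Hamiltonian vector fields of the quadratic functions $S_0=\tfrac12\omega(x,dx)$ and $S_0'=\tfrac12\omega'(x',d'x')$). Let $(\iota,\pi,\kappa)$ be a strong deformation retraction (SDR) of $\mathcal F$ onto $\mathcal F'$, that is, $\iota:\mathcal F'\to\mathcal F$ and $\pi:\mathcal F\to\mathcal F'$ are chain maps, $\kappa:\mathcal F\to\mathcal F$ has degree $-1$, and $$\pi\iota=\mathrm{id},\quad d\kappa+\kappa d=\mathrm{id}-\iota\pi,\quad \kappa^2=0,\quad \kappa\iota=0,\quad \pi\kappa=0,$$ compatible with the symplectic forms: $\omega(x,\iota y')=\omega'(\pi x,y')$ and $\omega(x,\kappa y)=\pm\omega(\kappa x,y)$ (with the sign dictated by the corresponding relation for $d$). Put $\mathcal L=\operatorname{im}\kappa$ (a Lagrangian in $\mathcal F''=\ker\pi$) and view $\mathcal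 F'$ as a subspace of $\mathcal F$ by $\iota$. Let $\widehat S\mathcal F^*$ be the algebra of formal power series on $\mathcal F$ (the completed graded-symmetric algebra of $\mathcal F^*$). Limits, derivatives and integrals of formal series are taken coefficientwise, and a formal map is a degree-preserving map between graded spaces given by power series without constant term. Let $S_{\rm int}\in\widehat S\mathcal F^*$ have degree $0$ and only terms of polynomial degree $\ge 3$, and let $S=S_0+S_{\rm int}$ satisfy the classical master equation $\{S,S\}=0$. Put $Q^{\rm cl}=\{S,\cdot\}$, $Q_{\rm int}=\{S_{\rm int},\cdot\}$, $Q_0'=\{S_0',\cdot\}'$, $i=\pi^*$, $p=\iota^*$. Let $\widehat\kappa$ be the derivation of $\widehat S\mathcal F^*$ that extends the dual $\kappa^*$, and let $K$ be the symmetrized chain homotopy: on a product of $m$ linear functions it is the sum, over all ways to put $\kappa^*$ in one position and either $\pi^*\iota^*$ or $\mathrm{id}$ in each of the other positions, with coefficient $M!\,N!/(M+N+1)!$ if $\pi^*\iota^*$ occurs $M$ times and $\mathrm{id}$ occurs $N$ times, $M+N+1=m$, and with the Koszul sign of moving $\kappa^*$ to its position. Define $$i^{\rm cl}_{\rm int}=\sum_{k\ge0}(-KQ_{\rm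 int})^k i,\qquad p^{\rm cl}_{\rm int}=\sum_{k\ge0}p(-Q_{\rm int}K)^k,\qquad K^{\rm cl}_{\rm int}=\sum_{k\ge0}K(-Q_{\rm int}K)^k,$$ $$Q'^{\rm cl}=Q_0'+\sum_{k\ge0}p(-Q_{\rm int}K)^kQ_{\rm int}i .$$ Let $H=[\widehat\kappa,Q^{\rm cl}]=\widehat\kappa Q^{\rm cl}+Q^{\rm cl}\widehat\kappa$, a formal vector field on $\mathcal F$ of degree $0$, and let $\Phi_T$ ($T\in\mathbb R$) be the flow of $-H$: $\Phi_0=\mathrm{id}$, $\frac{d}{dT}\Phi_T(x)=-H(\Phi_T(x))$. Let $\mathrm{cr}:\mathcal F'\to\mathcal L$ be the formal map such that $x'+\mathrm{cr}(x')$ is the critical point of $S|_{x'+\mathcal L}$, and let $\mathcal Z\subset\mathcal F'\oplus\mathcal L$ be the locus where the derivatives of $S$ in the directions of $\mathcal L$ vanish. **Statement.** The four series above converge. $(\widehat S\mathcal F^*,Q^{\rm cl},\cdot)$ and $(\widehat S\mathcal F'^*,Q'^{\rm cl},\cdot)$ are dg commutative algebras, and $(i^{\rm cl}_{\rm int},p^{\rm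 cl}_{\rm int},K^{\rm cl}_{\rm int})$ is an SDR of the first complex onto the second. It is the classical limit of the quantum one: let $c\in\mathbb k$ and let $S_{\rm int}+\hbar S^{(1)}_{\rm int}+\hbar^2S^{(2)}_{\rm int}+\cdots$, with all $S^{(j)}_{\rm int}$ of degree $0$ and with terms of polynomial degree $\ge3$ only, be such that $S_\hbar=S_0+S_{\rm int}+\hbar S_{\rm int}^{(1)}+\cdots$ solves the quantum master equation $\tfrac12\{S_\hbar,S_\hbar\}+c\hbar\Delta S_\hbar=0$ (usually $c=-\mathrm i$). Perturb the free data $(i,p,K,Q_0')$, extended to formal power series in $\hbar$, by the homological perturbation formulae first by $c\hbar\Delta$ and then by $\{S_\hbar-S_0,\cdot\}$. Then all the series converge, and the resulting maps reduce modulo $\hbar$ to $i^{\rm cl}_{\rm int},p^{\rm cl}_{\rm int},K^{\rm cl}_{\rm int},Q'^{\rm cl}$. The flow $\Phi_T$ and the map $\mathrm{cr}$ exist and are unique, and: (a) $p^{\rm cl}_{\rm int}:(\widehat S\mathcal F^*,Q^{\rm cl},\cdot)\to(\widehat S\mathcal F'^*,Q'^{\rm cl},\cdot)$ is a morphism of dg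 commutative algebras, $p^{\rm cl}_{\rm int}(O)=\lim_{T\to\infty}p(\Phi_T^*O)$, and $p^{\rm cl}_{\rm int}$ is the pullback by the formal map $$\iota^{\rm cl}_{\rm int}:\mathcal F'\to\mathcal F,\qquad x'\mapsto\lim_{T\to\infty}\Phi_T(x')=(\pi|_{\mathcal Z})^{-1}(x')=x'+\mathrm{cr}(x').$$ Thus $\iota^{\rm cl}_{\rm int}$ sends $x'$ to the critical point of $S$ restricted to $x'+\mathcal L$. It is an $L_\infty$ morphism, i.e. its pullback intertwines the cohomological vector fields $Q^{\rm cl}$ and $Q'^{\rm cl}$. Moreover $Q'^{\rm cl}=\{S\circ\iota^{\rm cl}_{\rm int},\cdot\}'$. (b) $i^{\rm cl}_{\rm int}:(\widehat S\mathcal F'^*,Q'^{\rm cl},\cdot)\to(\widehat S\mathcal F^*,Q^{\rm cl},\cdot)$ is a morphism of dg commutative algebras, $i^{\rm cl}_{\rm int}(O')=\lim_{T\to\infty}\Phi_T^*(i\,O')$, and $i^{\rm cl}_{\rm int}$ is the pullback by the formal map $$\pi^{\rm cl}_{\rm int}:\mathcal F\to\mathcal F',\qquad x\mapsto\lim_{T\to\infty}\pi\circ\Phi_T(x),$$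 which is an $L_\infty$ morphism. (c) For $O\in\widehat S\mathcal F^*$, $$K^{\rm cl}_{\rm int}(O)=\int_0^\infty dT\;\widehat\kappa\,\Phi_T^*O,\qquad\text{or, equivalently,}\qquad K^{\rm cl}_{\rm int}(O)(x)=\int_0^\infty O\big((\mathrm{id}+dT\,\kappa)\circ\Phi_T(x)\big),$$ where $dT$ is an odd variable of degree $1$, the part linear in $dT$ is integrated over $T\in(0,\infty)$, and the integrals converge absolutely. -/

import Mathlib

open Filter Topology

namespace BV

noncomputable section

section Algebra

open scoped Classical

/-! ## Formal functions on a graded vector space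

A finite-dimensional `ℤ`-graded vector space `F` with a homogeneous basis is recorded by the ghost
numbers `gh : Fin n → ℤ` of the dual coordinates `x⁰, …, xⁿ⁻¹` (so the `i`-th basis vector has degree
`- gh i`).  Coordinates of even ghost number commute, coordinates of odd ghost number anticommute. -/

/-- An exponent of a monomial: coordinates of odd ghost number occur at most once. -/
def Admissible {n : ℕ} (gh : Fin n → ℤ) (m : Fin n →₀ ℕ) : Prop := ∀ i, Odd (gh i) → m i ≤ 1

/-- The completed graded-symmetric algebra of `F*`: formal power series in the coordinates.
A series is the family of its coefficients at the ordered monomials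
`x^m = (x⁰)^(m 0) ⋯ (xⁿ⁻¹)^(m (n-1))`. -/
def FormalFun (𝕜 : Type*) {n : ℕ} (gh : Fin n → ℤ) : Type _ :=
  {m : Fin n →₀ ℕ // Admissible gh m} → 𝕜

/-- The sign in `x^a * x^b = ± x^(a+b)`. -/
def koszul (𝕜 : Type*) [CommRing 𝕜] {n : ℕ} (gh : Fin n → ℤ) (a b : Fin n →₀ ℕ) : 𝕜 :=
  (-1) ^ (∑ i, ∑ j ∈ Finset.univ.filter (· < i), a i * b j * (gh i * gh j).natAbs)

variable {𝕜 : Type*} [CommRing 𝕜] {n : ℕ} {gh : Fin n → ℤ}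

theorem koszul_zero_left (b : Fin n →₀ ℕ) : koszul 𝕜 gh 0 b = 1 := by simp [koszul]

theorem koszul_zero_right (b : Fin n →₀ ℕ) : koszul 𝕜 gh b 0 = 1 := by simp [koszul]

theorem koszul_add_left (a a' b : Fin n →₀ ℕ) :
    koszul 𝕜 gh (a + a') b = koszul 𝕜 gh a b * koszul 𝕜 gh a' b := by
  simp [koszul, add_mul, Finset.sum_add_distrib, pow_add]

theorem koszul_add_right (a b b' : Fin n →₀ ℕ) :
    koszul 𝕜 gh a (b + b') = koszul 𝕜 gh a b * koszul 𝕜 gh a b' := by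
  simp [koszul, mul_add, add_mul, Finset.sum_add_distrib, pow_add]

namespace FormalFun

instance : AddCommGroup (FormalFun 𝕜 gh) := inferInstanceAs (AddCommGroup (_ → 𝕜))

instance : Module 𝕜 (FormalFun 𝕜 gh) := inferInstanceAs (Module 𝕜 (_ → 𝕜))

/-- Coefficientwise convergence. -/
instance [TopologicalSpace 𝕜] : TopologicalSpace (FormalFun 𝕜 gh) :=
  inferInstanceAs (TopologicalSpace (_ → 𝕜))

/-- The coefficient at `x^m` (zero if `x^m = 0`). -/
def coeff (m : Fin n →₀ ℕ) (f : FormalFun 𝕜 gh) : 𝕜 := if h : Admissible gh m then f ⟨m, h⟩ else 0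

/-- The series with prescribed coefficients at the (nonzero) monomials. -/
def mk (gh : Fin n → ℤ) (c : (Fin n →₀ ℕ) → 𝕜) : FormalFun 𝕜 gh := fun m => c m.1

theorem coeff_mk (c : (Fin n →₀ ℕ) → 𝕜) {m : Fin n →₀ ℕ} (h : Admissible gh m) :
    coeff m (mk gh c) = c m := by simp [coeff, mk, h]

theorem coeff_of_not (f : FormalFun 𝕜 gh) {m : Fin n →₀ ℕ} (h : ¬ Admissible gh m) :
    coeff m f = 0 := by simp [coeff, h]

theorem ext' {f g : FormalFun 𝕜 gh} (h : ∀ m, Admissible gh m → coeff m f = coeff m g) :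
    f = g := by
  funext m
  have := h m.1 m.2
  simpa [coeff, m.2] using this

theorem coeff_add (m : Fin n →₀ ℕ) (f g : FormalFun 𝕜 gh) :
    coeff m (f + g) = coeff m f + coeff m g := by
  by_cases h : Admissible gh m
  · simp only [coeff, h, dif_pos]; rfl
  · simp [coeff, h]

theorem coeff_smul (m : Fin n →₀ ℕ) (c : 𝕜) (f : FormalFun 𝕜 gh) :
    coeff m (c • f) = c * coeff m f := by
  by_cases h : Admissible gh m
  · simp only [coeff, h, dif_pos]; rfl
  · simp [coeff, h]

theorem coeff_zero (m : Fin n →₀ ℕ) : coeff m (0 : FormalFun 𝕜 gh) = 0 := by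
  by_cases h : Admissible gh m
  · simp only [coeff, h, dif_pos]; rfl
  · simp [coeff, h]

instance : One (FormalFun 𝕜 gh) := ⟨mk gh fun m => if m = 0 then 1 else 0⟩

instance : Mul (FormalFun 𝕜 gh) :=
  ⟨fun f g => mk gh fun m =>
    ∑ p ∈ Finset.HasAntidiagonal.antidiagonal m, koszul 𝕜 gh p.1 p.2 * (coeff p.1 f * coeff p.2 g)⟩

theorem coeff_one (m : Fin n →₀ ℕ) :
    coeff m (1 : FormalFun 𝕜 gh) = if m = 0 then 1 else 0 := by
  by_cases h : Admissible gh m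
  · exact coeff_mk _ h
  · have : m ≠ 0 := by rintro rfl; exact h fun i _ => by simp
    simp [coeff, h, this]

theorem coeff_mul {m : Fin n →₀ ℕ} (h : Admissible gh m) (f g : FormalFun 𝕜 gh) :
    coeff m (f * g) =
      ∑ p ∈ Finset.HasAntidiagonal.antidiagonal m, koszul 𝕜 gh p.1 p.2 * (coeff p.1 f * coeff p.2 g) :=
  coeff_mk _ h

end FormalFun

theorem Admissible.of_add_left {a b : Fin n →₀ ℕ} (h : Admissible gh (a + b)) :
    Admissible gh a := fun i hi => le_trans (by simp) (h i hi)

theorem Admissible.of_add_right {a b : Fin n →₀ ℕ} (h : Admissible gh (a + b)) :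
    Admissible gh b := fun i hi => le_trans (by simp) (h i hi)

namespace FormalFun

theorem mul_assoc' (f g k : FormalFun 𝕜 gh) : f * g * k = f * (g * k) := by
  refine ext' fun m hm => ?_
  rw [coeff_mul hm, coeff_mul hm]
  have h1 : ∀ p ∈ Finset.HasAntidiagonal.antidiagonal m,
      koszul 𝕜 gh p.1 p.2 * (coeff p.1 (f * g) * coeff p.2 k) =
        ∑ q ∈ Finset.HasAntidiagonal.antidiagonal p.1, koszul 𝕜 gh p.1 p.2 *
          ((koszul 𝕜 gh q.1 q.2 * (coeff q.1 f * coeff q.2 g)) * coeff p.2 k) := by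
    intro p hp
    rw [coeff_mul ((Finset.HasAntidiagonal.mem_antidiagonal.1 hp ▸ hm : Admissible gh (p.1 + p.2)).of_add_left),
      Finset.sum_mul, Finset.mul_sum]
  have h2 : ∀ p ∈ Finset.HasAntidiagonal.antidiagonal m,
      koszul 𝕜 gh p.1 p.2 * (coeff p.1 f * coeff p.2 (g * k)) =
        ∑ q ∈ Finset.HasAntidiagonal.antidiagonal p.2, koszul 𝕜 gh p.1 p.2 *
          (coeff p.1 f * (koszul 𝕜 gh q.1 q.2 * (coeff q.1 g * coeff q.2 k))) := by
    intro p hp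
    rw [coeff_mul ((Finset.HasAntidiagonal.mem_antidiagonal.1 hp ▸ hm : Admissible gh (p.1 + p.2)).of_add_right),
      Finset.mul_sum, Finset.mul_sum]
  rw [Finset.sum_congr rfl h1, Finset.sum_congr rfl h2, Finset.sum_sigma', Finset.sum_sigma']
  refine Finset.sum_nbij' (fun x => ⟨(x.2.1, x.2.2 + x.1.2), (x.2.2, x.1.2)⟩)
    (fun x => ⟨(x.1.1 + x.2.1, x.2.2), (x.1.1, x.2.1)⟩) ?_ ?_ ?_ ?_ ?_
  · rintro ⟨⟨a, b⟩, ⟨c, d⟩⟩ h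
    simp only [Finset.mem_sigma, Finset.HasAntidiagonal.mem_antidiagonal] at h ⊢
    obtain ⟨h, rfl⟩ := h
    simpa [add_assoc] using h
  · rintro ⟨⟨a, b⟩, ⟨c, d⟩⟩ h
    simp only [Finset.mem_sigma, Finset.HasAntidiagonal.mem_antidiagonal] at h ⊢
    obtain ⟨h, rfl⟩ := h
    simpa [add_assoc] using h
  · rintro ⟨⟨a, b⟩, ⟨c, d⟩⟩ h
    simp only [Finset.mem_sigma, Finset.HasAntidiagonal.mem_antidiagonal] at h
    obtain ⟨h, rfl⟩ := h
    rfl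
  · rintro ⟨⟨a, b⟩, ⟨c, d⟩⟩ h
    simp only [Finset.mem_sigma, Finset.HasAntidiagonal.mem_antidiagonal] at h
    obtain ⟨h, rfl⟩ := h
    rfl
  · rintro ⟨⟨a, b⟩, ⟨c, d⟩⟩ h
    simp only [Finset.mem_sigma, Finset.HasAntidiagonal.mem_antidiagonal] at h
    obtain ⟨h, rfl⟩ := h
    simp only [koszul_add_left, koszul_add_right]
    ring

theorem one_mul' (f : FormalFun 𝕜 gh) : 1 * f = f := by
  refine ext' fun m hm => ?_
  rw [coeff_mul hm, Finset.sum_eq_single (0, m)]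
  · simp [coeff_one, koszul_zero_left]
  · rintro ⟨a, b⟩ h hne
    have : a ≠ 0 := by
      rintro rfl
      simp only [Finset.HasAntidiagonal.mem_antidiagonal, zero_add] at h
      exact hne (by rw [h])
    simp [coeff_one, this]
  · simp

theorem mul_one' (f : FormalFun 𝕜 gh) : f * 1 = f := by
  refine ext' fun m hm => ?_
  rw [coeff_mul hm, Finset.sum_eq_single (m, 0)]
  · simp [coeff_one, koszul_zero_right]
  · rintro ⟨a, b⟩ h hne
    have : b ≠ 0 := by
      rintro rfl
      simp only [Finset.HasAntidiagonal.mem_antidiagonal, add_zero] at h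
      exact hne (by rw [h])
    simp [coeff_one, this]
  · simp

instance : Ring (FormalFun 𝕜 gh) where
  __ := (inferInstance : AddCommGroup (FormalFun 𝕜 gh))
  mul_assoc := mul_assoc'
  one_mul := one_mul'
  mul_one := mul_one'
  zero_mul f := ext' fun m hm => by simp [coeff_mul hm, coeff_zero]
  mul_zero f := ext' fun m hm => by simp [coeff_mul hm, coeff_zero]
  left_distrib f g k := ext' fun m hm => by
    simp only [coeff_mul hm, coeff_add, mul_add, Finset.sum_add_distrib]
  right_distrib f g k := ext' fun m hm => by
    simp only [coeff_mul hm, coeff_add, add_mul, mul_add, Finset.sum_add_distrib]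

end FormalFun

open FormalFun

/-- The coordinate function `xⁱ`. -/
def X (i : Fin n) : FormalFun 𝕜 gh := mk gh fun m => if m = Finsupp.single i 1 then 1 else 0

/-- `f` is homogeneous of ghost number `k`. -/
def IsHomogeneous (k : ℤ) (f : FormalFun 𝕜 gh) : Prop :=
  ∀ m, coeff m f ≠ 0 → ∑ i, (m i : ℤ) * gh i = k

/-- The left partial derivative `∂f/∂xⁱ`. -/
def dL (i : Fin n) (f : FormalFun 𝕜 gh) : FormalFun 𝕜 gh := mk gh fun m =>
  (m i + 1 : 𝕜) * koszul 𝕜 gh (Finsupp.single i 1) m * coeff (m + Finsupp.single i 1) f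

/-- The right partial derivative of `f` with respect to `xⁱ`. -/
def dR (i : Fin n) (f : FormalFun 𝕜 gh) : FormalFun 𝕜 gh := mk gh fun m =>
  (m i + 1 : 𝕜) * koszul 𝕜 gh m (Finsupp.single i 1) * coeff (m + Finsupp.single i 1) f

/-- The formal vector field `∑ vⁱ ∂/∂xⁱ`, acting on functions. -/
def vectorField (v : Fin n → FormalFun 𝕜 gh) (f : FormalFun 𝕜 gh) : FormalFun 𝕜 gh :=
  ∑ i, v i * dL i f

/-- The `i`-th component of the linear map with matrix `M`, i.e. the linear form `∑ⱼ M i j xʲ`. -/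
def linForm (gh : Fin n → ℤ) {k : ℕ} (M : Matrix (Fin k) (Fin n) 𝕜) (i : Fin k) :
    FormalFun 𝕜 gh := ∑ j, M i j • X j

/-- Substitution of the series `g⁰, g¹, …` without constant term for the coordinates in `f`:
`∑ f_m (g⁰)^(m 0) (g¹)^(m 1) ⋯`.  Only the finitely many terms with `|m| ≤ |l|` contribute to
the coefficient at `x^l`. -/
def subst {k : ℕ} {ghT : Fin k → ℤ} (g : Fin k → FormalFun 𝕜 gh) (f : FormalFun 𝕜 ghT) :
    FormalFun 𝕜 gh := mk gh fun l =>
  ∑ d ∈ Finset.range (l.degree + 1), ∑ m ∈ Finset.finsuppAntidiag (Finset.univ : Finset (Fin k)) d,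
    coeff m f * coeff l (List.ofFn fun i => g i ^ m i).prod

variable (𝕜) in
/-- A formal (nonlinear) map, defined near zero, from the graded vector space with coordinates of
ghost numbers `ghS` to the one with ghost numbers `ghT`: its `i`-th component is a formal function on
the source, of the ghost number of the coordinate `xⁱ` of the target, vanishing at zero. -/
@[ext]
structure FormalMap {k l : ℕ} (ghS : Fin k → ℤ) (ghT : Fin l → ℤ) where
  comp : Fin l → FormalFun 𝕜 ghS
  homogeneous : ∀ i, IsHomogeneous (ghT i) (comp i)
  constantCoeff : ∀ i, coeff 0 (comp i) = 0

/-- The pullback of functions by a formal map. -/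
def FormalMap.pullback {k l : ℕ} {ghS : Fin k → ℤ} {ghT : Fin l → ℤ} (g : FormalMap 𝕜 ghS ghT) :
    FormalFun 𝕜 ghT → FormalFun 𝕜 ghS := subst g.comp

end Algebra

/-! ## Differential graded commutative algebras of formal functions -/

section DG

variable {𝕜 : Type*} [CommRing 𝕜] {n n' : ℕ} {gh : Fin n → ℤ} {gh' : Fin n' → ℤ}

/-- `Q` makes the algebra of formal functions a dg commutative algebra; equivalently, `Q` is a
cohomological vector field. -/
structure IsDGCommAlgebra (Q : FormalFun 𝕜 gh → FormalFun 𝕜 gh) : Prop where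
  linear : IsLinearMap 𝕜 Q
  degree : ∀ k f, IsHomogeneous k f → IsHomogeneous (k + 1) (Q f)
  square : ∀ f, Q (Q f) = 0
  leibniz : ∀ k f g, IsHomogeneous k f → Q (f * g) = Q f * g + (-1 : 𝕜) ^ k.natAbs • (f * Q g)
  comm : ∀ k l (f g : FormalFun 𝕜 gh), IsHomogeneous k f → IsHomogeneous l g →
    f * g = (-1 : 𝕜) ^ (k * l).natAbs • (g * f)

/-- `φ` is a morphism of dg commutative algebras from `(·, Q)` to `(·, Q')`. -/
structure IsDGAlgHom (Q : FormalFun 𝕜 gh → FormalFun 𝕜 gh) (Q' : FormalFun 𝕜 gh' → FormalFun 𝕜 gh')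
    (φ : FormalFun 𝕜 gh → FormalFun 𝕜 gh') : Prop where
  linear : IsLinearMap 𝕜 φ
  map_one : φ 1 = 1
  map_mul : ∀ f g, φ (f * g) = φ f * φ g
  degree : ∀ k f, IsHomogeneous k f → IsHomogeneous k (φ f)
  comm : ∀ f, φ (Q f) = Q' (φ f)

/-- A formal map between formal graded spaces with cohomological vector fields `Q`, `Q'`
(equivalently, between the `L∞` algebras which they encode on the shifted spaces `[-1]`) is an `L∞`
morphism if its pullback intertwines the cohomological vector fields. -/
def IsLInfinityMorphism (Q : FormalFun 𝕜 gh → FormalFun 𝕜 gh)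
    (Q' : FormalFun 𝕜 gh' → FormalFun 𝕜 gh') (g : FormalMap 𝕜 gh gh') : Prop :=
  ∀ f, g.pullback (Q' f) = Q (g.pullback f)

/-- Strong deformation retraction of the complex of formal functions `(·, Q)` onto `(·, Q')`. -/
structure IsSDR (Q : FormalFun 𝕜 gh → FormalFun 𝕜 gh) (Q' : FormalFun 𝕜 gh' → FormalFun 𝕜 gh')
    (i : FormalFun 𝕜 gh' → FormalFun 𝕜 gh) (p : FormalFun 𝕜 gh → FormalFun 𝕜 gh')
    (K : FormalFun 𝕜 gh → FormalFun 𝕜 gh) : Prop where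
  linear_i : IsLinearMap 𝕜 i
  linear_p : IsLinearMap 𝕜 p
  linear_K : IsLinearMap 𝕜 K
  degree_i : ∀ k f, IsHomogeneous k f → IsHomogeneous k (i f)
  degree_p : ∀ k f, IsHomogeneous k f → IsHomogeneous k (p f)
  degree_K : ∀ k f, IsHomogeneous k f → IsHomogeneous (k - 1) (K f)
  square : ∀ f, Q (Q f) = 0
  square' : ∀ f, Q' (Q' f) = 0
  chain_i : ∀ f, Q (i f) = i (Q' f)
  chain_p : ∀ f, p (Q f) = Q' (p f)
  homotopy : ∀ f, Q (K f) + K (Q f) = f - i (p f)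
  p_i : ∀ f, p (i f) = f
  K_K : ∀ f, K (K f) = 0
  K_i : ∀ f, K (i f) = 0
  p_K : ∀ f, p (K f) = 0

end DG

/-! ## Homological perturbation formulae

`i, p, K` are the maps of the unperturbed retraction of `V` onto `V'`, `δ` is the perturbation of the
differential of `V`, and `d'` is the unperturbed differential of `V'`. -/

section HPL

variable {V V' : Type*} [AddCommGroup V] [TopologicalSpace V] [AddCommGroup V'] [TopologicalSpace V']

/-- `∑ₖ (-K δ)ᵏ i`. -/
def hplI (K δ : V → V) (i : V' → V) (f : V') : V := ∑' k : ℕ, (fun v => -K (δ v))^[k] (i f)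

/-- `∑ₖ p (-δ K)ᵏ`. -/
def hplP (p : V → V') (K δ : V → V) (f : V) : V' := ∑' k : ℕ, p ((fun v => -δ (K v))^[k] f)

/-- `∑ₖ K (-δ K)ᵏ`. -/
def hplK (K δ : V → V) (f : V) : V := ∑' k : ℕ, K ((fun v => -δ (K v))^[k] f)

/-- `d' + ∑ₖ p (-δ K)ᵏ δ i`. -/
def hplD (d' : V' → V') (p : V → V') (K δ : V → V) (i : V' → V) (f : V') : V' :=
  d' f + ∑' k : ℕ, p ((fun v => -δ (K v))^[k] (δ (i f)))

/-- Convergence of the four perturbation series. -/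
structure HPLConverges (p : V → V') (K δ : V → V) (i : V' → V) : Prop where
  conv_i : ∀ f, Summable fun k : ℕ => (fun v => -K (δ v))^[k] (i f)
  conv_p : ∀ f, Summable fun k : ℕ => p ((fun v => -δ (K v))^[k] f)
  conv_K : ∀ f, Summable fun k : ℕ => K ((fun v => -δ (K v))^[k] f)
  conv_d : ∀ f, Summable fun k : ℕ => p ((fun v => -δ (K v))^[k] (δ (i f)))

end HPL

/-! ## The BV structure -/

section Bracket

variable {𝕜 : Type*} [Field 𝕜] {n : ℕ} {gh : Fin n → ℤ}

/-- The degree `1` Poisson bracket.  Here `ω` is the matrix of the symplectic form in the coordinates,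
`ω(x, y) = ∑ ω i j xⁱ yʲ`; it pairs even with odd coordinates and is symmetric in this convention.
In terms of left and right derivatives `{f, g} = ∑ (-1)^(gh i) (ω⁻¹) i j (f ∂←ᵢ) (∂→ⱼ g)`,
which is `∑ (ω⁻¹) i j (∂ᵢ f) (∂ⱼ g)` with left derivatives if `f` is even. -/
def bracket (ω : Matrix (Fin n) (Fin n) 𝕜) (f g : FormalFun 𝕜 gh) : FormalFun 𝕜 gh :=
  ∑ i, ∑ j, ((-1) ^ (gh i).natAbs * ω⁻¹ i j) • (dR i f * dL j g)

/-- The BV Laplacian `½ ∑ (ω⁻¹) i j ∂ᵢ ∂ⱼ`. -/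
def laplacian (ω : Matrix (Fin n) (Fin n) 𝕜) (f : FormalFun 𝕜 gh) : FormalFun 𝕜 gh :=
  (1 / 2 : 𝕜) • ∑ i, ∑ j, ω⁻¹ i j • dL i (dL j f)

/-- The quadratic function `½ ω(x, d x)`. -/
def quadraticAction (gh : Fin n → ℤ) (ω d : Matrix (Fin n) (Fin n) 𝕜) : FormalFun 𝕜 gh :=
  (1 / 2 : 𝕜) • ∑ i, ∑ j, ω i j • (X i * linForm gh d j)

end Bracket

/-- A free BV theory with a retraction onto infrared fields: finite-dimensional cochain complexes
`(F, d)` and `(F', d')` with symplectic forms `ω`, `ω'` of degree `-1`, and a strong deformation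
retraction `(ι, π, κ) = (inc, pr, κ)` of `F` onto `F'` compatible with the symplectic forms.
Everything is written in homogeneous bases; `gh`, `gh'` are the ghost numbers of the coordinates, the
basis vectors have the opposite degrees.  The ultraviolet fields are `F'' = ker π`, and the
gauge-fixing Lagrangian is `L = im κ`. -/
structure FreeBVRetract (𝕜 : Type*) [Field 𝕜] (n n' : ℕ) where
  gh : Fin n → ℤ
  gh' : Fin n' → ℤ
  ω : Matrix (Fin n) (Fin n) 𝕜
  ω' : Matrix (Fin n') (Fin n') 𝕜
  d : Matrix (Fin n) (Fin n) 𝕜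
  d' : Matrix (Fin n') (Fin n') 𝕜
  inc : Matrix (Fin n) (Fin n') 𝕜
  pr : Matrix (Fin n') (Fin n) 𝕜
  κ : Matrix (Fin n) (Fin n) 𝕜
  ω_deg : ∀ i j, ω i j ≠ 0 → gh i + gh j = -1
  ω_symm : ω.IsSymm
  ω_nondeg : IsUnit ω.det
  ω'_deg : ∀ i j, ω' i j ≠ 0 → gh' i + gh' j = -1
  ω'_symm : ω'.IsSymm
  ω'_nondeg : IsUnit ω'.det
  d_deg : ∀ i j, d i j ≠ 0 → gh j = gh i + 1
  d_sq : d * d = 0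
  /-- `ω(x, d y) = ± ω(d x, y)`, with the sign for which the function `ω(x, d x)` encodes `d` -/
  d_compat : ∀ i j, (ω * d) j i = (-1) ^ (gh i * gh j).natAbs * (ω * d) i j
  d'_deg : ∀ i j, d' i j ≠ 0 → gh' j = gh' i + 1
  d'_sq : d' * d' = 0
  d'_compat : ∀ i j, (ω' * d') j i = (-1) ^ (gh' i * gh' j).natAbs * (ω' * d') i j
  inc_deg : ∀ i j, inc i j ≠ 0 → gh' j = gh i
  pr_deg : ∀ i j, pr i j ≠ 0 → gh j = gh' i
  κ_deg : ∀ i j, κ i j ≠ 0 → gh j = gh i - 1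
  inc_chain : d * inc = inc * d'
  pr_chain : pr * d = d' * pr
  pr_inc : pr * inc = 1
  homotopy : d * κ + κ * d = 1 - inc * pr
  κ_κ : κ * κ = 0
  κ_inc : κ * inc = 0
  pr_κ : pr * κ = 0
  /-- `ω(x, ι y') = ω'(π x, y')` -/
  inc_compat : ω * inc = pr.transpose * ω'
  /-- `ω(x, κ y) = ± ω(κ x, y)`, the only sign that is consistent with `d_compat` and `homotopy`
  when `F''` is nonzero -/
  κ_compat : ∀ i j, (ω * κ) j i = -((-1) ^ (gh i * gh j).natAbs * (ω * κ) i j)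

namespace FreeBVRetract

section Free

variable {𝕜 : Type*} [Field 𝕜] {n n' : ℕ} (D : FreeBVRetract 𝕜 n n')

/-- The free action `S₀ = ½ ω(x, d x)`. -/
def S₀ : FormalFun 𝕜 D.gh := quadraticAction D.gh D.ω D.d

/-- The differential `Q'₀ = {S'₀, ·}'` of the free infrared theory. -/
def Q'₀ : FormalFun 𝕜 D.gh' → FormalFun 𝕜 D.gh' :=
  bracket D.ω' (quadraticAction D.gh' D.ω' D.d')

/-- `i = π*`. -/
def i : FormalFun 𝕜 D.gh' → FormalFun 𝕜 D.gh := subst (linForm D.gh D.pr)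

/-- `p = ι*`. -/
def p : FormalFun 𝕜 D.gh → FormalFun 𝕜 D.gh' := subst (linForm D.gh' D.inc)

/-- The extension of the dual of `κ` to a derivation. -/
def κhat : FormalFun 𝕜 D.gh → FormalFun 𝕜 D.gh := vectorField (linForm D.gh D.κ)

/-- The symmetrized chain homotopy on a product `x^(w 0) x^(w 1) ⋯` of coordinates: the sum over the
position `k` of `κ` and over the choices of `P'` (positions in `s`) or `id` in the other positions,
with coefficient `M! N! / (M + N + 1)!` for `M` factors `P'` and `N` factors `id`, and with the
sign of moving `κ` to the position `k`. -/
def Kword (w : List (Fin n)) : FormalFun 𝕜 D.gh :=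
  ∑ k : Fin w.length, ∑ s ∈ (Finset.univ.erase k).powerset,
    (((s.card.factorial * (w.length - 1 - s.card).factorial : ℕ) : 𝕜) / (w.length.factorial : 𝕜) *
        ∏ l ∈ Finset.univ.filter (· < k), (-1) ^ (D.gh (w.get l)).natAbs) •
      (List.ofFn fun l => if l = k then linForm D.gh D.κ (w.get l)
        else if l ∈ s then linForm D.gh (D.inc * D.pr) (w.get l) else X (w.get l)).prod

/-- The coordinates, with multiplicities and in increasing order, in the monomial `x^m`. -/
def word (m : Fin n →₀ ℕ) : List (Fin n) :=
  (List.finRange n).flatMap fun i => List.replicate (m i) i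

/-- The chain homotopy `K = κ^sym` of the free classical theory, extended to formal power series
(it preserves the polynomial degree). -/
def K (f : FormalFun 𝕜 D.gh) : FormalFun 𝕜 D.gh := FormalFun.mk D.gh fun l =>
  ∑ m ∈ Finset.finsuppAntidiag (Finset.univ : Finset (Fin n)) l.degree,
    FormalFun.coeff m f * FormalFun.coeff l (D.Kword (word m))

/-- An interaction term: a power series of ghost number zero starting in polynomial degree `3`. -/
def IsInteraction (Sint : FormalFun 𝕜 D.gh) : Prop :=
  IsHomogeneous 0 Sint ∧ ∀ m : Fin n →₀ ℕ, m.degree < 3 → FormalFun.coeff m Sint = 0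

variable (Sint : FormalFun 𝕜 D.gh)

/-- The action `S = S₀ + S_int`. -/
def S : FormalFun 𝕜 D.gh := D.S₀ + Sint

/-- The differential `Q = {S, ·}`. -/
def Q : FormalFun 𝕜 D.gh → FormalFun 𝕜 D.gh := bracket D.ω (D.S Sint)

/-- Its perturbation `Q_int = {S_int, ·}`. -/
def Qint : FormalFun 𝕜 D.gh → FormalFun 𝕜 D.gh := bracket D.ω Sint

/-- The Hamiltonian `H = [κhat, Q]` (graded commutator of odd derivations). -/
def H (f : FormalFun 𝕜 D.gh) : FormalFun 𝕜 D.gh := D.κhat (D.Q Sint f) + D.Q Sint (D.κhat f)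

/-- The formal map `g` into `F` satisfies `∂S/∂x_κ (g) = 0`: all derivatives of `S` in the directions
of `L = im κ` vanish along `g`. -/
def IsCriticalAlongL {k : ℕ} {ghY : Fin k → ℤ} (g : Fin n → FormalFun 𝕜 ghY) : Prop :=
  ∀ j, ∑ i, D.κ i j • subst g (dL i (D.S Sint)) = 0

/-- The map `cr : F' → L`: a formal map with values in `L = im κ` such that
`∂S/∂x_κ (x' + cr x') = 0`. -/
def IsCr (cr : FormalMap 𝕜 D.gh' D.gh) : Prop :=
  (∀ m, (fun i => FormalFun.coeff m (cr.comp i)) ∈ LinearMap.range D.κ.mulVecLin) ∧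
    D.IsCriticalAlongL Sint fun i => linForm D.gh' D.inc i + cr.comp i

/-- The formal map `g` takes values in `Z`, the locus in `F' ⊕ L` where `∂S/∂x_κ = 0`. -/
def MapsToZ {k : ℕ} {ghY : Fin k → ℤ} (g : FormalMap 𝕜 ghY D.gh) : Prop :=
  (∀ m, (fun i => FormalFun.coeff m (g.comp i)) ∈
      LinearMap.range D.inc.mulVecLin ⊔ LinearMap.range D.κ.mulVecLin) ∧
    D.IsCriticalAlongL Sint g.comp

/-- `σ = (π|_Z)⁻¹` : the formal map `σ` is a section of `π` with values in `Z`, and every formal map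
`z` into `Z` satisfies `z = σ ∘ π ∘ z`. -/
def IsInverseOfPrOnZ (σ : FormalMap 𝕜 D.gh' D.gh) : Prop :=
  D.MapsToZ Sint σ ∧ (∀ a, ∑ i, D.pr a i • σ.comp i = X a) ∧
    ∀ (k : ℕ) (ghY : Fin k → ℤ) (z : FormalMap 𝕜 ghY D.gh), D.MapsToZ Sint z →
      ∀ i, z.comp i = subst (fun a => ∑ j, D.pr a j • z.comp j) (σ.comp i)

/-- The pullback of `O` by the map `(id + dT κ) ∘ φ`, as a function on `F × ℝ[-1]`, where `dT` is
a coordinate of ghost number `1` (placed in front of the coordinates of `F`). -/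
def pullbackWithDT (φ : FormalMap 𝕜 D.gh D.gh) (O : FormalFun 𝕜 D.gh) :
    FormalFun 𝕜 (Fin.cons 1 D.gh : Fin (n + 1) → ℤ) :=
  let y : Fin n → FormalFun 𝕜 (Fin.cons 1 D.gh : Fin (n + 1) → ℤ) :=
    fun i => subst (fun j => X j.succ) (φ.comp i)
  subst (fun i => y i + X 0 * ∑ j, D.κ i j • y j) O

/-- The coefficient `a` of `dT` in a function `b + dT a` on `F × ℝ[-1]`. -/
def dTPart (f : FormalFun 𝕜 (Fin.cons 1 D.gh : Fin (n + 1) → ℤ)) : FormalFun 𝕜 D.gh :=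
  subst (Fin.cons 0 X : Fin (n + 1) → FormalFun 𝕜 D.gh) (dL 0 f)

/-! ### The quantum theory

Elements of `ŜF*[[ħ]]` are the sequences of their coefficients in `ħ`.  The quantum BV differential
is `{S, ·} + c ħ Δ` for a constant `c`; the usual choice is `c = -i` over the complex numbers. -/

/-- The extension of a map coefficientwise in `ħ`. -/
def hlift {A B : Type*} (φ : A → B) (f : ℕ → A) : ℕ → B := fun k => φ (f k)

/-- `c ħ Δ`. -/
def hΔ (c : 𝕜) (f : ℕ → FormalFun 𝕜 D.gh) : ℕ → FormalFun 𝕜 D.gh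
  | 0 => 0
  | k + 1 => c • laplacian D.ω (f k)

/-- The `ħ`-linear extension of the Poisson bracket. -/
def hbracket (f g : ℕ → FormalFun 𝕜 D.gh) : ℕ → FormalFun 𝕜 D.gh :=
  fun k => ∑ q ∈ Finset.HasAntidiagonal.antidiagonal k, bracket D.ω (f q.1) (g q.2)

/-- The action `S₀ + S_int` with an `ħ`-dependent interaction. -/
def hS (SintQ : ℕ → FormalFun 𝕜 D.gh) : ℕ → FormalFun 𝕜 D.gh
  | 0 => D.S₀ + SintQ 0
  | k + 1 => SintQ (k + 1)

/-- The quantum master equation `½ {S, S} + c ħ Δ S = 0`. -/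
def QME (c : 𝕜) (SintQ : ℕ → FormalFun 𝕜 D.gh) : Prop :=
  (1 / 2 : 𝕜) • D.hbracket (D.hS SintQ) (D.hS SintQ) + D.hΔ c (D.hS SintQ) = 0

end Free

section Perturbed

variable {𝕜 : Type*} [Field 𝕜] [TopologicalSpace 𝕜] {n n' : ℕ} (D : FreeBVRetract 𝕜 n n')

/-! ### The maps of the interacting classical theory -/

/-- `i_int^cl`. -/
def iInt (Sint : FormalFun 𝕜 D.gh) : FormalFun 𝕜 D.gh' → FormalFun 𝕜 D.gh :=
  hplI D.K (D.Qint Sint) D.i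

/-- `p_int^cl`. -/
def pInt (Sint : FormalFun 𝕜 D.gh) : FormalFun 𝕜 D.gh → FormalFun 𝕜 D.gh' :=
  hplP D.p D.K (D.Qint Sint)

/-- `K_int^cl`. -/
def KInt (Sint : FormalFun 𝕜 D.gh) : FormalFun 𝕜 D.gh → FormalFun 𝕜 D.gh :=
  hplK D.K (D.Qint Sint)

/-- The induced differential `Q'^cl`. -/
def QInt' (Sint : FormalFun 𝕜 D.gh) : FormalFun 𝕜 D.gh' → FormalFun 𝕜 D.gh' :=
  hplD D.Q'₀ D.p D.K (D.Qint Sint) D.i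

/-! ### The maps of the free quantum theory (perturbation `c ħ Δ`) and of the interacting quantum
theory (further perturbation `{S_int, ·}`) -/

/-- `i_ħ`. -/
def ih (c : 𝕜) : (ℕ → FormalFun 𝕜 D.gh') → (ℕ → FormalFun 𝕜 D.gh) :=
  hplI (hlift D.K) (D.hΔ c) (hlift D.i)

/-- `p_ħ`. -/
def ph (c : 𝕜) : (ℕ → FormalFun 𝕜 D.gh) → (ℕ → FormalFun 𝕜 D.gh') :=
  hplP (hlift D.p) (hlift D.K) (D.hΔ c)

/-- `K_ħ`. -/
def Kh (c : 𝕜) : (ℕ → FormalFun 𝕜 D.gh) → (ℕ → FormalFun 𝕜 D.gh) :=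
  hplK (hlift D.K) (D.hΔ c)

/-- `Q'_{0,ħ}`. -/
def Q'₀h (c : 𝕜) : (ℕ → FormalFun 𝕜 D.gh') → (ℕ → FormalFun 𝕜 D.gh') :=
  hplD (hlift D.Q'₀) (hlift D.p) (hlift D.K) (D.hΔ c) (hlift D.i)

/-- `i_int`. -/
def ihInt (c : 𝕜) (SintQ : ℕ → FormalFun 𝕜 D.gh) :
    (ℕ → FormalFun 𝕜 D.gh') → (ℕ → FormalFun 𝕜 D.gh) :=
  hplI (D.Kh c) (D.hbracket SintQ) (D.ih c)

/-- `p_int`. -/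
def phInt (c : 𝕜) (SintQ : ℕ → FormalFun 𝕜 D.gh) :
    (ℕ → FormalFun 𝕜 D.gh) → (ℕ → FormalFun 𝕜 D.gh') :=
  hplP (D.ph c) (D.Kh c) (D.hbracket SintQ)

/-- `K_int`. -/
def KhInt (c : 𝕜) (SintQ : ℕ → FormalFun 𝕜 D.gh) :
    (ℕ → FormalFun 𝕜 D.gh) → (ℕ → FormalFun 𝕜 D.gh) :=
  hplK (D.Kh c) (D.hbracket SintQ)

/-- `Q'_ħ`. -/
def QhInt' (c : 𝕜) (SintQ : ℕ → FormalFun 𝕜 D.gh) :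
    (ℕ → FormalFun 𝕜 D.gh') → (ℕ → FormalFun 𝕜 D.gh') :=
  hplD (D.Q'₀h c) (D.ph c) (D.Kh c) (D.hbracket SintQ) (D.ih c)

/-- The maps of the interacting quantum theory are well defined, and their reductions modulo `ħ` are
the maps of the interacting classical theory with interaction `SintQ 0`. -/
structure ReducesModH (c : 𝕜) (SintQ : ℕ → FormalFun 𝕜 D.gh) : Prop where
  conv_free : HPLConverges (hlift D.p) (hlift D.K) (D.hΔ c) (hlift D.i)
  conv_int : HPLConverges (D.ph c) (D.Kh c) (D.hbracket SintQ) (D.ih c)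
  red_i : ∀ f, D.ihInt c SintQ f 0 = D.iInt (SintQ 0) (f 0)
  red_p : ∀ f, D.phInt c SintQ f 0 = D.pInt (SintQ 0) (f 0)
  red_K : ∀ f, D.KhInt c SintQ f 0 = D.KInt (SintQ 0) (f 0)
  red_Q' : ∀ f, D.QhInt' c SintQ f 0 = D.QInt' (SintQ 0) (f 0)

end Perturbed

section Flow

variable {𝕜 : Type*} [RCLike 𝕜] {n n' : ℕ} (D : FreeBVRetract 𝕜 n n')

/-- `Φ` is the flow of the formal vector field `-H`: `Φ₀ = id` and
`d/dT Φ_T(x) = -H(Φ_T(x))`, coefficientwise; the components of `H` are `H xⁱ`. -/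
def IsFlow (Sint : FormalFun 𝕜 D.gh) (Φ : ℝ → FormalMap 𝕜 D.gh D.gh) : Prop :=
  (∀ i, (Φ 0).comp i = X i) ∧
    ∀ (T : ℝ) (i : Fin n) (m : Fin n →₀ ℕ),
      HasDerivAt (fun t => FormalFun.coeff m ((Φ t).comp i))
        (-FormalFun.coeff m ((Φ T).pullback (D.H Sint (X i)))) T

end Flow

end FreeBVRetract

end

end BV

open BV

namespace BV

open FormalFun

noncomputable section

/-! Two facts drive the proof: the symmetrized homotopy factors through the derivation `κhat` on
both sides, and the flow of `-H` contracts exponentially onto the interacting infrared functions.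

The free Hamiltonian `E = [κhat, Q₀]` acts on linear forms as the projection to the ultraviolet
part, so as a derivation it counts the ultraviolet degree. Let `G` be the inverse of `E` on
functions that vanish on infrared fields. Writing `1/j` as the integral of `t^j dt/t` and dilating
the ultraviolet fields by `t` turns the coefficients `M! N!/(M+N+1)!` into beta integrals, whence `K
= κhat G = G κhat` (`Kword_eq_κL_green`, `KL_eq`). The homotopy relation and side conditions of `K`
follow, and the perturbation lemma (`IsPerturbation`) gives the interacting retraction; its series
converge because `Q_int` raises the polynomial degree.

From the factorization, `κhat i_int = 0`, `p_int κhat = 0` and `K_int κhat = 0`. With the retraction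
relations this gives `H i_int = 0`, `p_int H = 0` and `K_int H = κhat` for `H = [κhat, Q]`. To
leading order in the polynomial degree `H` is `E`, with eigenvalues `0, 1, 2, ...`, and the
eigenvalue `0` is excluded on the kernel of `p_int`. Hence the pullback by the flow decays
exponentially on that kernel (`exists_shifts`, `flow_decay`), is the identity on the image of
`i_int`, and converges to `i_int p_int` (`tendsto_flow`).

The flow acts by algebra automorphisms because `H` is an even derivation. Therefore the limits
`p_int` and `i_int` are multiplicative, hence pullbacks by formal maps, and `Q' = p_int Q i` is a
derivation. Integrating `d/dT (K_int Φ_T^*) = -κhat Φ_T^*` gives the formula for `K_int`.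

The derivatives of `S` along the gauge-fixing Lagrangian are combinations of the functions `Q κhat
xᵃ`, and `p_int Q κhat = Q' p_int κhat = 0`, so `ι_int` is critical. Conversely, a map `z` into the
critical locus pulls back `κhat` and `H` to zero. It is then invariant under the flow, so `z^* = z^*
i_int p_int = z^* i p_int`, which says that `z = ι_int ∘ π ∘ z` (`eq_of_mapsToZ`). The formula for
`Q'` as a Hamiltonian vector field follows from the chain rule, since the part of the derivative of
`ι_int` along the Lagrangian meets vanishing derivatives of `S`.

For the quantum theory `ħ` receives weight `2`: then `ħ Δ` preserves the weight and the interaction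
raises it, which gives convergence, and at `ħ = 0` the series become the classical ones term by
term. -/

section FormalFunctions

/-! ## Signs and ghost degrees -/

section Signs

variable (𝕜 : Type*) [Field 𝕜]

/-- The sign `(-1) ^ k`. -/
def sg (k : ℤ) : 𝕜 := (-1) ^ k.natAbs

theorem sg_eq_ite (k : ℤ) : sg 𝕜 k = if Even k then 1 else -1 := by
  unfold sg
  split_ifs with h
  · exact (Int.natAbs_even.2 h).neg_one_pow
  · exact (Int.natAbs_odd.2 (Int.not_even_iff_odd.1 h)).neg_one_pow

theorem sg_add (a b : ℤ) : sg 𝕜 (a + b) = sg 𝕜 a * sg 𝕜 b := by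
  simp only [sg_eq_ite, Int.even_add]
  by_cases ha : Even a <;> by_cases hb : Even b <;> simp [ha, hb]

theorem sg_congr {a b : ℤ} (h : Even (a - b)) : sg 𝕜 a = sg 𝕜 b := by
  rw [Int.even_sub] at h
  simp only [sg_eq_ite, h]

@[simp] theorem sg_zero : sg 𝕜 0 = 1 := by simp [sg]

theorem sg_neg (a : ℤ) : sg 𝕜 (-a) = sg 𝕜 a := by simp [sg]

theorem sg_even {a : ℤ} (h : Even a) : sg 𝕜 a = 1 := by simp [sg_eq_ite, h]

@[simp] theorem sg_mul_self (a : ℤ) : sg 𝕜 a * sg 𝕜 a = 1 := by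
  simp only [sg_eq_ite]; split_ifs <;> simp

theorem sg_ne_zero (a : ℤ) : sg 𝕜 a ≠ 0 := by
  simp only [sg_eq_ite]; split_ifs <;> simp

theorem sg_sum {ι : Type*} (s : Finset ι) (f : ι → ℤ) :
    sg 𝕜 (∑ i ∈ s, f i) = ∏ i ∈ s, sg 𝕜 (f i) := by
  classical
  induction s using Finset.induction_on with
  | empty => simp
  | insert a s ha ih => rw [Finset.sum_insert ha, Finset.prod_insert ha, sg_add, ih]

end Signs

variable {𝕜 : Type*} [Field 𝕜] {n n' : ℕ} {gh : Fin n → ℤ} {gh' : Fin n' → ℤ}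

/-- The ghost number of the monomial `x^m`. -/
def gd (gh : Fin n → ℤ) (m : Fin n →₀ ℕ) : ℤ := ∑ i, (m i : ℤ) * gh i

theorem gd_add (a b : Fin n →₀ ℕ) : gd gh (a + b) = gd gh a + gd gh b := by
  simp [gd, add_mul, Finset.sum_add_distrib]

@[simp] theorem gd_zero : gd gh 0 = 0 := by simp [gd]

@[simp] theorem gd_single (i : Fin n) : gd gh (Finsupp.single i 1) = gh i := by
  rw [gd, Finset.sum_eq_single i]
  · simp
  · intro j _ hj
    simp [Finsupp.single_eq_of_ne hj]
  · simp

theorem koszul_eq_sg (a b : Fin n →₀ ℕ) : koszul 𝕜 gh a b =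
    sg 𝕜 (∑ i, ∑ j ∈ Finset.univ.filter (· < i), ((a i : ℤ) * b j) * (gh i * gh j)) := by
  unfold koszul
  rw [← Finset.prod_pow_eq_pow_sum, sg_sum]
  refine Finset.prod_congr rfl fun i _ => ?_
  rw [← Finset.prod_pow_eq_pow_sum, sg_sum]
  refine Finset.prod_congr rfl fun j _ => ?_
  rw [sg, Int.natAbs_mul ((a i : ℤ) * b j), Int.natAbs_mul (a i : ℤ), Int.natAbs_natCast,
    Int.natAbs_natCast]

theorem koszul_mul_self (a b : Fin n →₀ ℕ) : koszul 𝕜 gh a b * koszul 𝕜 gh a b = 1 := by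
  rw [koszul_eq_sg, sg_mul_self]

/-- The product of the two ghost numbers is the sum of the terms below, above and on the diagonal.
The first two give the two Koszul signs, and the diagonal is even by admissibility. -/
theorem koszul_swap {a b : Fin n →₀ ℕ} (h : Admissible gh (a + b)) :
    koszul 𝕜 gh a b = sg 𝕜 (gd gh a * gd gh b) * koszul 𝕜 gh b a := by
  rw [koszul_eq_sg, koszul_eq_sg, ← sg_add]
  refine sg_congr _ ?_
  set t : Fin n → Fin n → ℤ := fun i j => ((a i : ℤ) * b j) * (gh i * gh j) with ht
  have h1 : gd gh a * gd gh b = ∑ i, ∑ j, t i j := by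
    simp only [gd, Finset.sum_mul_sum, ht]
    refine Finset.sum_congr rfl fun i _ => Finset.sum_congr rfl fun j _ => by ring
  have h2 : ∑ i, ∑ j ∈ Finset.univ.filter (· < i), ((b i : ℤ) * a j) * (gh i * gh j) =
      ∑ i, ∑ j ∈ Finset.univ.filter (i < ·), t i j := by
    simp only [Finset.sum_filter]
    rw [Finset.sum_comm]
    refine Finset.sum_congr rfl fun i _ => Finset.sum_congr rfl fun j _ => ?_
    split_ifs
    · simp only [ht]; ring
    · rfl
  have h3 : ∑ i, ∑ j, t i j = ∑ i, ∑ j ∈ Finset.univ.filter (· < i), t i j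
      + ∑ i, ∑ j ∈ Finset.univ.filter (i < ·), t i j + ∑ i, t i i := by
    rw [← Finset.sum_add_distrib, ← Finset.sum_add_distrib]
    refine Finset.sum_congr rfl fun i _ => ?_
    simp only [Finset.sum_filter]
    rw [← Finset.sum_add_distrib]
    have : t i i = ∑ j, if j = i then t i j else 0 := by simp
    rw [this, ← Finset.sum_add_distrib]
    refine Finset.sum_congr rfl fun j _ => ?_
    rcases lt_trichotomy j i with hj | hj | hj
    · simp [hj, hj.not_gt, hj.ne]
    · simp [hj]
    · simp [hj, hj.not_gt, hj.ne']
  -- An odd coordinate occurs in at most one of the two monomials, and an even one contributes an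
  -- even ghost number.
  have h4 : Even (∑ i, t i i) := by
    refine Finset.even_sum _ fun i _ => ?_
    by_cases hi : Odd (gh i)
    · have := h i hi
      simp only [Finsupp.add_apply] at this
      have : a i = 0 ∨ b i = 0 := by omega
      rcases this with h | h <;> simp [ht, h]
    · rw [Int.not_odd_iff_even] at hi
      exact (hi.mul_right _).mul_left _
  rw [h1, h2, h3]
  obtain ⟨r, hr⟩ := h4
  rw [hr]
  exact ⟨-(∑ i, ∑ j ∈ Finset.univ.filter (i < ·), t i j) - r, by ring⟩

theorem isHomogeneous_iff {k : ℤ} {f : FormalFun 𝕜 gh} :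
    IsHomogeneous k f ↔ ∀ m, coeff m f ≠ 0 → gd gh m = k := Iff.rfl

/-! ## Linear structure, algebra structure, filtration -/

namespace FormalFun

theorem coeff_sum {ι : Type*} (s : Finset ι) (m : Fin n →₀ ℕ) (f : ι → FormalFun 𝕜 gh) :
    coeff m (∑ i ∈ s, f i) = ∑ i ∈ s, coeff m (f i) := by
  classical
  induction s using Finset.induction_on with
  | empty => simp [coeff_zero]
  | insert a s ha ih => rw [Finset.sum_insert ha, Finset.sum_insert ha, coeff_add, ih]

/-- The coefficient at `x^m` as a linear functional. -/
def coeffL (m : Fin n →₀ ℕ) : FormalFun 𝕜 gh →ₗ[𝕜] 𝕜 where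
  toFun := coeff m
  map_add' := coeff_add m
  map_smul' := coeff_smul m

theorem coeff_neg (m : Fin n →₀ ℕ) (f : FormalFun 𝕜 gh) : coeff m (-f) = -coeff m f :=
  map_neg (coeffL m) f

theorem coeff_sub (m : Fin n →₀ ℕ) (f g : FormalFun 𝕜 gh) :
    coeff m (f - g) = coeff m f - coeff m g := map_sub (coeffL m) f g

theorem smul_mul' (c : 𝕜) (f g : FormalFun 𝕜 gh) : c • f * g = c • (f * g) := by
  refine ext' fun m hm => ?_
  simp only [coeff_mul hm, coeff_smul, Finset.mul_sum]
  exact Finset.sum_congr rfl fun p _ => by ring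

theorem mul_smul' (c : 𝕜) (f g : FormalFun 𝕜 gh) : f * c • g = c • (f * g) := by
  refine ext' fun m hm => ?_
  simp only [coeff_mul hm, coeff_smul, Finset.mul_sum]
  exact Finset.sum_congr rfl fun p _ => by ring

instance : IsScalarTower 𝕜 (FormalFun 𝕜 gh) (FormalFun 𝕜 gh) := ⟨smul_mul'⟩

instance : SMulCommClass 𝕜 (FormalFun 𝕜 gh) (FormalFun 𝕜 gh) := ⟨fun c f g => (mul_smul' c f g).symm⟩

/-- The series of terms of polynomial degree at least `N`. -/
def Fil (𝕜 : Type*) [Field 𝕜] {n : ℕ} (gh : Fin n → ℤ) (N : ℕ) : Submodule 𝕜 (FormalFun 𝕜 gh) where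
  carrier := {f | ∀ m : Fin n →₀ ℕ, m.degree < N → coeff m f = 0}
  zero_mem' m _ := coeff_zero m
  add_mem' hf hg m hm := by rw [coeff_add, hf m hm, hg m hm, add_zero]
  smul_mem' c f hf m hm := by rw [coeff_smul, hf m hm, mul_zero]

theorem Fil_antitone {M N : ℕ} (h : M ≤ N) : Fil 𝕜 gh N ≤ Fil 𝕜 gh M :=
  fun _ hf m hm => hf m (hm.trans_le h)

theorem mem_Fil_zero (f : FormalFun 𝕜 gh) : f ∈ Fil 𝕜 gh 0 := fun m hm => by simp at hm

theorem mem_Fil_one {f : FormalFun 𝕜 gh} : f ∈ Fil 𝕜 gh 1 ↔ coeff 0 f = 0 := by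
  refine ⟨fun h => h 0 (by simp), fun h m hm => ?_⟩
  have : m = 0 := by
    rw [← Finsupp.degree_eq_zero_iff]; omega
  rwa [this]

theorem eq_zero_of_mem_Fil {f : FormalFun 𝕜 gh} (h : ∀ N, f ∈ Fil 𝕜 gh N) : f = 0 :=
  ext' fun m _ => by rw [h (m.degree + 1) m (Nat.lt_succ_self _), coeff_zero]

theorem mul_mem_Fil {a b : ℕ} {f g : FormalFun 𝕜 gh} (hf : f ∈ Fil 𝕜 gh a) (hg : g ∈ Fil 𝕜 gh b) :
    f * g ∈ Fil 𝕜 gh (a + b) := by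
  intro m hm
  by_cases hadm : Admissible gh m
  · rw [coeff_mul hadm]
    refine Finset.sum_eq_zero fun p hp => ?_
    rw [Finset.HasAntidiagonal.mem_antidiagonal] at hp
    have : p.1.degree + p.2.degree < a + b := by rw [← map_add, hp]; exact hm
    rcases lt_or_ge p.1.degree a with h | h
    · rw [hf _ h]; simp
    · rw [hg p.2 (by omega)]; simp
  · exact coeff_of_not _ hadm

theorem mul_mem_Fil_left {b : ℕ} (f : FormalFun 𝕜 gh) {g : FormalFun 𝕜 gh} (hg : g ∈ Fil 𝕜 gh b) :
    f * g ∈ Fil 𝕜 gh b := by simpa using mul_mem_Fil (mem_Fil_zero f) hg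

theorem mul_mem_Fil_right {b : ℕ} {f : FormalFun 𝕜 gh} (hf : f ∈ Fil 𝕜 gh b) (g : FormalFun 𝕜 gh) :
    f * g ∈ Fil 𝕜 gh b := by simpa using mul_mem_Fil hf (mem_Fil_zero g)

/-- The monomial `x^m`, zero if `m` is not admissible. -/
def mono (gh : Fin n → ℤ) (m : Fin n →₀ ℕ) : FormalFun 𝕜 gh := mk gh fun l => if l = m then 1 else 0

theorem coeff_mono {l m : Fin n →₀ ℕ} (h : Admissible gh l) :
    coeff l (mono gh m : FormalFun 𝕜 gh) = if l = m then 1 else 0 := coeff_mk _ h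

theorem coeff_mono_of_ne {l m : Fin n →₀ ℕ} (h : l ≠ m) :
    coeff l (mono gh m : FormalFun 𝕜 gh) = 0 := by
  by_cases hl : Admissible gh l
  · rw [coeff_mono hl, if_neg h]
  · exact coeff_of_not _ hl

theorem mono_of_not {m : Fin n →₀ ℕ} (h : ¬ Admissible gh m) : (mono gh m : FormalFun 𝕜 gh) = 0 :=
  ext' fun l hl => by
    rw [coeff_mono_of_ne (by rintro rfl; exact h hl), coeff_zero]

theorem X_eq_mono (i : Fin n) : (X i : FormalFun 𝕜 gh) = mono gh (Finsupp.single i 1) :=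
  ext' fun l hl => by rw [coeff_mono hl, X, coeff_mk _ hl]

theorem one_eq_mono : (1 : FormalFun 𝕜 gh) = mono gh 0 :=
  ext' fun l hl => by rw [coeff_mono hl, coeff_one]

theorem coeff_X (m : Fin n →₀ ℕ) (i : Fin n) :
    coeff m (X i : FormalFun 𝕜 gh) = if m = Finsupp.single i 1 then 1 else 0 := by
  by_cases h : Admissible gh m
  · exact coeff_mk _ h
  · rw [coeff_of_not _ h, if_neg]
    rintro rfl
    exact h fun j _ => by
      rw [Finsupp.single_apply]; split_ifs <;> simp

theorem X_mem_Fil (i : Fin n) : (X i : FormalFun 𝕜 gh) ∈ Fil 𝕜 gh 1 := by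
  rw [mem_Fil_one, coeff_X, if_neg]
  intro h
  simpa using DFunLike.congr_fun h i

theorem mono_mul_mono (a b : Fin n →₀ ℕ) :
    (mono gh a * mono gh b : FormalFun 𝕜 gh) = koszul 𝕜 gh a b • mono gh (a + b) := by
  refine ext' fun m hm => ?_
  rw [coeff_mul hm, coeff_smul, coeff_mono hm]
  by_cases h : m = a + b
  · subst h
    rw [Finset.sum_eq_single (a, b)]
    · rw [coeff_mono hm.of_add_left, coeff_mono hm.of_add_right]; simp
    · rintro ⟨c, d⟩ hcd hne
      have : ¬(c = a ∧ d = b) := by rintro ⟨rfl, rfl⟩; exact hne rfl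
      by_cases hc : c = a
      · have hd : d ≠ b := fun hd => this ⟨hc, hd⟩
        simp [coeff_mono_of_ne hd]
      · simp [coeff_mono_of_ne hc]
    · simp
  · rw [if_neg h, mul_zero]
    refine Finset.sum_eq_zero ?_
    rintro ⟨c, d⟩ hcd
    rw [Finset.HasAntidiagonal.mem_antidiagonal] at hcd
    by_cases hc : c = a
    · have hd : d ≠ b := by rintro rfl; exact h (by rw [← hcd, ← hc])
      simp [coeff_mono_of_ne hd]
    · simp [coeff_mono_of_ne hc]

/-- The exponents of degree at most `N`. -/
def mons (n N : ℕ) : Finset (Fin n →₀ ℕ) :=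
  (Finset.range (N + 1)).biUnion fun d => Finset.finsuppAntidiag (Finset.univ : Finset (Fin n)) d

theorem mem_finsuppAntidiag_iff_degree {m : Fin n →₀ ℕ} {d : ℕ} :
    m ∈ Finset.finsuppAntidiag (Finset.univ : Finset (Fin n)) d ↔ m.degree = d := by
  simp [Finset.mem_finsuppAntidiag, Finsupp.degree_eq_sum]

theorem mem_mons {N : ℕ} {m : Fin n →₀ ℕ} : m ∈ mons n N ↔ m.degree ≤ N := by
  simp [mons, Finsupp.degree_eq_sum]

/-- The part of polynomial degree at most `N`. -/
def trunc (N : ℕ) (f : FormalFun 𝕜 gh) : FormalFun 𝕜 gh := ∑ m ∈ mons n N, coeff m f • mono gh m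

theorem coeff_trunc (N : ℕ) (f : FormalFun 𝕜 gh) (l : Fin n →₀ ℕ) :
    coeff l (trunc N f) = if l.degree ≤ N then coeff l f else 0 := by
  by_cases hl : Admissible gh l
  · simp [trunc, coeff_sum, coeff_smul, coeff_mono hl, mem_mons]
  · simp [coeff_of_not _ hl]

theorem sub_trunc_mem (N : ℕ) (f : FormalFun 𝕜 gh) : f - trunc N f ∈ Fil 𝕜 gh (N + 1) := by
  intro m hm
  rw [coeff_sub, coeff_trunc, if_pos (by omega), sub_self]

/-- Monomials are built from `1` by multiplication with coordinates. -/
theorem mono_induction {P : FormalFun 𝕜 gh → Prop} (h1 : P 1)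
    (hX : ∀ i f, P f → P (X i * f)) (hs : ∀ (c : 𝕜) f, P f → P (c • f)) (m : Fin n →₀ ℕ) :
    P (mono gh m) := by
  induction hd : m.degree generalizing m with
  | zero =>
    rw [Finsupp.degree_eq_zero_iff] at hd
    rw [hd, ← one_eq_mono]; exact h1
  | succ d ih =>
    have : m ≠ 0 := by rintro rfl; simp at hd
    obtain ⟨i, hi⟩ := Finsupp.ne_iff.1 this
    have hle : Finsupp.single i 1 ≤ m := by
      rw [Finsupp.single_le_iff]
      exact Nat.one_le_iff_ne_zero.2 hi
    obtain ⟨m', rfl⟩ := exists_add_of_le hle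
    have hd' : m'.degree = d := by
      rw [map_add] at hd
      simp at hd
      omega
    have hmul := mono_mul_mono (𝕜 := 𝕜) (gh := gh) (Finsupp.single i 1) m'
    have : (mono gh (Finsupp.single i 1 + m') : FormalFun 𝕜 gh) =
        koszul 𝕜 gh (Finsupp.single i 1) m' • (X i * mono gh m') := by
      rw [X_eq_mono, hmul, smul_smul, koszul_mul_self, one_smul]
    rw [this]
    exact hs _ _ (hX _ _ (ih m' hd'))

/-- A linear map that is continuous for the degree filtrations vanishes if its kernel contains `1`
and is stable under multiplication by the coordinates. -/
theorem linearMap_eq_zero {L : FormalFun 𝕜 gh →ₗ[𝕜] FormalFun 𝕜 gh'} (c : ℕ)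
    (hL : ∀ N f, f ∈ Fil 𝕜 gh (N + c) → L f ∈ Fil 𝕜 gh' N) (h1 : L 1 = 0)
    (hX : ∀ i f, L f = 0 → L (X i * f) = 0) : L = 0 := by
  have hm : ∀ m, L (mono gh m) = 0 := fun m =>
    mono_induction (P := fun f => L f = 0) h1 hX
      (fun c f hf => by rw [map_smul, hf, smul_zero]) m
  ext1 f
  refine eq_zero_of_mem_Fil fun N => ?_
  have h2 : L (trunc (N + c) f) = 0 := by
    simp [trunc, map_sum, hm]
  have := hL N (f - trunc (N + c) f) (Fil_antitone (by omega) (sub_trunc_mem (N + c) f))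
  rwa [map_sub, h2, sub_zero] at this

/-- The main tool for operator identities: they need to be checked only on `1` and under
multiplication by a coordinate. The constant `c` is the permitted loss of degree: `0` for
substitutions and for vector fields vanishing at the origin, `1` for a partial derivative, `2` for a
second one. -/
theorem linearMap_ext {L L' : FormalFun 𝕜 gh →ₗ[𝕜] FormalFun 𝕜 gh'} (c : ℕ)
    (hL : ∀ N f, f ∈ Fil 𝕜 gh (N + c) → L f ∈ Fil 𝕜 gh' N)
    (hL' : ∀ N f, f ∈ Fil 𝕜 gh (N + c) → L' f ∈ Fil 𝕜 gh' N) (h1 : L 1 = L' 1)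
    (hX : ∀ i f, L f = L' f → L (X i * f) = L' (X i * f)) : L = L' := by
  rw [← sub_eq_zero]
  refine linearMap_eq_zero c (fun N f hf => ?_) (by simp [h1]) fun i f hf => ?_
  · exact Submodule.sub_mem _ (hL N f hf) (hL' N f hf)
  · rw [LinearMap.sub_apply, sub_eq_zero] at hf ⊢
    exact hX i f hf

/-- The coefficients of the image under a continuous linear map are finite linear combinations of
coefficients. -/
theorem coeff_linearMap {L : FormalFun 𝕜 gh →ₗ[𝕜] FormalFun 𝕜 gh'} {c : ℕ}
    (hL : ∀ N f, f ∈ Fil 𝕜 gh (N + c) → L f ∈ Fil 𝕜 gh' N) (f : FormalFun 𝕜 gh) {l : Fin n' →₀ ℕ}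
    {N : ℕ} (hN : l.degree + c ≤ N) :
    coeff l (L f) = ∑ m ∈ mons n N, coeff l (L (mono gh m)) * coeff m f := by
  have h1 := hL (l.degree + 1) (f - trunc N f) (Fil_antitone (by omega) (sub_trunc_mem N f)) l
    (Nat.lt_succ_self _)
  rw [map_sub, coeff_sub, sub_eq_zero] at h1
  rw [h1, trunc, map_sum, coeff_sum]
  exact Finset.sum_congr rfl fun m _ => by rw [map_smul, coeff_smul, mul_comm]

/-! ### The sign twist and graded commutativity -/

/-- The automorphism `f ↦ (-1)^(k |f|) f`. -/
def tw (gh : Fin n → ℤ) (k : ℤ) : FormalFun 𝕜 gh →ₗ[𝕜] FormalFun 𝕜 gh where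
  toFun f := mk gh fun m => sg 𝕜 (k * gd gh m) * coeff m f
  map_add' f g := ext' fun m hm => by simp only [coeff_mk _ hm, coeff_add, mul_add]
  map_smul' c f := ext' fun m hm => by
    simp only [coeff_mk _ hm, coeff_smul, RingHom.id_apply]; ring

theorem coeff_tw (k : ℤ) (f : FormalFun 𝕜 gh) (m : Fin n →₀ ℕ) :
    coeff m (tw gh k f) = sg 𝕜 (k * gd gh m) * coeff m f := by
  by_cases h : Admissible gh m
  · exact coeff_mk (fun m => sg 𝕜 (k * gd gh m) * coeff m f) h
  · simp [coeff_of_not _ h]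

theorem tw_homogeneous {k e : ℤ} {f : FormalFun 𝕜 gh} (h : IsHomogeneous e f) :
    tw gh k f = sg 𝕜 (k * e) • f := by
  refine ext' fun m _ => ?_
  rw [coeff_tw, coeff_smul]
  by_cases hm : coeff m f = 0
  · simp [hm]
  · rw [isHomogeneous_iff.1 h m hm]

theorem tw_mem_Fil {k : ℤ} {N : ℕ} {f : FormalFun 𝕜 gh} (h : f ∈ Fil 𝕜 gh N) :
    tw gh k f ∈ Fil 𝕜 gh N := fun m hm => by rw [coeff_tw, h m hm, mul_zero]

theorem tw_tw (k l : ℤ) (f : FormalFun 𝕜 gh) : tw gh k (tw gh l f) = tw gh (k + l) f :=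
  ext' fun m _ => by simp only [coeff_tw]; rw [add_mul, sg_add]; ring

theorem tw_even {k : ℤ} (hk : Even k) (f : FormalFun 𝕜 gh) : tw gh k f = f :=
  ext' fun m _ => by rw [coeff_tw, sg_even _ (hk.mul_right _), one_mul]

@[simp] theorem tw_zero (f : FormalFun 𝕜 gh) : tw gh 0 f = f := tw_even (by simp) f

theorem tw_congr {k l : ℤ} (h : Even (k - l)) (f : FormalFun 𝕜 gh) : tw gh k f = tw gh l f :=
  ext' fun m _ => by
    rw [coeff_tw, coeff_tw, sg_congr 𝕜 (a := k * gd gh m) (b := l * gd gh m)]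
    rw [← sub_mul]; exact h.mul_right _

theorem tw_mul (k : ℤ) (f g : FormalFun 𝕜 gh) : tw gh k (f * g) = tw gh k f * tw gh k g :=
  ext' fun m hm => by
    rw [coeff_tw, coeff_mul hm, coeff_mul hm, Finset.mul_sum]
    refine Finset.sum_congr rfl fun p hp => ?_
    rw [Finset.HasAntidiagonal.mem_antidiagonal] at hp
    rw [← hp, gd_add, mul_add, sg_add, coeff_tw, coeff_tw]
    ring

theorem tw_one (k : ℤ) : tw gh k (1 : FormalFun 𝕜 gh) = 1 := by
  refine ext' fun m _ => ?_
  rw [coeff_tw, coeff_one]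
  split_ifs with h
  · simp [h]
  · simp

/-- Graded commutativity. -/
theorem mul_comm_tw {k : ℤ} {f : FormalFun 𝕜 gh} (hf : IsHomogeneous k f) (g : FormalFun 𝕜 gh) :
    f * g = tw gh k g * f := by
  refine ext' fun m hm => ?_
  rw [coeff_mul hm, coeff_mul hm,
    ← Finset.sum_equiv (Equiv.prodComm _ _) (s := Finset.HasAntidiagonal.antidiagonal m)
      (f := fun p => koszul 𝕜 gh p.2 p.1 * (coeff p.2 f * coeff p.1 g))
      (fun p => by simp [add_comm]) (fun p _ => rfl)]
  refine Finset.sum_congr rfl fun p hp => ?_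
  rw [Finset.HasAntidiagonal.mem_antidiagonal] at hp
  rw [coeff_tw]
  by_cases h0 : coeff p.2 f = 0
  · simp [h0]
  · rw [koszul_swap (a := p.2) (b := p.1) (by rwa [add_comm, hp]), isHomogeneous_iff.1 hf _ h0]
    ring

theorem linearMap_eq_zero_of_mono {L : FormalFun 𝕜 gh →ₗ[𝕜] FormalFun 𝕜 gh'} (c : ℕ)
    (hL : ∀ N f, f ∈ Fil 𝕜 gh (N + c) → L f ∈ Fil 𝕜 gh' N) (h : ∀ m, L (mono gh m) = 0) : L = 0 := by
  ext1 f
  refine ext' fun l _ => ?_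
  rw [coeff_linearMap hL f le_rfl]
  simp [h, coeff_zero]

end FormalFun

/-! ### Homogeneous elements -/

theorem IsHomogeneous.add {k : ℤ} {f g : FormalFun 𝕜 gh} (hf : IsHomogeneous k f)
    (hg : IsHomogeneous k g) : IsHomogeneous k (f + g) := by
  intro m hm
  by_cases h : coeff m f = 0
  · exact hg m fun h' => hm (by rw [coeff_add, h, h', add_zero])
  · exact hf m h

theorem IsHomogeneous.smul {k : ℤ} {f : FormalFun 𝕜 gh} (hf : IsHomogeneous k f) (c : 𝕜) :
    IsHomogeneous k (c • f) := fun m hm => hf m fun h => hm (by rw [coeff_smul, h, mul_zero])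

theorem isHomogeneous_zero (k : ℤ) : IsHomogeneous k (0 : FormalFun 𝕜 gh) :=
  fun m hm => absurd (coeff_zero m) hm

theorem isHomogeneous_one : IsHomogeneous 0 (1 : FormalFun 𝕜 gh) := by
  rw [isHomogeneous_iff]
  intro m hm
  rw [coeff_one] at hm
  have : m = 0 := by by_contra h; simp [h] at hm
  simp [this]

theorem isHomogeneous_X (i : Fin n) : IsHomogeneous (gh i) (X i : FormalFun 𝕜 gh) := by
  rw [isHomogeneous_iff]
  intro m hm
  rw [coeff_X] at hm
  have : m = Finsupp.single i 1 := by by_contra h; simp [h] at hm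
  simp [this]

theorem IsHomogeneous.neg {k : ℤ} {f : FormalFun 𝕜 gh} (hf : IsHomogeneous k f) :
    IsHomogeneous k (-f) := by simpa using hf.smul (-1 : 𝕜)

theorem IsHomogeneous.sum {ι : Type*} {s : Finset ι} {k : ℤ} {f : ι → FormalFun 𝕜 gh}
    (hf : ∀ i ∈ s, IsHomogeneous k (f i)) : IsHomogeneous k (∑ i ∈ s, f i) := by
  classical
  induction s using Finset.induction_on with
  | empty => simpa using isHomogeneous_zero k
  | insert a s ha ih =>
    rw [Finset.sum_insert ha]
    exact (hf a (by simp)).add (ih fun i hi => hf i (by simp [hi]))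

theorem IsHomogeneous.mul {k l : ℤ} {f g : FormalFun 𝕜 gh} (hf : IsHomogeneous k f)
    (hg : IsHomogeneous l g) : IsHomogeneous (k + l) (f * g) := by
  rw [isHomogeneous_iff] at *
  intro m hm
  by_cases hadm : Admissible gh m
  · rw [coeff_mul hadm] at hm
    obtain ⟨p, hp, hne⟩ := Finset.exists_ne_zero_of_sum_ne_zero hm
    rw [Finset.HasAntidiagonal.mem_antidiagonal] at hp
    rw [← hp, gd_add, hf p.1 fun h => hne (by simp [h]), hg p.2 fun h => hne (by simp [h])]
  · exact absurd (coeff_of_not _ hadm) hm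

theorem IsHomogeneous.mul' {k l e : ℤ} {f g : FormalFun 𝕜 gh} (hf : IsHomogeneous k f)
    (hg : IsHomogeneous l g) (h : k + l = e) : IsHomogeneous e (f * g) := h ▸ hf.mul hg

theorem IsHomogeneous.smul_of_ne {k : ℤ} {f : FormalFun 𝕜 gh} {c : 𝕜}
    (hf : c ≠ 0 → IsHomogeneous k f) : IsHomogeneous k (c • f) := by
  by_cases hc : c = 0
  · rw [hc, zero_smul]; exact isHomogeneous_zero k
  · exact (hf hc).smul c

/-- The square of an odd element vanishes. -/
theorem IsHomogeneous.mul_self [CharZero 𝕜] {k : ℤ} (hk : Odd k) {f : FormalFun 𝕜 gh}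
    (hf : IsHomogeneous k f) : f * f = 0 := by
  have h := mul_comm_tw hf f
  rw [tw_homogeneous hf, sg_eq_ite, if_neg (by simpa [Int.even_mul] using hk), neg_one_smul,
    neg_mul] at h
  have h2 : (2 : 𝕜) • (f * f) = 0 := by
    rw [two_smul]; nth_rewrite 1 [h]; simp
  simpa using h2

/-! ## Partial derivatives -/

theorem coeff_dL {m : Fin n →₀ ℕ} (hm : Admissible gh m) (i : Fin n) (f : FormalFun 𝕜 gh) :
    coeff m (dL i f) =
      (m i + 1 : 𝕜) * koszul 𝕜 gh (Finsupp.single i 1) m * coeff (m + Finsupp.single i 1) f :=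
  coeff_mk _ hm

theorem coeff_dR {m : Fin n →₀ ℕ} (hm : Admissible gh m) (i : Fin n) (f : FormalFun 𝕜 gh) :
    coeff m (dR i f) =
      (m i + 1 : 𝕜) * koszul 𝕜 gh m (Finsupp.single i 1) * coeff (m + Finsupp.single i 1) f :=
  coeff_mk _ hm

/-- The left derivative as a linear map. -/
def dLL (i : Fin n) : FormalFun 𝕜 gh →ₗ[𝕜] FormalFun 𝕜 gh where
  toFun := dL i
  map_add' f g := ext' fun m hm => by simp only [coeff_dL hm, coeff_add, mul_add]
  map_smul' c f := ext' fun m hm => by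
    simp only [coeff_dL hm, coeff_smul, RingHom.id_apply]; ring

@[simp] theorem dLL_apply (i : Fin n) (f : FormalFun 𝕜 gh) : dLL i f = dL i f := rfl

theorem dL_mem_Fil {i : Fin n} {N : ℕ} {f : FormalFun 𝕜 gh} (h : f ∈ Fil 𝕜 gh (N + 1)) :
    dL i f ∈ Fil 𝕜 gh N := by
  intro m hm
  by_cases hadm : Admissible gh m
  · rw [coeff_dL hadm, h _ (by simpa using hm), mul_zero]
  · exact coeff_of_not _ hadm

theorem IsHomogeneous.dL {k : ℤ} {f : FormalFun 𝕜 gh} (hf : IsHomogeneous k f) (i : Fin n) :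
    IsHomogeneous (k - gh i) (dL i f) := by
  rw [isHomogeneous_iff] at *
  intro m hm
  by_cases hadm : Admissible gh m
  · rw [coeff_dL hadm] at hm
    have := hf _ (right_ne_zero_of_mul hm)
    rw [gd_add, gd_single] at this
    omega
  · exact absurd (coeff_of_not _ hadm) hm

/-- The cofactor of `xⁱ` in a monomial of ghost number zero has ghost number `-gh i`, so moving `xⁱ`
across it costs `(-1)^(gh i * gh i)`, and `k² ≡ k` modulo `2`. -/
theorem dR_eq_of_homogeneous_zero {f : FormalFun 𝕜 gh} (hf : IsHomogeneous 0 f) (i : Fin n) :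
    dR i f = sg 𝕜 (gh i) • dL i f := by
  refine ext' fun m hm => ?_
  rw [coeff_smul, coeff_dL hm, coeff_dR hm]
  by_cases h0 : coeff (m + Finsupp.single i 1) f = 0
  · simp [h0]
  · have hadm : Admissible gh (m + Finsupp.single i 1) := by
      by_contra h; exact h0 (coeff_of_not _ h)
    have h1 := isHomogeneous_iff.1 hf _ h0
    rw [gd_add, gd_single] at h1
    rw [koszul_swap hadm, gd_single, show gd gh m = -gh i by omega,
      sg_congr 𝕜 (a := -gh i * gh i) (b := gh i)]
    · ring
    · rw [show -gh i * gh i - gh i = -(gh i * (gh i + 1)) by ring]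
      exact (Int.even_mul_succ_self _).neg

theorem coeff_X_mul {j : Fin n} {m : Fin n →₀ ℕ} (h : Admissible gh (Finsupp.single j 1 + m))
    (f : FormalFun 𝕜 gh) : coeff (Finsupp.single j 1 + m) (X j * f) =
      koszul 𝕜 gh (Finsupp.single j 1) m * coeff m f := by
  rw [coeff_mul h, Finset.sum_eq_single (Finsupp.single j 1, m)]
  · rw [coeff_X, if_pos rfl, one_mul]
  · rintro ⟨a, b⟩ hab hne
    rw [Finset.HasAntidiagonal.mem_antidiagonal] at hab
    rw [coeff_X, if_neg]
    · simp
    · rintro rfl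
      have hb : b = m := add_left_cancel hab
      exact hne (by rw [hb])
  · simp

theorem coeff_X_mul_of_eq_zero {j : Fin n} {m : Fin n →₀ ℕ} (h : m j = 0)
    (f : FormalFun 𝕜 gh) : coeff m (X j * f) = 0 := by
  by_cases hm : Admissible gh m
  · rw [coeff_mul hm]
    refine Finset.sum_eq_zero ?_
    rintro ⟨a, b⟩ hab
    rw [Finset.HasAntidiagonal.mem_antidiagonal] at hab
    rw [coeff_X, if_neg]
    · simp
    · rintro rfl
      rw [← hab] at h
      simp at h
  · exact coeff_of_not _ hm

theorem dL_one (i : Fin n) : dL i (1 : FormalFun 𝕜 gh) = 0 := ext' fun m hm => by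
  rw [coeff_dL hm, coeff_one, if_neg, mul_zero, coeff_zero]
  intro h
  simpa using DFunLike.congr_fun h i

theorem exists_eq_single_add {j : Fin n} {m : Fin n →₀ ℕ} (h : m j ≠ 0) :
    ∃ m', m = Finsupp.single j 1 + m' := by
  refine exists_add_of_le ?_
  rw [Finsupp.single_le_iff]
  exact Nat.one_le_iff_ne_zero.2 h

/-- The Leibniz rule for a coordinate as left factor, from which the general rule follows by
induction on monomials. The coefficients are compared according to whether `i = j` and whether `xʲ`
divides the monomial. -/
theorem dL_X_mul (i j : Fin n) (f : FormalFun 𝕜 gh) :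
    dL i (X j * f) = (if i = j then f else 0) + sg 𝕜 (gh i * gh j) • (X j * dL i f) := by
  refine ext' fun m hm => ?_
  rw [coeff_dL hm, coeff_add, coeff_smul]
  by_cases hij : i = j
  · subst hij
    rw [if_pos rfl, add_comm m]
    by_cases hmi : m i = 0
    · have hadm : Admissible gh (Finsupp.single i 1 + m) := by
        intro k hk
        rw [Finsupp.add_apply, Finsupp.single_apply]
        split_ifs with h
        · rw [← h, hmi]
        · simpa using hm k hk
      rw [coeff_X_mul hadm, coeff_X_mul_of_eq_zero hmi, hmi]
      linear_combination coeff m f * koszul_mul_self (𝕜 := 𝕜) (gh := gh) (Finsupp.single i 1) m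
    · obtain ⟨m', rfl⟩ := exists_eq_single_add hmi
      have e1 := koszul_mul_self (𝕜 := 𝕜) (gh := gh) (Finsupp.single i 1) m'
      rw [coeff_X_mul hm, coeff_dL hm.of_add_right, add_comm m']
      by_cases hodd : Odd (gh i)
      -- For odd `xⁱ` the left side involves `(xⁱ)² = 0`, and the two terms on the right cancel
      -- because the sign is `-1`.
      · have hn : ¬ Admissible gh (Finsupp.single i 1 + (Finsupp.single i 1 + m')) := fun h => by
          have := h i hodd
          simp at this
        have hm' : m' i = 0 := by
          have := hm i hodd
          simp at this
          omega
        rw [coeff_of_not _ hn, sg_eq_ite, if_neg (by simpa [Int.even_mul] using hodd), hm']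
        push_cast
        linear_combination coeff (Finsupp.single i 1 + m') f * e1
      · rw [Int.not_odd_iff_even] at hodd
        have hn : Admissible gh (Finsupp.single i 1 + (Finsupp.single i 1 + m')) := by
          intro k hk
          rw [Finsupp.add_apply, Finsupp.single_eq_of_ne, zero_add]
          · exact hm k hk
          · rintro rfl; exact (Int.not_odd_iff_even.2 hodd) hk
        have e2 := koszul_mul_self (𝕜 := 𝕜) (gh := gh) (Finsupp.single i 1) (Finsupp.single i 1 + m')
        rw [coeff_X_mul hn, sg_even _ (hodd.mul_left _)]
        simp only [Finsupp.add_apply, Finsupp.single_eq_same]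
        push_cast
        -- For even `xⁱ` the identity is `m' i + 2 = 1 + (m' i + 1)`, up to squares of Koszul signs.
        linear_combination (m' i + 2) * coeff (Finsupp.single i 1 + m') f * e2 -
          (m' i + 1) * coeff (Finsupp.single i 1 + m') f * e1
  · rw [if_neg hij, coeff_zero, zero_add]
    by_cases hmj : m j = 0
    · rw [coeff_X_mul_of_eq_zero hmj, coeff_X_mul_of_eq_zero]
      · simp
      · simp [hmj, Finsupp.single_eq_of_ne (Ne.symm hij)]
    · obtain ⟨m', rfl⟩ := exists_eq_single_add hmj
      rw [coeff_X_mul hm, coeff_dL hm.of_add_right]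
      have hij' : (Finsupp.single j 1 : Fin n →₀ ℕ) i = 0 := Finsupp.single_eq_of_ne hij
      have e0 : koszul 𝕜 gh (Finsupp.single i 1) (Finsupp.single j 1) = sg 𝕜 (gh i * gh j) *
          koszul 𝕜 gh (Finsupp.single j 1) (Finsupp.single i 1) := by
        rw [koszul_swap, gd_single, gd_single]
        intro k _
        rw [Finsupp.add_apply, Finsupp.single_apply, Finsupp.single_apply]
        split_ifs with h1 h2
        · exact absurd (h1.trans h2.symm) hij
        all_goals simp
      have e1 := koszul_mul_self (𝕜 := 𝕜) (gh := gh) (Finsupp.single j 1) (Finsupp.single i 1)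
      by_cases hadm : Admissible gh (Finsupp.single j 1 + (m' + Finsupp.single i 1))
      · rw [add_assoc, coeff_X_mul hadm, koszul_add_right, koszul_add_right, e0]
        simp only [Finsupp.add_apply, hij', zero_add]
        linear_combination (m' i + 1) * sg 𝕜 (gh i * gh j) *
          koszul 𝕜 gh (Finsupp.single i 1) m' * koszul 𝕜 gh (Finsupp.single j 1) m' *
          coeff (m' + Finsupp.single i 1) f * e1
      -- The monomials on the two sides differ by one factor `xʲ`. Since `i ≠ j`, the exponent at
      -- `j` is already controlled by `hm`, so both are admissible or neither is.
      · have : ¬ Admissible gh (m' + Finsupp.single i 1) := by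
          intro h
          refine hadm fun k hk => ?_
          by_cases hkj : k = j
          · have := hm k hk
            subst hkj
            simp only [Finsupp.add_apply, Finsupp.single_eq_same,
              Finsupp.single_eq_of_ne (Ne.symm hij)] at this ⊢
            omega
          · have := h k hk
            simpa [Finsupp.single_eq_of_ne hkj] using this
        rw [add_assoc, coeff_of_not _ hadm, coeff_of_not _ this]
        simp

theorem tw_X_mul (k : ℤ) (j : Fin n) (f : FormalFun 𝕜 gh) :
    tw gh k (X j * f) = sg 𝕜 (k * gh j) • (X j * tw gh k f) := by
  rw [tw_mul, tw_homogeneous (isHomogeneous_X j), smul_mul_assoc]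

/-- The graded Leibniz rule for partial derivatives. -/
theorem dL_mul (i : Fin n) (f g : FormalFun 𝕜 gh) :
    dL i (f * g) = dL i f * g + tw gh (gh i) f * dL i g := by
  let R : FormalFun 𝕜 gh → FormalFun 𝕜 gh →ₗ[𝕜] FormalFun 𝕜 gh := fun g => LinearMap.mulRight 𝕜 g
  -- Both sides are linear in `f` and lose at most one degree, so the rule propagates from `f` to
  -- `xʲ f`.
  have h := linearMap_ext (L := (dLL i).comp (R g))
    (L' := (R g).comp (dLL i) + (R (dL i g)).comp (tw gh (gh i))) 1
    (fun N f hf => dL_mem_Fil (mul_mem_Fil_right hf g))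
    (fun N f hf => Submodule.add_mem _ (mul_mem_Fil_right (dL_mem_Fil hf) g)
      (mul_mem_Fil_right (tw_mem_Fil (Fil_antitone (Nat.le_succ _) hf)) _))
    (by simp [R, dL_one, tw_one]) fun j f hf => ?_
  · exact LinearMap.congr_fun h f
  · simp only [LinearMap.comp_apply, LinearMap.add_apply, R, LinearMap.mulRight_apply,
      dLL_apply] at hf ⊢
    rw [mul_assoc, dL_X_mul, hf, dL_X_mul, tw_X_mul, add_mul, mul_add, smul_add, smul_mul_assoc,
      smul_mul_assoc, mul_assoc, mul_assoc, add_assoc]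
    split_ifs <;> simp

theorem dL_X (i j : Fin n) : dL i (X j : FormalFun 𝕜 gh) = if i = j then 1 else 0 := by
  have := dL_X_mul (𝕜 := 𝕜) (gh := gh) i j 1
  simpa [dL_one] using this

theorem dL_dL (i j : Fin n) (f : FormalFun 𝕜 gh) :
    dL i (dL j f) = sg 𝕜 (gh i * gh j) • dL j (dL i f) := by
  have h := linearMap_ext (L := (dLL i).comp (dLL (gh := gh) (𝕜 := 𝕜) j))
    (L' := sg 𝕜 (gh i * gh j) • (dLL j).comp (dLL i)) 2
    (fun N f hf => dL_mem_Fil (dL_mem_Fil hf))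
    (fun N f hf => Submodule.smul_mem _ _ (dL_mem_Fil (dL_mem_Fil hf)))
    (by
      have : ∀ i, dL i (0 : FormalFun 𝕜 gh) = 0 := fun i => map_zero (dLL i)
      simp [dL_one, this]) fun k f hf => ?_
  · exact LinearMap.congr_fun h f
  · simp only [LinearMap.comp_apply, LinearMap.smul_apply, dLL_apply] at hf ⊢
    have ha : ∀ i (f g : FormalFun 𝕜 gh), dL i (f + g) = dL i f + dL i g :=
      fun i => map_add (dLL i)
    have hs : ∀ i c (f : FormalFun 𝕜 gh), dL i (c • f) = c • dL i f := fun i => map_smul (dLL i)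
    have h0 : ∀ i, dL i (0 : FormalFun 𝕜 gh) = 0 := fun i => map_zero (dLL i)
    have s1 := sg_mul_self 𝕜 (gh i * gh j)
    rw [dL_X_mul, dL_X_mul, ha, ha, hs, hs, dL_X_mul, dL_X_mul, hf]
    simp only [mul_smul_comm]
    by_cases hjk : j = k <;> by_cases hik : i = k
    · subst hjk; subst hik
      simp only [if_true, smul_add, smul_smul]
      match_scalars <;> first | ring1 | linear_combination -s1
    · subst hjk
      simp only [if_true, if_neg hik, smul_add, smul_smul, h0, zero_add]
      match_scalars <;> first | ring1 | linear_combination -s1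
    · subst hik
      simp only [if_true, if_neg hjk, smul_add, smul_smul, h0, zero_add]
      rw [mul_comm (gh j) (gh i)]
    · simp only [if_neg hjk, if_neg hik, smul_smul, h0, zero_add]
      match_scalars; ring

/-! ## Derivations and vector fields -/

/-- A derivation of parity `e` of the algebra of formal functions, preserving the filtration. -/
structure IsDer (e : ℤ) (D : FormalFun 𝕜 gh →ₗ[𝕜] FormalFun 𝕜 gh) : Prop where
  leibniz : ∀ f g, D (f * g) = D f * g + tw gh e f * D g
  fil : ∀ N f, f ∈ Fil 𝕜 gh N → D f ∈ Fil 𝕜 gh N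

theorem IsDer.map_one {e : ℤ} {D : FormalFun 𝕜 gh →ₗ[𝕜] FormalFun 𝕜 gh} (h : IsDer e D) :
    D 1 = 0 := by
  have := h.leibniz 1 1
  simpa [tw_one] using this

theorem IsDer.ext {e : ℤ} {D D' : FormalFun 𝕜 gh →ₗ[𝕜] FormalFun 𝕜 gh} (h : IsDer e D)
    (h' : IsDer e D') (hX : ∀ i, D (X i) = D' (X i)) : D = D' :=
  linearMap_ext 0 (fun N f hf => h.fil N f hf) (fun N f hf => h'.fil N f hf)
    (by rw [h.map_one, h'.map_one])
    fun i f hf => by rw [h.leibniz, h'.leibniz, hX, hf]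

/-- The formal vector field with components `v`, as a linear map. -/
def vfL (v : Fin n → FormalFun 𝕜 gh) : FormalFun 𝕜 gh →ₗ[𝕜] FormalFun 𝕜 gh :=
  ∑ i, (LinearMap.mulLeft 𝕜 (v i)).comp (dLL i)

theorem vfL_apply (v : Fin n → FormalFun 𝕜 gh) (f : FormalFun 𝕜 gh) :
    vfL v f = vectorField v f := by
  simp [vfL, vectorField, LinearMap.sum_apply]

theorem vfL_apply' (v : Fin n → FormalFun 𝕜 gh) (f : FormalFun 𝕜 gh) :
    vfL v f = ∑ i, v i * dL i f := vfL_apply v f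

theorem vfL_X (v : Fin n → FormalFun 𝕜 gh) (j : Fin n) : vfL v (X j) = v j := by
  simp [vfL_apply', dL_X]

theorem vfL_homogeneous {v : Fin n → FormalFun 𝕜 gh} {e k : ℤ}
    (hv : ∀ i, IsHomogeneous (gh i + e) (v i)) {f : FormalFun 𝕜 gh} (hf : IsHomogeneous k f) :
    IsHomogeneous (k + e) (vfL v f) := by
  rw [vfL_apply']
  exact IsHomogeneous.sum fun i _ => (hv i).mul' (hf.dL i) (by ring)

/-- Components without constant term compensate for the degree lost in differentiation, which is why
such vector fields preserve the filtration. -/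
theorem vfL_isDer {v : Fin n → FormalFun 𝕜 gh} {e : ℤ}
    (hv : ∀ i, IsHomogeneous (gh i + e) (v i)) (h0 : ∀ i, v i ∈ Fil 𝕜 gh 1) : IsDer e (vfL v) where
  leibniz f g := by
    simp only [vfL_apply', Finset.sum_mul, Finset.mul_sum, dL_mul, mul_add, Finset.sum_add_distrib]
    congr 1
    · exact Finset.sum_congr rfl fun i _ => by rw [mul_assoc]
    · refine Finset.sum_congr rfl fun i _ => ?_
      -- Passing `∂ᵢ` and then `vⁱ` across `f` twists by `gh i` and by `gh i + e`; the total has the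
      -- parity of `e`.
      rw [← mul_assoc, mul_comm_tw (hv i), tw_tw, mul_assoc, tw_congr (l := e)]
      exact ⟨gh i, by ring⟩
  fil N f hf := by
    rw [vfL_apply']
    refine Submodule.sum_mem _ fun i _ => ?_
    cases N with
    | zero => exact mem_Fil_zero _
    | succ N =>
      rw [add_comm]
      exact mul_mem_Fil (h0 i) (dL_mem_Fil hf)

theorem IsDer.tw_comm {e : ℤ} {D : FormalFun 𝕜 gh →ₗ[𝕜] FormalFun 𝕜 gh} (h : IsDer e D)
    (hh : ∀ i, IsHomogeneous (gh i + e) (D (X i))) (k : ℤ) (f : FormalFun 𝕜 gh) :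
    D (tw gh k f) = sg 𝕜 (k * e) • tw gh k (D f) := by
  have := linearMap_ext (L := D.comp (tw gh k)) (L' := sg 𝕜 (k * e) • (tw gh k).comp D) 0
    (fun N f hf => h.fil _ _ (tw_mem_Fil hf))
    (fun N f hf => Submodule.smul_mem _ _ (tw_mem_Fil (h.fil _ _ hf)))
    (by simp [tw_one, h.map_one]) fun j f hf => ?_
  · exact LinearMap.congr_fun this f
  · simp only [LinearMap.comp_apply, LinearMap.smul_apply] at hf ⊢
    rw [tw_X_mul, map_smul, h.leibniz, hf, h.leibniz, map_add, tw_mul, tw_mul,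
      tw_homogeneous (hh j), tw_homogeneous (isHomogeneous_X j), map_smul,
      tw_homogeneous (isHomogeneous_X j)]
    simp only [smul_add, smul_mul_assoc, mul_smul_comm, smul_smul]
    rw [mul_add, sg_add]
    congr 2
    · linear_combination (-sg 𝕜 (k * gh j)) * sg_mul_self 𝕜 (k * e)
    · ring

/-- The graded commutator of two odd derivations is an even derivation. -/
theorem IsDer.anticomm {D D' : FormalFun 𝕜 gh →ₗ[𝕜] FormalFun 𝕜 gh} {e e' : ℤ} (he : Odd e)
    (he' : Odd e') (h : IsDer e D) (h' : IsDer e' D')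
    (hh : ∀ i, IsHomogeneous (gh i + e) (D (X i))) (hh' : ∀ i, IsHomogeneous (gh i + e') (D' (X i))) :
    IsDer 0 (D.comp D' + D'.comp D) where
  leibniz f g := by
    have t1 : sg 𝕜 (e' * e) = -1 := by
      rw [sg_eq_ite, if_neg]; simpa [Int.even_mul] using ⟨he', he⟩
    have t2 : sg 𝕜 (e * e') = -1 := by rw [mul_comm]; exact t1
    simp only [LinearMap.add_apply, LinearMap.comp_apply, h.leibniz, h'.leibniz, map_add,
      h.tw_comm hh, h'.tw_comm hh', tw_tw, t1, t2, tw_zero]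
    rw [tw_even (he.add_odd he'), tw_even (he'.add_odd he),
      tw_congr (k := e') (l := e) (he'.sub_odd he) (D f)]
    simp only [neg_smul, one_smul, neg_mul, mul_add, add_mul]
    abel
  fil N f hf := Submodule.add_mem _ (h.fil _ _ (h'.fil _ _ hf)) (h'.fil _ _ (h.fil _ _ hf))

/-- Twice the square of an odd derivation is its graded commutator with itself, an even derivation,
so it is determined by its values on coordinates. -/
theorem IsDer.sq_eq_zero [CharZero 𝕜] {D : FormalFun 𝕜 gh →ₗ[𝕜] FormalFun 𝕜 gh} {e : ℤ} (he : Odd e)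
    (h : IsDer e D) (hh : ∀ i, IsHomogeneous (gh i + e) (D (X i))) (hX : ∀ i, D (D (X i)) = 0)
    (f : FormalFun 𝕜 gh) : D (D f) = 0 := by
  have h1 := IsDer.anticomm he he h h hh hh
  have h2 : D.comp D + D.comp D = 0 := h1.ext
    ⟨fun f g => by simp, fun N f _ => Submodule.zero_mem _⟩ fun i => by simp [hX]
  have h3 := LinearMap.congr_fun h2 f
  simp only [LinearMap.add_apply, LinearMap.comp_apply, LinearMap.zero_apply] at h3
  rw [← two_smul 𝕜] at h3
  simpa using h3

/-! ## Linear forms -/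

theorem linForm_mem_Fil {k : ℕ} (M : Matrix (Fin k) (Fin n) 𝕜) (i : Fin k) :
    linForm gh M i ∈ Fil 𝕜 gh 1 :=
  Submodule.sum_mem _ fun j _ => Submodule.smul_mem _ _ (X_mem_Fil j)

theorem linForm_homogeneous {k : ℕ} {M : Matrix (Fin k) (Fin n) 𝕜} {i : Fin k} {e : ℤ}
    (h : ∀ j, M i j ≠ 0 → gh j = e) : IsHomogeneous e (linForm gh M i) :=
  IsHomogeneous.sum fun j _ => IsHomogeneous.smul_of_ne fun hj => h j hj ▸ isHomogeneous_X j

theorem map_linForm {W : Type*} [AddCommGroup W] [Module 𝕜 W] (L : FormalFun 𝕜 gh →ₗ[𝕜] W) {k : ℕ}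
    (M : Matrix (Fin k) (Fin n) 𝕜) (i : Fin k) : L (linForm gh M i) = ∑ j, M i j • L (X j) := by
  simp [linForm, map_sum]

theorem sum_smul_linForm {k l : ℕ} (A : Matrix (Fin l) (Fin k) 𝕜) (M : Matrix (Fin k) (Fin n) 𝕜)
    (i : Fin l) : ∑ j, A i j • linForm gh M j = linForm gh (A * M) i := by
  simp only [linForm, Matrix.mul_apply, Finset.smul_sum, Finset.sum_smul, smul_smul]
  rw [Finset.sum_comm]

theorem linForm_one (i : Fin n) : linForm gh (1 : Matrix (Fin n) (Fin n) 𝕜) i = X i := by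
  simp [linForm, Matrix.one_apply]

theorem linForm_add {k : ℕ} (M M' : Matrix (Fin k) (Fin n) 𝕜) (i : Fin k) :
    linForm gh (M + M') i = linForm gh M i + linForm gh M' i := by
  simp [linForm, add_smul, Finset.sum_add_distrib]

theorem linForm_smul {k : ℕ} (c : 𝕜) (M : Matrix (Fin k) (Fin n) 𝕜) (i : Fin k) :
    linForm gh (c • M) i = c • linForm gh M i := by
  simp [linForm, Finset.smul_sum, smul_smul]

theorem linForm_zero {k : ℕ} (i : Fin k) :
    linForm gh (0 : Matrix (Fin k) (Fin n) 𝕜) i = 0 := by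
  simp [linForm]

/-! ## Substitution -/

/-- The components of a formal map to a graded space with coordinates of ghost numbers `ghT`. -/
structure IsMap {k : ℕ} (ghT : Fin k → ℤ) (g : Fin k → FormalFun 𝕜 gh) : Prop where
  hom : ∀ i, IsHomogeneous (ghT i) (g i)
  fil : ∀ i, g i ∈ Fil 𝕜 gh 1

theorem FormalMap.isMap {k : ℕ} {ghT : Fin k → ℤ} (g : FormalMap 𝕜 gh ghT) : IsMap ghT g.comp :=
  ⟨g.homogeneous, fun i => mem_Fil_one.2 (g.constantCoeff i)⟩

theorem IsHomogeneous.pow {k : ℤ} {f : FormalFun 𝕜 gh} (hf : IsHomogeneous k f) (m : ℕ) :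
    IsHomogeneous (m * k) (f ^ m) := by
  induction m with
  | zero => simpa using isHomogeneous_one
  | succ m ih => rw [pow_succ]; exact ih.mul' hf (by push_cast; ring)

theorem pow_mem_Fil {f : FormalFun 𝕜 gh} (hf : f ∈ Fil 𝕜 gh 1) (m : ℕ) : f ^ m ∈ Fil 𝕜 gh m := by
  induction m with
  | zero => exact mem_Fil_zero _
  | succ m ih => rw [pow_succ]; exact mul_mem_Fil ih hf

/-- The ordered product `(g⁰)^(m 0) (g¹)^(m 1) ⋯`. -/
def prodPow {k : ℕ} (g : Fin k → FormalFun 𝕜 gh) (m : Fin k → ℕ) : FormalFun 𝕜 gh :=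
  (List.ofFn fun i => g i ^ m i).prod

theorem prodPow_succ {k : ℕ} (g : Fin (k + 1) → FormalFun 𝕜 gh) (m : Fin (k + 1) → ℕ) :
    prodPow g m = g 0 ^ m 0 * prodPow (fun i => g i.succ) fun i => m i.succ := by
  simp [prodPow, List.ofFn_succ]

theorem prodPow_mem_Fil {k : ℕ} {g : Fin k → FormalFun 𝕜 gh} (hg : ∀ i, g i ∈ Fil 𝕜 gh 1)
    (m : Fin k → ℕ) : prodPow g m ∈ Fil 𝕜 gh (∑ i, m i) := by
  induction k with
  | zero => simpa using mem_Fil_zero _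
  | succ k ih =>
    rw [prodPow_succ, Fin.sum_univ_succ]
    exact mul_mem_Fil (pow_mem_Fil (hg 0) _) (ih (fun i => hg i.succ) _)

theorem prodPow_homogeneous {k : ℕ} {ghT : Fin k → ℤ} {g : Fin k → FormalFun 𝕜 gh}
    (hg : ∀ i, IsHomogeneous (ghT i) (g i)) (m : Fin k → ℕ) :
    IsHomogeneous (∑ i, (m i : ℤ) * ghT i) (prodPow g m) := by
  induction k with
  | zero => simpa [prodPow] using isHomogeneous_one
  | succ k ih =>
    rw [prodPow_succ, Fin.sum_univ_succ]
    exact ((hg 0).pow _).mul (ih (fun i => hg i.succ) _)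

/-- The factor `g i` moves to its place across the powers of `g j` with `j < i`. The sign is the
Koszul sign of the corresponding monomials, which is what makes substitution multiplicative. -/
theorem mul_prodPow {k : ℕ} {ghT : Fin k → ℤ} {g : Fin k → FormalFun 𝕜 gh}
    (hg : ∀ i, IsHomogeneous (ghT i) (g i)) (m : Fin k → ℕ) (i : Fin k) :
    g i * prodPow g m = sg 𝕜 (∑ j, if j < i then (m j : ℤ) * (ghT i * ghT j) else 0) •
      prodPow g fun j => if j = i then m j + 1 else m j := by
  induction k with
  | zero => exact i.elim0
  | succ k ih =>
    rw [prodPow_succ, prodPow_succ, Fin.sum_univ_succ]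
    refine Fin.cases ?_ (fun i => ?_) i
    · simp [pow_succ', mul_assoc, Fin.succ_ne_zero]
    · rw [← mul_assoc, mul_comm_tw (hg i.succ), tw_homogeneous ((hg 0).pow (m 0)), smul_mul_assoc,
        smul_mul_assoc, mul_assoc, ih (fun i => hg i.succ) (fun i => m i.succ) i, mul_smul_comm,
        smul_smul, sg_add]
      simp only [Fin.succ_pos, if_true, Fin.succ_lt_succ_iff, (Fin.succ_ne_zero i).symm, if_false,
        Fin.succ_inj]
      rw [show ghT i.succ * ((m 0 : ℤ) * ghT 0) = (m 0 : ℤ) * (ghT i.succ * ghT 0) by ring]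

theorem koszul_single_left (i : Fin n) (m : Fin n →₀ ℕ) : koszul 𝕜 gh (Finsupp.single i 1) m =
    sg 𝕜 (∑ j, if j < i then (m j : ℤ) * (gh i * gh j) else 0) := by
  rw [koszul_eq_sg, Finset.sum_eq_single i]
  · simp [Finset.sum_filter]
  · intro j _ hj
    simp [Finsupp.single_eq_of_ne hj]
  · simp

theorem mul_prodPow' {ghT : Fin n → ℤ} {g : Fin n → FormalFun 𝕜 gh'}
    (hg : ∀ i, IsHomogeneous (ghT i) (g i)) (m : Fin n →₀ ℕ) (i : Fin n) :
    g i * prodPow g m = koszul 𝕜 ghT (Finsupp.single i 1) m • prodPow g (Finsupp.single i 1 + m : Fin n →₀ ℕ) := by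
  rw [mul_prodPow hg, koszul_single_left]
  congr 2
  ext j
  by_cases h : j = i
  · subst h; simp [add_comm]
  · simp [h, Finsupp.single_eq_of_ne h]

/-- Odd elements square to zero in characteristic zero. So the ordered product agrees with the image
of the monomial also when that monomial is zero. -/
theorem prodPow_of_not_admissible [CharZero 𝕜] {k : ℕ} {ghT : Fin k → ℤ} {g : Fin k → FormalFun 𝕜 gh}
    (hg : ∀ i, IsHomogeneous (ghT i) (g i)) {m : Fin k →₀ ℕ} (hm : ¬ Admissible ghT m) :
    prodPow g m = 0 := by
  simp only [Admissible, not_forall, not_le] at hm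
  obtain ⟨i, hi, hlt⟩ := hm
  refine List.prod_eq_zero ?_
  rw [List.mem_ofFn]
  refine ⟨i, ?_⟩
  obtain ⟨r, hr⟩ := Nat.exists_eq_add_of_le' hlt
  rw [hr, pow_add, pow_two, (hg i).mul_self hi, mul_zero]

section Subst

variable {k : ℕ} {ghT : Fin k → ℤ}

/-- A product of `|m|` series without constant term starts in degree `|m|`, so the cutoff may be any
bound for the degree of `l`. This allows one index set for several coefficients. -/
theorem coeff_subst {g : Fin k → FormalFun 𝕜 gh} (hg : ∀ i, g i ∈ Fil 𝕜 gh 1) (f : FormalFun 𝕜 ghT)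
    {l : Fin n →₀ ℕ} {N : ℕ} (hN : l.degree ≤ N) :
    coeff l (subst g f) = ∑ m ∈ mons k N, coeff m f * coeff l (prodPow g m) := by
  by_cases hl : Admissible gh l
  · have h1 : coeff l (subst g f) =
        ∑ m ∈ mons k l.degree, coeff m f * coeff l (prodPow g m) := by
      rw [subst, coeff_mk _ hl, mons, Finset.sum_biUnion]
      · rfl
      · intro a _ b _ hab
        rw [Function.onFun, Finset.disjoint_left]
        intro m ha hb
        rw [mem_finsuppAntidiag_iff_degree] at ha hb
        exact hab (ha.symm.trans hb)
    rw [h1]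
    refine Finset.sum_subset (fun m hm => mem_mons.2 ((mem_mons.1 hm).trans hN)) fun m _ hm => ?_
    rw [mem_mons, not_le] at hm
    rw [prodPow_mem_Fil hg m l (by rwa [← Finsupp.degree_eq_sum]), mul_zero]
  · simp [coeff_of_not _ hl]

theorem subst_add (g : Fin k → FormalFun 𝕜 gh) (f f' : FormalFun 𝕜 ghT) :
    subst g (f + f') = subst g f + subst g f' := ext' fun l hl => by
  simp only [subst, coeff_mk _ hl, coeff_add, add_mul, Finset.sum_add_distrib]

theorem subst_smul (g : Fin k → FormalFun 𝕜 gh) (c : 𝕜) (f : FormalFun 𝕜 ghT) :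
    subst g (c • f) = c • subst g f := ext' fun l hl => by
  simp only [subst, coeff_mk _ hl, coeff_smul, mul_assoc, Finset.mul_sum]

/-- Substitution as a linear map. -/
def substL (ghT : Fin k → ℤ) (g : Fin k → FormalFun 𝕜 gh) : FormalFun 𝕜 ghT →ₗ[𝕜] FormalFun 𝕜 gh where
  toFun := subst g
  map_add' := subst_add g
  map_smul' := subst_smul g

@[simp] theorem substL_apply (g : Fin k → FormalFun 𝕜 gh) (f : FormalFun 𝕜 ghT) :
    substL ghT g f = subst g f := rfl

theorem subst_mem_Fil {g : Fin k → FormalFun 𝕜 gh} (hg : ∀ i, g i ∈ Fil 𝕜 gh 1) {N : ℕ}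
    {f : FormalFun 𝕜 ghT} (hf : f ∈ Fil 𝕜 ghT N) : subst g f ∈ Fil 𝕜 gh N := by
  intro l hl
  rw [coeff_subst hg f le_rfl]
  refine Finset.sum_eq_zero fun m hm => ?_
  rw [hf m ((mem_mons.1 hm).trans_lt hl), zero_mul]

theorem subst_homogeneous {g : Fin k → FormalFun 𝕜 gh} (hg : IsMap ghT g) {e : ℤ}
    {f : FormalFun 𝕜 ghT} (hf : IsHomogeneous e f) : IsHomogeneous e (subst g f) := by
  intro l hl
  rw [coeff_subst hg.fil f le_rfl] at hl
  obtain ⟨m, _, hm⟩ := Finset.exists_ne_zero_of_sum_ne_zero hl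
  rw [← hf m (left_ne_zero_of_mul hm)]
  exact prodPow_homogeneous hg.hom m l (right_ne_zero_of_mul hm)

theorem IsMap.subst {l : ℕ} {ghU : Fin l → ℤ} {g : Fin k → FormalFun 𝕜 gh} (hg : IsMap ghT g)
    {h : Fin l → FormalFun 𝕜 ghT} (hh : IsMap ghU h) : IsMap ghU fun i => subst g (h i) :=
  ⟨fun i => subst_homogeneous hg (hh.hom i), fun i => subst_mem_Fil hg.fil (hh.fil i)⟩

theorem isMap_X : IsMap gh (X : Fin n → FormalFun 𝕜 gh) := ⟨isHomogeneous_X, X_mem_Fil⟩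

variable [CharZero 𝕜]

theorem subst_mono {g : Fin k → FormalFun 𝕜 gh} (hg : IsMap ghT g) (m : Fin k →₀ ℕ) :
    subst g (mono ghT m) = prodPow g m := by
  refine ext' fun l _ => ?_
  by_cases hm : Admissible ghT m
  · rw [coeff_subst hg.fil _ (le_max_left l.degree m.degree), Finset.sum_eq_single m]
    · rw [coeff_mono hm, if_pos rfl, one_mul]
    · intro b _ hb
      rw [coeff_mono_of_ne hb, zero_mul]
    · intro h
      exact absurd (mem_mons.2 (le_max_right _ _)) h
  · rw [mono_of_not hm, prodPow_of_not_admissible hg.hom hm]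
    exact congrArg _ (map_zero (substL ghT g))

theorem subst_one {g : Fin k → FormalFun 𝕜 gh} (hg : IsMap ghT g) :
    subst g (1 : FormalFun 𝕜 ghT) = 1 := by
  rw [one_eq_mono, subst_mono hg]
  exact List.prod_eq_one (by simp)

/-- By continuity this is a statement about monomials, where both sides acquire the same Koszul
sign. -/
theorem subst_X_mul {g : Fin k → FormalFun 𝕜 gh} (hg : IsMap ghT g) (i : Fin k)
    (f : FormalFun 𝕜 ghT) : subst g (X i * f) = g i * subst g f := by
  have := linearMap_eq_zero_of_mono (L := (substL ghT g).comp (LinearMap.mulLeft 𝕜 (X i)) -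
    (LinearMap.mulLeft 𝕜 (g i)).comp (substL ghT g)) 0
    (fun N f hf => Submodule.sub_mem _ (subst_mem_Fil hg.fil (mul_mem_Fil_left _ hf))
      (mul_mem_Fil_left _ (subst_mem_Fil hg.fil hf))) fun m => ?_
  · exact sub_eq_zero.1 (LinearMap.congr_fun this f)
  · simp only [LinearMap.sub_apply, LinearMap.comp_apply, LinearMap.mulLeft_apply, substL_apply]
    rw [X_eq_mono, mono_mul_mono, subst_smul, subst_mono hg, subst_mono hg, mul_prodPow' hg.hom,
      sub_self]

theorem subst_X {g : Fin k → FormalFun 𝕜 gh} (hg : IsMap ghT g) (i : Fin k) :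
    subst g (X i : FormalFun 𝕜 ghT) = g i := by
  have := subst_X_mul hg i 1
  rwa [subst_one hg, mul_one, mul_one] at this

theorem subst_mul {g : Fin k → FormalFun 𝕜 gh} (hg : IsMap ghT g) (f f' : FormalFun 𝕜 ghT) :
    subst g (f * f') = subst g f * subst g f' := by
  have := linearMap_ext (L := (substL ghT g).comp (LinearMap.mulRight 𝕜 f'))
    (L' := (LinearMap.mulRight 𝕜 (subst g f')).comp (substL ghT g)) 0
    (fun N f hf => subst_mem_Fil hg.fil (mul_mem_Fil_right hf _))
    (fun N f hf => mul_mem_Fil_right (subst_mem_Fil hg.fil hf) _)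
    (by simp [subst_one hg]) fun i f hf => ?_
  · exact LinearMap.congr_fun this f
  · simp only [LinearMap.comp_apply, LinearMap.mulRight_apply, substL_apply] at hf ⊢
    rw [mul_assoc, subst_X_mul hg, subst_X_mul hg, hf, mul_assoc]

/-- A multiplicative linear map preserving the filtrations is determined by the images of the
coordinates. -/
theorem eq_subst_of_mul {g : Fin k → FormalFun 𝕜 gh} (hg : IsMap ghT g)
    {φ : FormalFun 𝕜 ghT →ₗ[𝕜] FormalFun 𝕜 gh}
    (hfil : ∀ N f, f ∈ Fil 𝕜 ghT N → φ f ∈ Fil 𝕜 gh N) (h1 : φ 1 = 1)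
    (hX : ∀ i f, φ (X i * f) = g i * φ f) : φ = substL ghT g :=
  linearMap_ext 0 (fun N f hf => hfil N f hf) (fun N f hf => subst_mem_Fil hg.fil hf)
    (by rw [h1, substL_apply, subst_one hg]) fun i f hf => by
      rw [hX, hf, substL_apply, substL_apply, subst_X_mul hg]

theorem subst_subst {l : ℕ} {ghU : Fin l → ℤ} {g : Fin k → FormalFun 𝕜 gh} (hg : IsMap ghT g)
    {h : Fin l → FormalFun 𝕜 ghT} (hh : IsMap ghU h) (f : FormalFun 𝕜 ghU) :
    subst g (subst h f) = subst (fun i => subst g (h i)) f := by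
  have := eq_subst_of_mul (hg.subst hh) (φ := (substL ghT g).comp (substL ghU h))
    (fun N f hf => subst_mem_Fil hg.fil (subst_mem_Fil hh.fil hf))
    (by simp [subst_one hg, subst_one hh])
    fun i f => by simp [subst_X_mul hh, subst_mul hg]
  exact LinearMap.congr_fun this f

theorem subst_id (f : FormalFun 𝕜 gh) : subst X f = f := by
  have := eq_subst_of_mul isMap_X (φ := (LinearMap.id : FormalFun 𝕜 gh →ₗ[𝕜] FormalFun 𝕜 gh))
    (fun N f hf => hf) rfl fun i f => rfl
  exact (LinearMap.congr_fun this f).symm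

/-- The chain rule. -/
theorem dL_subst {g : Fin k → FormalFun 𝕜 gh} (hg : IsMap ghT g) (b : Fin n) (f : FormalFun 𝕜 ghT) :
    dL b (subst g f) = ∑ j, dL b (g j) * subst g (dL j f) := by
  have hs : ∀ f, (∑ j, (LinearMap.mulLeft 𝕜 (dL b (g j))).comp ((substL ghT g).comp (dLL j))) f =
      ∑ j, dL b (g j) * subst g (dL j f) := fun f => by
    simp [LinearMap.sum_apply]
  have := linearMap_ext (L := (dLL b).comp (substL ghT g))
    (L' := ∑ j, (LinearMap.mulLeft 𝕜 (dL b (g j))).comp ((substL ghT g).comp (dLL j))) 1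
    (fun N f hf => dL_mem_Fil (subst_mem_Fil hg.fil hf))
    (fun N f hf => by
      rw [hs]
      exact Submodule.sum_mem _ fun j _ => mul_mem_Fil_left _ (subst_mem_Fil hg.fil (dL_mem_Fil hf)))
    (by
      rw [hs]
      have : subst g (0 : FormalFun 𝕜 ghT) = 0 := map_zero (substL ghT g)
      simp [subst_one hg, dL_one, this]) fun i f hf => ?_
  · exact (LinearMap.congr_fun this f).trans (hs f)
  · rw [hs] at hf ⊢
    simp only [LinearMap.comp_apply, dLL_apply, substL_apply] at hf ⊢
    rw [subst_X_mul hg, dL_mul, hf, tw_homogeneous (hg.hom i)]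
    -- Differentiating past `xⁱ` gives the sign of `ghT j * ghT i`, and moving `g i` to the front
    -- gives that of `(ghT j - gh b) * ghT i`. Together they have the parity of `gh b * ghT i`.
    have hterm : ∀ j, dL b (g j) * subst g (dL j (X i * f)) =
        (if j = i then dL b (g j) * subst g f else 0) +
          sg 𝕜 (gh b * ghT i) • (g i * (dL b (g j) * subst g (dL j f))) := fun j => by
      rw [dL_X_mul, subst_add, subst_smul, subst_X_mul hg, mul_add, mul_smul_comm, ← mul_assoc,
        ← mul_assoc, mul_comm_tw ((hg.hom j).dL b) (g i), tw_homogeneous (hg.hom i), smul_mul_assoc,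
        smul_mul_assoc, smul_smul, ← sg_add]
      congr 1
      · split_ifs
        · rfl
        · rw [show subst g (0 : FormalFun 𝕜 ghT) = 0 from map_zero (substL ghT g), mul_zero]
      · rw [sg_congr 𝕜]
        exact ⟨(ghT j - gh b) * ghT i, by ring⟩
    simp only [hterm, Finset.sum_add_distrib, Finset.sum_ite_eq', Finset.mem_univ, if_true,
      Finset.mul_sum, smul_mul_assoc]

end Subst

theorem linForm_isMap {k : ℕ} {ghT : Fin k → ℤ} {M : Matrix (Fin k) (Fin n) 𝕜}
    (h : ∀ i j, M i j ≠ 0 → gh j = ghT i) : IsMap ghT (linForm gh M) :=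
  ⟨fun i => linForm_homogeneous (h i), linForm_mem_Fil M⟩

/-! ## Hamiltonian vector fields -/

section Hamiltonian

variable {ω : Matrix (Fin n) (Fin n) 𝕜}

/-- Discarding the entries of the inverse matrix in the wrong degree still leaves a right inverse of
`ω`. By uniqueness of inverses nothing has been discarded. -/
theorem inv_deg (hdeg : ∀ i j, ω i j ≠ 0 → gh i + gh j = -1) (hu : IsUnit ω.det) {i j : Fin n}
    (hij : ω⁻¹ i j ≠ 0) : gh i + gh j = -1 := by
  let M : Matrix (Fin n) (Fin n) 𝕜 := fun i j => if gh i + gh j = -1 then ω⁻¹ i j else 0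
  have hM : ω * M = 1 := by
    ext a c
    have h1 : (ω * ω⁻¹) a c = (1 : Matrix (Fin n) (Fin n) 𝕜) a c := by
      rw [Matrix.mul_nonsing_inv _ hu]
    rw [Matrix.mul_apply] at h1 ⊢
    by_cases hac : gh a = gh c
    · rw [← h1]
      refine Finset.sum_congr rfl fun b _ => ?_
      by_cases hb : ω a b = 0
      · simp [hb]
      · have := hdeg a b hb
        simp only [M]
        rw [if_pos (by omega)]
    · rw [Matrix.one_apply_ne (by rintro rfl; exact hac rfl)]
      refine Finset.sum_eq_zero fun b _ => ?_
      by_cases hb : ω a b = 0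
      · simp [hb]
      · have := hdeg a b hb
        simp only [M]
        rw [if_neg (by omega), mul_zero]
  rw [Matrix.inv_eq_right_inv hM] at hij
  by_contra h
  exact hij (if_neg h)

theorem inv_symm (hs : ω.IsSymm) (i j : Fin n) : ω⁻¹ i j = ω⁻¹ j i := by
  have : ω⁻¹.transpose = ω⁻¹ := by rw [Matrix.transpose_nonsing_inv, hs.eq]
  exact (congrFun (congrFun this j) i)

/-- The components of the Hamiltonian vector field of an even function `S`. -/
def hamComp (ω : Matrix (Fin n) (Fin n) 𝕜) (S : FormalFun 𝕜 gh) (j : Fin n) : FormalFun 𝕜 gh :=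
  ∑ i, ω⁻¹ i j • dL i S

/-- For a function of ghost number zero, right and left derivatives differ exactly by the sign in
the definition of the bracket. -/
theorem bracket_eq {S : FormalFun 𝕜 gh} (hS : IsHomogeneous 0 S) (f : FormalFun 𝕜 gh) :
    bracket ω S f = vfL (hamComp ω S) f := by
  rw [vfL_apply', bracket, Finset.sum_comm]
  refine Finset.sum_congr rfl fun j _ => ?_
  rw [hamComp, Finset.sum_mul]
  refine Finset.sum_congr rfl fun i _ => ?_
  rw [dR_eq_of_homogeneous_zero hS, smul_mul_assoc, smul_mul_assoc, smul_smul]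
  congr 1
  change sg 𝕜 (gh i) * _ * _ = _
  linear_combination (ω⁻¹ i j) * sg_mul_self 𝕜 (gh i)

theorem hamComp_homogeneous (hdeg : ∀ i j, ω i j ≠ 0 → gh i + gh j = -1) (hu : IsUnit ω.det)
    {S : FormalFun 𝕜 gh} (hS : IsHomogeneous 0 S) (j : Fin n) :
    IsHomogeneous (gh j + 1) (hamComp ω S j) := by
  refine IsHomogeneous.sum fun i _ => IsHomogeneous.smul_of_ne fun h => ?_
  have := inv_deg hdeg hu h
  convert hS.dL i using 1
  omega

theorem hamComp_mem_Fil {S : FormalFun 𝕜 gh} {N : ℕ} (hS : S ∈ Fil 𝕜 gh (N + 1)) (j : Fin n) :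
    hamComp ω S j ∈ Fil 𝕜 gh N :=
  Submodule.sum_mem _ fun _ _ => Submodule.smul_mem _ _ (dL_mem_Fil hS)

theorem hamComp_add (S T : FormalFun 𝕜 gh) (j : Fin n) :
    hamComp ω (S + T) j = hamComp ω S j + hamComp ω T j := by
  have : ∀ i, dL i (S + T) = dL i S + dL i T := fun i => map_add (dLL i) S T
  simp [hamComp, this, Finset.sum_add_distrib]

theorem ham_isDer (hdeg : ∀ i j, ω i j ≠ 0 → gh i + gh j = -1) (hu : IsUnit ω.det)
    {S : FormalFun 𝕜 gh} (hS : IsHomogeneous 0 S) (hS2 : S ∈ Fil 𝕜 gh 2) :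
    IsDer 1 (vfL (hamComp ω S)) :=
  vfL_isDer (hamComp_homogeneous hdeg hu hS) (hamComp_mem_Fil hS2)

/-- Recovers the differential of the function from its Hamiltonian vector field by lowering the
index with `ω`. -/
theorem sum_hamComp_mul_of_symm (hs : ω.IsSymm) (hu : IsUnit ω.det) (S : FormalFun 𝕜 gh)
    (i : Fin n) : ∑ j, ω i j • hamComp ω S j = dL i S := by
  simp only [hamComp, Finset.smul_sum, smul_smul]
  rw [Finset.sum_comm]
  have : ∀ k, ∑ j, (ω i j * ω⁻¹ k j) • dL k S = (1 : Matrix (Fin n) (Fin n) 𝕜) i k • dL k S :=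
    fun k => by
      rw [← Finset.sum_smul, ← Matrix.mul_nonsing_inv _ hu, Matrix.mul_apply]
      congr 1
      exact Finset.sum_congr rfl fun j _ => by rw [inv_symm hs]
  simp [this, Matrix.one_apply]

/-- The classical master equation implies that the Hamiltonian vector field is cohomological. -/
theorem ham_sq [CharZero 𝕜] (hdeg : ∀ i j, ω i j ≠ 0 → gh i + gh j = -1) (hs : ω.IsSymm)
    (hu : IsUnit ω.det) {S : FormalFun 𝕜 gh} (hS : IsHomogeneous 0 S) (hS2 : S ∈ Fil 𝕜 gh 2)
    (hCME : bracket ω S S = 0) (f : FormalFun 𝕜 gh) :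
    vfL (hamComp ω S) (vfL (hamComp ω S) f) = 0 := by
  have hder := ham_isDer hdeg hu hS hS2
  have hL0 : ∀ i, dL i (0 : FormalFun 𝕜 gh) = 0 := fun i => map_zero (dLL i)
  have hLs : ∀ i c (f : FormalFun 𝕜 gh), dL i (c • f) = c • dL i f := fun i => map_smul (dLL i)
  -- Differentiating `{S, S} = 0` gives `± 2 Q(∂ᵢ S) = 0`. This suffices, because each `Q xʲ` is a
  -- combination of the `∂ᵢ S`.
  have hQs : ∀ i, vfL (hamComp ω S) (dL i S) = 0 := by
    intro i
    rw [bracket_eq hS, vfL_apply'] at hCME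
    have h1 : dL i (∑ j, hamComp ω S j * dL j S) = 0 := by rw [hCME, hL0]
    have h2 : dL i (∑ j, hamComp ω S j * dL j S) =
        ∑ a, ∑ b, (ω⁻¹ a b • (dL i (dL a S) * dL b S) +
          (ω⁻¹ a b * sg 𝕜 (gh i * gh a)) • (dL a S * dL i (dL b S))) := by
      rw [Finset.sum_comm]
      change dLL i _ = _
      rw [map_sum]
      refine Finset.sum_congr rfl fun b _ => ?_
      rw [hamComp, Finset.sum_mul, map_sum]
      refine Finset.sum_congr rfl fun a _ => ?_
      rw [smul_mul_assoc, map_smul, dLL_apply, dL_mul, tw_homogeneous (hS.dL a), smul_add,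
        smul_mul_assoc, smul_smul]
      congr 3
      exact sg_congr 𝕜 ⟨-(gh i * gh a), by ring⟩
    -- The two halves of the Leibniz rule coincide, by the symmetry of the inverse matrix and graded
    -- commutativity. Only entries with `gh a + gh b = -1` contribute to the signs.
    have h3 : ∑ a, ∑ b, ω⁻¹ a b • (dL i (dL a S) * dL b S) =
        ∑ a, ∑ b, (ω⁻¹ a b * sg 𝕜 (gh i * gh a)) • (dL a S * dL i (dL b S)) := by
      rw [Finset.sum_comm]
      refine Finset.sum_congr rfl fun b _ => Finset.sum_congr rfl fun a _ => ?_
      by_cases hω : ω⁻¹ a b = 0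
      · rw [inv_symm hs b a, hω]; simp
      · have hab := inv_deg hdeg hu hω
        rw [mul_comm_tw ((hS.dL a).dL i) (dL b S), tw_homogeneous (hS.dL b), smul_mul_assoc, smul_smul,
          inv_symm hs b a]
        congr 2
        refine sg_congr 𝕜 ?_
        rw [show gh a = -1 - gh b by omega]
        obtain ⟨r, hr⟩ := Int.even_mul_succ_self (gh b)
        exact ⟨-r, by linear_combination -hr⟩
    have h4 : (2 * sg 𝕜 (gh i)) • vfL (hamComp ω S) (dL i S) = 0 := by
      rw [← h1, h2]
      simp only [Finset.sum_add_distrib]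
      rw [h3, ← two_smul 𝕜, mul_smul]
      congr 1
      rw [vfL_apply', Finset.smul_sum, Finset.sum_comm]
      refine Finset.sum_congr rfl fun b _ => ?_
      rw [hamComp, Finset.sum_mul, Finset.smul_sum]
      refine Finset.sum_congr rfl fun a _ => ?_
      by_cases hω : ω⁻¹ a b = 0
      · simp [hω]
      · have hab := inv_deg hdeg hu hω
        rw [dL_dL i b, mul_smul_comm, smul_smul, smul_mul_assoc, smul_smul, mul_assoc, ← sg_add,
          mul_comm]
        congr 2
        refine sg_congr 𝕜 ?_
        rw [show gh a = -1 - gh b by omega]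
        exact ⟨gh i, by ring⟩
    exact (smul_eq_zero.1 h4).resolve_left (mul_ne_zero two_ne_zero (sg_ne_zero _ _))
  refine hder.sq_eq_zero odd_one (fun i => ?_) (fun i => ?_) f
  · rw [vfL_X]; exact hamComp_homogeneous hdeg hu hS i
  · rw [vfL_X, hamComp, map_sum]
    exact Finset.sum_eq_zero fun j _ => by rw [map_smul, hQs, smul_zero]

variable {d : Matrix (Fin n) (Fin n) 𝕜}

theorem quadraticAction_eq : quadraticAction gh ω d =
    (1 / 2 : 𝕜) • ∑ i, X i * linForm gh (ω * d) i := by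
  rw [quadraticAction]
  congr 1
  refine Finset.sum_congr rfl fun i _ => ?_
  rw [← sum_smul_linForm, Finset.mul_sum]
  exact Finset.sum_congr rfl fun j _ => by rw [mul_smul_comm]

theorem quadraticAction_mem_Fil : quadraticAction gh ω d ∈ Fil 𝕜 gh 2 := by
  rw [quadraticAction_eq]
  exact Submodule.smul_mem _ _ (Submodule.sum_mem _ fun i _ =>
    mul_mem_Fil (X_mem_Fil i) (linForm_mem_Fil _ i))

theorem quadraticAction_homogeneous (hdeg : ∀ i j, ω i j ≠ 0 → gh i + gh j = -1)
    (hd : ∀ i j, d i j ≠ 0 → gh j = gh i + 1) : IsHomogeneous 0 (quadraticAction gh ω d) := by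
  refine IsHomogeneous.smul (IsHomogeneous.sum fun i _ => IsHomogeneous.sum fun j _ =>
    IsHomogeneous.smul_of_ne fun h => ?_) _
  exact (isHomogeneous_X i).mul' (linForm_homogeneous (hd j)) (by have := hdeg i j h; omega)

/-- The derivative may hit either factor. Compatibility of `d` with `ω` makes the two contributions
equal, which cancels the factor `1/2`. -/
theorem dL_quadraticAction [CharZero 𝕜]
    (hc : ∀ i j, (ω * d) j i = (-1) ^ (gh i * gh j).natAbs * (ω * d) i j) (k : Fin n) :
    dL k (quadraticAction gh ω d) = linForm gh (ω * d) k := by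
  rw [quadraticAction_eq]
  change dLL k _ = _
  rw [map_smul, map_sum]
  have h1 : ∀ a, dLL k (X a * linForm gh (ω * d) a) =
      (if k = a then linForm gh (ω * d) a else 0) + (ω * d) k a • X a := fun a => by
    rw [dLL_apply, dL_X_mul]
    congr 1
    have : dL k (linForm gh (ω * d) a) = (ω * d) a k • 1 := by
      change dLL k _ = _
      rw [map_linForm]
      simp [dL_X]
    rw [this, mul_smul_comm, mul_one, smul_smul, hc k a]
    congr 1
    change _ * (sg 𝕜 _ * _) = _
    linear_combination ((ω * d) k a) * sg_mul_self 𝕜 (gh k * gh a)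
  simp only [h1, Finset.sum_add_distrib, Finset.sum_ite_eq, Finset.mem_univ, if_true]
  change (1 / 2 : 𝕜) • (linForm gh (ω * d) k + linForm gh (ω * d) k) = _
  rw [← two_smul 𝕜, smul_smul]
  norm_num

theorem hamComp_quadraticAction [CharZero 𝕜] (hs : ω.IsSymm) (hu : IsUnit ω.det)
    (hc : ∀ i j, (ω * d) j i = (-1) ^ (gh i * gh j).natAbs * (ω * d) i j) (k : Fin n) :
    hamComp ω (quadraticAction gh ω d) k = linForm gh d k := by
  rw [hamComp]
  simp only [dL_quadraticAction hc, inv_symm hs _ k]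
  rw [sum_smul_linForm, ← Matrix.mul_assoc, Matrix.nonsing_inv_mul _ hu, Matrix.one_mul]

end Hamiltonian

/-! ## Maps preserving the polynomial degree -/

/-- Homogeneous polynomials of degree `N`. -/
def Pol (𝕜 : Type*) [Field 𝕜] {n : ℕ} (gh : Fin n → ℤ) (N : ℕ) : Submodule 𝕜 (FormalFun 𝕜 gh) where
  carrier := {f | ∀ m : Fin n →₀ ℕ, m.degree ≠ N → coeff m f = 0}
  zero_mem' m _ := coeff_zero m
  add_mem' hf hg m hm := by rw [coeff_add, hf m hm, hg m hm, add_zero]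
  smul_mem' c f hf m hm := by rw [coeff_smul, hf m hm, mul_zero]

theorem mono_mem_Pol (m : Fin n →₀ ℕ) : (mono gh m : FormalFun 𝕜 gh) ∈ Pol 𝕜 gh m.degree :=
  fun l hl => coeff_mono_of_ne (by rintro rfl; exact hl rfl)

theorem X_mem_Pol (i : Fin n) : (X i : FormalFun 𝕜 gh) ∈ Pol 𝕜 gh 1 := by
  rw [X_eq_mono]; simpa using mono_mem_Pol (𝕜 := 𝕜) (gh := gh) (Finsupp.single i 1)

theorem one_mem_Pol : (1 : FormalFun 𝕜 gh) ∈ Pol 𝕜 gh 0 := by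
  rw [one_eq_mono]; simpa using mono_mem_Pol (𝕜 := 𝕜) (gh := gh) 0

theorem mul_mem_Pol {a b : ℕ} {f g : FormalFun 𝕜 gh} (hf : f ∈ Pol 𝕜 gh a) (hg : g ∈ Pol 𝕜 gh b) :
    f * g ∈ Pol 𝕜 gh (a + b) := by
  intro m hm
  by_cases hadm : Admissible gh m
  · rw [coeff_mul hadm]
    refine Finset.sum_eq_zero fun p hp => ?_
    rw [Finset.HasAntidiagonal.mem_antidiagonal] at hp
    have : p.1.degree + p.2.degree ≠ a + b := by rw [← map_add, hp]; exact hm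
    by_cases h : p.1.degree = a
    · rw [hg p.2 (by omega)]; simp
    · rw [hf _ h]; simp
  · exact coeff_of_not _ hadm

theorem linForm_mem_Pol {k : ℕ} (M : Matrix (Fin k) (Fin n) 𝕜) (i : Fin k) :
    linForm gh M i ∈ Pol 𝕜 gh 1 :=
  Submodule.sum_mem _ fun j _ => Submodule.smul_mem _ _ (X_mem_Pol j)

theorem list_prod_mem_Pol (l : List (FormalFun 𝕜 gh)) (h : ∀ f ∈ l, f ∈ Pol 𝕜 gh 1) :
    l.prod ∈ Pol 𝕜 gh l.length := by
  induction l with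
  | nil => exact one_mem_Pol
  | cons f l ih =>
    rw [List.prod_cons, List.length_cons, add_comm]
    exact mul_mem_Pol (h f (by simp)) (ih fun g hg => h g (by simp [hg]))

theorem dL_mem_Pol {i : Fin n} {N : ℕ} {f : FormalFun 𝕜 gh} (h : f ∈ Pol 𝕜 gh (N + 1)) :
    dL i f ∈ Pol 𝕜 gh N := by
  intro m hm
  by_cases hadm : Admissible gh m
  · rw [coeff_dL hadm, h _ (by simpa using hm), mul_zero]
  · exact coeff_of_not _ hadm

theorem dL_eq_zero_of_mem_Pol {i : Fin n} {f : FormalFun 𝕜 gh} (h : f ∈ Pol 𝕜 gh 0) :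
    dL i f = 0 := ext' fun m hm => by
  rw [coeff_dL hm, h _ (by simp), mul_zero, coeff_zero]

/-- Linear maps preserving the polynomial degree. -/
structure IsGraded (L : FormalFun 𝕜 gh →ₗ[𝕜] FormalFun 𝕜 gh') : Prop where
  fil : ∀ N f, f ∈ Fil 𝕜 gh N → L f ∈ Fil 𝕜 gh' N
  pol : ∀ N f, f ∈ Pol 𝕜 gh N → L f ∈ Pol 𝕜 gh' N

namespace IsGraded

/-- A degree-preserving operator sees only the degree `|l|` part of its argument. This allows
operators assembled degree by degree, such as `green`, to be replaced by a single polynomial in `E`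
when one coefficient is computed. -/
theorem coeff_congr {L L' : FormalFun 𝕜 gh →ₗ[𝕜] FormalFun 𝕜 gh'} (h : IsGraded L) (h' : IsGraded L')
    {f g : FormalFun 𝕜 gh} {l : Fin n' →₀ ℕ}
    (hL : ∀ m : Fin n →₀ ℕ, m.degree = l.degree → coeff l (L (mono gh m)) = coeff l (L' (mono gh m)))
    (hfg : ∀ m : Fin n →₀ ℕ, m.degree = l.degree → coeff m f = coeff m g) :
    coeff l (L f) = coeff l (L' g) := by
  rw [coeff_linearMap (c := 0) h.fil f le_rfl, coeff_linearMap (c := 0) h'.fil g le_rfl]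
  refine Finset.sum_congr rfl fun m _ => ?_
  by_cases hm : m.degree = l.degree
  · rw [hfg m hm, hL m hm]
  · rw [h.pol _ _ (mono_mem_Pol m) l (Ne.symm hm), h'.pol _ _ (mono_mem_Pol m) l (Ne.symm hm),
      zero_mul, zero_mul]

theorem comp {n'' : ℕ} {gh'' : Fin n'' → ℤ} {L : FormalFun 𝕜 gh' →ₗ[𝕜] FormalFun 𝕜 gh''}
    {L' : FormalFun 𝕜 gh →ₗ[𝕜] FormalFun 𝕜 gh'} (h : IsGraded L) (h' : IsGraded L') :
    IsGraded (L.comp L') :=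
  ⟨fun N f hf => h.fil N _ (h'.fil N f hf), fun N f hf => h.pol N _ (h'.pol N f hf)⟩

theorem add {L L' : FormalFun 𝕜 gh →ₗ[𝕜] FormalFun 𝕜 gh'} (h : IsGraded L) (h' : IsGraded L') :
    IsGraded (L + L') :=
  ⟨fun N f hf => Submodule.add_mem _ (h.fil N f hf) (h'.fil N f hf),
    fun N f hf => Submodule.add_mem _ (h.pol N f hf) (h'.pol N f hf)⟩

theorem aeval {L : Module.End 𝕜 (FormalFun 𝕜 gh)} (h : IsGraded L) (q : Polynomial 𝕜) :
    IsGraded (Polynomial.aeval L q) := by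
  induction q using Polynomial.induction_on' with
  | add p q hp hq => rw [map_add]; exact hp.add hq
  | monomial k c =>
    rw [Polynomial.aeval_monomial, ← Algebra.smul_def]
    have hk : IsGraded (L ^ k) := by
      induction k with
      | zero => exact ⟨fun _ _ h => h, fun _ _ h => h⟩
      | succ k ih => rw [pow_succ]; exact ih.comp h
    exact ⟨fun N f hf => Submodule.smul_mem _ _ (hk.fil N f hf),
      fun N f hf => Submodule.smul_mem _ _ (hk.pol N f hf)⟩

theorem vfL_linForm (M : Matrix (Fin n) (Fin n) 𝕜) : IsGraded (vfL (linForm gh M)) where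
  fil N f hf := by
    rw [vfL_apply']
    refine Submodule.sum_mem _ fun i _ => ?_
    cases N with
    | zero => exact mem_Fil_zero _
    | succ N =>
      rw [add_comm]
      exact mul_mem_Fil (linForm_mem_Fil M i) (dL_mem_Fil hf)
  pol N f hf := by
    rw [vfL_apply']
    refine Submodule.sum_mem _ fun i _ => ?_
    cases N with
    | zero => rw [dL_eq_zero_of_mem_Pol hf, mul_zero]; exact Submodule.zero_mem _
    | succ N =>
      rw [add_comm]
      exact mul_mem_Pol (linForm_mem_Pol M i) (dL_mem_Pol hf)

end IsGraded

theorem prodPow_mem_Pol {k : ℕ} {g : Fin k → FormalFun 𝕜 gh} (hg : ∀ i, g i ∈ Pol 𝕜 gh 1)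
    (m : Fin k → ℕ) : prodPow g m ∈ Pol 𝕜 gh (∑ i, m i) := by
  induction k with
  | zero => simpa [prodPow] using one_mem_Pol
  | succ k ih =>
    rw [prodPow_succ, Fin.sum_univ_succ]
    refine mul_mem_Pol ?_ (ih (fun i => hg i.succ) _)
    induction m 0 with
    | zero => simpa using one_mem_Pol
    | succ r ihr => rw [pow_succ]; exact mul_mem_Pol ihr (hg 0)

theorem IsGraded.substL_linForm {k : ℕ} {ghT : Fin k → ℤ} (M : Matrix (Fin k) (Fin n) 𝕜) :
    IsGraded (substL ghT (linForm gh M)) where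
  fil N f hf := subst_mem_Fil (linForm_mem_Fil M) hf
  pol N f hf := by
    intro l hl
    rw [substL_apply, coeff_subst (linForm_mem_Fil M) f le_rfl]
    refine Finset.sum_eq_zero fun m _ => ?_
    by_cases hm : m.degree = N
    · rw [prodPow_mem_Pol (linForm_mem_Pol M) m l
        (by rw [← Finsupp.degree_eq_sum, hm]; exact hl), mul_zero]
    · rw [hf m hm, zero_mul]

end FormalFunctions

/-! ## The beta functional -/

section Beta

open Polynomial

variable {𝕜 : Type*} [Field 𝕜]

/-- The functional `q ↦ ∫₀¹ (q(t) - q(0)) / t dt` on polynomials. -/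
def logInt : Polynomial 𝕜 →ₗ[𝕜] 𝕜 := Polynomial.lsum fun j => ((j : 𝕜)⁻¹) • LinearMap.id

theorem logInt_monomial (j : ℕ) (c : 𝕜) : logInt (monomial j c) = (j : 𝕜)⁻¹ * c := by
  simp [logInt, Polynomial.lsum_apply, Polynomial.sum_monomial_index]

/-- The beta integral of `(1-t)^a t^b` over the unit interval, computed by splitting one factor `1 -
t`. It is the origin of the coefficients in the symmetrized homotopy. -/
theorem logInt_beta [CharZero 𝕜] (a b : ℕ) : logInt ((1 - Polynomial.X) ^ a * Polynomial.X ^ (b + 1) : Polynomial 𝕜) =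
    (a.factorial * b.factorial : 𝕜) / ((a + b + 1).factorial : 𝕜) := by
  induction a generalizing b with
  | zero =>
    rw [pow_zero, one_mul, ← monomial_one_right_eq_X_pow, logInt_monomial]
    have : ((b + 1 : ℕ) : 𝕜) ≠ 0 := Nat.cast_ne_zero.2 (by omega)
    have : (b.factorial : 𝕜) ≠ 0 := by exact_mod_cast b.factorial_ne_zero
    simp only [zero_add, Nat.factorial_zero, Nat.factorial_succ]
    push_cast at *
    field_simp
  | succ a ih =>
    have h : ((1 - Polynomial.X) ^ (a + 1) * Polynomial.X ^ (b + 1) : Polynomial 𝕜) =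
        (1 - Polynomial.X) ^ a * Polynomial.X ^ (b + 1) - (1 - Polynomial.X) ^ a * Polynomial.X ^ (b + 1 + 1) := by ring
    rw [h, map_sub, ih, ih]
    have h2 : ((a + b + 1).factorial : 𝕜) ≠ 0 := by exact_mod_cast Nat.factorial_ne_zero _
    have h3 : ((a + b + 2 : ℕ) : 𝕜) ≠ 0 := Nat.cast_ne_zero.2 (by omega)
    rw [show a + (b + 1) + 1 = (a + b + 1) + 1 by ring, show a + 1 + b + 1 = (a + b + 1) + 1 by ring]
    simp only [Nat.factorial_succ]
    simp only [Nat.factorial_succ] at h2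
    push_cast at *
    have h4 : (a : 𝕜) + b + 1 + 1 ≠ 0 := by convert h3 using 1; ring
    field_simp
    ring

/-- The polynomial `(1 - ∏ (1 - X / k)) / X`, the product being over `1 ≤ k ≤ N`. -/
def greenPoly (𝕜 : Type*) [Field 𝕜] (N : ℕ) : Polynomial 𝕜 :=
  (1 - ∏ k ∈ Finset.range N, (1 - C (((k : 𝕜) + 1)⁻¹) * Polynomial.X)).divX

theorem X_mul_greenPoly (N : ℕ) :
    Polynomial.X * greenPoly 𝕜 N = 1 - ∏ k ∈ Finset.range N, (1 - C (((k : 𝕜) + 1)⁻¹) * Polynomial.X) := by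
  have h := Polynomial.X_mul_divX_add
    (1 - ∏ k ∈ Finset.range N, (1 - C (((k : 𝕜) + 1)⁻¹) * Polynomial.X))
  have h0 : (1 - ∏ k ∈ Finset.range N, (1 - C (((k : 𝕜) + 1)⁻¹) * Polynomial.X)).coeff 0 = 0 := by
    rw [Polynomial.coeff_zero_eq_eval_zero]
    simp [Polynomial.eval_prod]
  rw [h0, C_0, add_zero] at h
  exact h

theorem eval_prod_eq_zero [CharZero 𝕜] {N j : ℕ} (h1 : 1 ≤ j) (h2 : j ≤ N) :
    (∏ k ∈ Finset.range N, (1 - C (((k : 𝕜) + 1)⁻¹) * Polynomial.X)).eval (j : 𝕜) = 0 := by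
  rw [Polynomial.eval_prod]
  refine Finset.prod_eq_zero (i := j - 1) (Finset.mem_range.2 (by omega)) ?_
  have : ((j - 1 : ℕ) : 𝕜) + 1 = j := by
    rw [← Nat.cast_succ]; congr 1; omega
  rw [this]
  have : (j : 𝕜) ≠ 0 := by exact_mod_cast (by omega : j ≠ 0)
  simp [this]

/-- The product in the definition of `greenPoly` vanishes at `j`, which leaves `j * q(j) = 1`. So
the polynomial interpolates the inverse of the operator `E` on ultraviolet degrees `1, ..., N`. -/
theorem eval_greenPoly [CharZero 𝕜] {N j : ℕ} (h1 : 1 ≤ j) (h2 : j ≤ N) :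
    (greenPoly 𝕜 N).eval (j : 𝕜) = (j : 𝕜)⁻¹ := by
  have h := congrArg (Polynomial.eval (j : 𝕜)) (X_mul_greenPoly (𝕜 := 𝕜) N)
  rw [eval_mul, eval_X, eval_sub, eval_prod_eq_zero h1 h2, eval_one, sub_zero] at h
  exact eq_inv_of_mul_eq_one_right h

end Beta

/-- The action of a derivation on an ordered product. -/
theorem IsDer.list_prod {𝕜 : Type*} [Field 𝕜] {n : ℕ} {gh : Fin n → ℤ} {e : ℤ}
    {D : FormalFun 𝕜 gh →ₗ[𝕜] FormalFun 𝕜 gh} (h : IsDer e D) {N : ℕ} (y : Fin N → FormalFun 𝕜 gh)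
    (k : Fin N → ℤ) (hy : ∀ l, IsHomogeneous (k l) (y l)) :
    D (List.ofFn y).prod = ∑ j, (∏ l ∈ Finset.univ.filter (· < j), sg 𝕜 (e * k l)) •
      (List.ofFn (Function.update y j (D (y j)))).prod := by
  induction N with
  | zero => simp [h.map_one]
  | succ N ih =>
    rw [List.ofFn_succ, List.prod_cons, h.leibniz, Fin.sum_univ_succ, ih _ _ fun l => hy l.succ,
      tw_homogeneous (hy 0), Finset.mul_sum]
    congr 1
    · simp [List.ofFn_succ]
    · refine Finset.sum_congr rfl fun j _ => ?_
      rw [List.ofFn_succ, List.prod_cons, Function.update_of_ne (Fin.succ_ne_zero j).symm,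
        smul_mul_assoc, mul_smul_comm, smul_smul]
      congr 1
      · simp only [Finset.prod_filter, Fin.prod_univ_succ, Fin.succ_pos, if_true,
          Fin.succ_lt_succ_iff]
      · congr 3
        ext l
        by_cases hl : l = j
        · subst hl; simp
        · simp [Function.update_of_ne hl,
            Function.update_of_ne (fun h => hl (Fin.succ_injective _ h) : l.succ ≠ j.succ)]

namespace FreeBVRetract

variable {𝕜 : Type*} [Field 𝕜] {n n' : ℕ} (D : FreeBVRetract 𝕜 n n')

/-! ## The free theory -/

theorem inc_isMap : IsMap D.gh (linForm D.gh' D.inc) := linForm_isMap D.inc_deg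

theorem pr_isMap : IsMap D.gh' (linForm D.gh D.pr) := linForm_isMap D.pr_deg

theorem isHomogeneous_S₀ : IsHomogeneous 0 D.S₀ := quadraticAction_homogeneous D.ω_deg D.d_deg

/-- `i` as a linear map. -/
def iL : FormalFun 𝕜 D.gh' →ₗ[𝕜] FormalFun 𝕜 D.gh := substL D.gh' (linForm D.gh D.pr)

/-- `p` as a linear map. -/
def pL : FormalFun 𝕜 D.gh →ₗ[𝕜] FormalFun 𝕜 D.gh' := substL D.gh (linForm D.gh' D.inc)

/-- `κhat` as a linear map. -/
def κL : FormalFun 𝕜 D.gh →ₗ[𝕜] FormalFun 𝕜 D.gh := vfL (linForm D.gh D.κ)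

/-- The free differential as a linear map. -/
def Q₀L : FormalFun 𝕜 D.gh →ₗ[𝕜] FormalFun 𝕜 D.gh := vfL (linForm D.gh D.d)

/-- The free infrared differential as a linear map. -/
def Q₀L' : FormalFun 𝕜 D.gh' →ₗ[𝕜] FormalFun 𝕜 D.gh' := vfL (linForm D.gh' D.d')

/-- The free Hamiltonian `[κhat, Q₀]`. -/
def EL : Module.End 𝕜 (FormalFun 𝕜 D.gh) := D.κL.comp D.Q₀L + D.Q₀L.comp D.κL

theorem κL_apply (f : FormalFun 𝕜 D.gh) : D.κL f = D.κhat f := vfL_apply _ _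

theorem κL_X (j : Fin n) : D.κL (X j) = linForm D.gh D.κ j := vfL_X _ j

theorem Q₀L_X (j : Fin n) : D.Q₀L (X j) = linForm D.gh D.d j := vfL_X _ j

theorem κ_linForm_hom (i : Fin n) : IsHomogeneous (D.gh i + -1) (linForm D.gh D.κ i) :=
  linForm_homogeneous fun j h => by have := D.κ_deg i j h; omega

theorem d_linForm_hom (i : Fin n) : IsHomogeneous (D.gh i + 1) (linForm D.gh D.d i) :=
  linForm_homogeneous fun j h => D.d_deg i j h

theorem κL_X_hom (i : Fin n) : IsHomogeneous (D.gh i + -1) (D.κL (X i)) := by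
  rw [κL_X]; exact D.κ_linForm_hom i

theorem Q₀L_X_hom (i : Fin n) : IsHomogeneous (D.gh i + 1) (D.Q₀L (X i)) := by
  rw [Q₀L_X]; exact D.d_linForm_hom i

theorem κL_isDer : IsDer (-1) D.κL := vfL_isDer D.κ_linForm_hom fun i => linForm_mem_Fil _ i

theorem Q₀L_isDer : IsDer 1 D.Q₀L := vfL_isDer D.d_linForm_hom fun i => linForm_mem_Fil _ i

theorem EL_isDer : IsDer 0 D.EL :=
  IsDer.anticomm (by decide) odd_one D.κL_isDer D.Q₀L_isDer D.κL_X_hom D.Q₀L_X_hom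

theorem iL_graded : IsGraded D.iL := IsGraded.substL_linForm _

theorem pL_graded : IsGraded D.pL := IsGraded.substL_linForm _

theorem κL_graded : IsGraded D.κL := IsGraded.vfL_linForm _

theorem Q₀L_graded : IsGraded D.Q₀L := IsGraded.vfL_linForm _

theorem EL_graded : IsGraded D.EL :=
  (D.κL_graded.comp D.Q₀L_graded).add (D.Q₀L_graded.comp D.κL_graded)

theorem κL_linForm (M : Matrix (Fin n) (Fin n) 𝕜) (i : Fin n) :
    D.κL (linForm D.gh M i) = linForm D.gh (M * D.κ) i := by
  rw [map_linForm, ← sum_smul_linForm]; simp [κL_X]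

theorem κL_linForm' {k : ℕ} (M : Matrix (Fin k) (Fin n) 𝕜) (i : Fin k) :
    D.κL (linForm D.gh M i) = linForm D.gh (M * D.κ) i := by
  rw [map_linForm, ← sum_smul_linForm]; simp [κL_X]

theorem Q₀L_linForm {k : ℕ} (M : Matrix (Fin k) (Fin n) 𝕜) (i : Fin k) :
    D.Q₀L (linForm D.gh M i) = linForm D.gh (M * D.d) i := by
  rw [map_linForm, ← sum_smul_linForm]; simp [Q₀L_X]

/-- By the homotopy relation of the retraction, `E` acts on linear forms as the projection to the
ultraviolet part. As a derivation it therefore counts ultraviolet factors. -/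
theorem EL_linForm {k : ℕ} (M : Matrix (Fin k) (Fin n) 𝕜) (i : Fin k) :
    D.EL (linForm D.gh M i) = linForm D.gh (M * (1 - D.inc * D.pr)) i := by
  rw [EL, LinearMap.add_apply, LinearMap.comp_apply, LinearMap.comp_apply, Q₀L_linForm, κL_linForm',
    κL_linForm', Q₀L_linForm, ← linForm_add, Matrix.mul_assoc, Matrix.mul_assoc, ← Matrix.mul_add,
    D.homotopy]

section CharZero

variable [CharZero 𝕜]

theorem κL_κL (f : FormalFun 𝕜 D.gh) : D.κL (D.κL f) = 0 :=
  D.κL_isDer.sq_eq_zero (by decide) D.κL_X_hom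
    (fun i => by rw [κL_X, κL_linForm, D.κ_κ, linForm_zero]) f

theorem Q₀L_Q₀L (f : FormalFun 𝕜 D.gh) : D.Q₀L (D.Q₀L f) = 0 :=
  D.Q₀L_isDer.sq_eq_zero odd_one D.Q₀L_X_hom
    (fun i => by rw [Q₀L_X, Q₀L_linForm, D.d_sq, linForm_zero]) f

theorem iL_mul (f g : FormalFun 𝕜 D.gh') : D.iL (f * g) = D.iL f * D.iL g := subst_mul D.pr_isMap f g

theorem pL_mul (f g : FormalFun 𝕜 D.gh) : D.pL (f * g) = D.pL f * D.pL g := subst_mul D.inc_isMap f g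

theorem iL_one : D.iL 1 = 1 := subst_one D.pr_isMap

theorem pL_one : D.pL 1 = 1 := subst_one D.inc_isMap

theorem iL_X (a : Fin n') : D.iL (X a) = linForm D.gh D.pr a := subst_X D.pr_isMap a

theorem pL_X (j : Fin n) : D.pL (X j) = linForm D.gh' D.inc j := subst_X D.inc_isMap j

theorem iL_linForm {k : ℕ} (M : Matrix (Fin k) (Fin n') 𝕜) (i : Fin k) :
    D.iL (linForm D.gh' M i) = linForm D.gh (M * D.pr) i := by
  rw [map_linForm, ← sum_smul_linForm]; simp [iL_X]

theorem pL_linForm {k : ℕ} (M : Matrix (Fin k) (Fin n) 𝕜) (i : Fin k) :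
    D.pL (linForm D.gh M i) = linForm D.gh' (M * D.inc) i := by
  rw [map_linForm, ← sum_smul_linForm]; simp [pL_X]

theorem pL_iL (f : FormalFun 𝕜 D.gh') : D.pL (D.iL f) = f := by
  have := linearMap_ext (L := D.pL.comp D.iL) (L' := LinearMap.id) 0
    (fun N f hf => D.pL_graded.fil _ _ (D.iL_graded.fil _ _ hf)) (fun N f hf => hf)
    (by simp [iL_one, pL_one]) fun a f hf => ?_
  · exact LinearMap.congr_fun this f
  · simp only [LinearMap.comp_apply, LinearMap.id_apply] at hf ⊢
    rw [iL_mul, pL_mul, hf, iL_X, pL_linForm, D.pr_inc, linForm_one]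

theorem κL_iL (f : FormalFun 𝕜 D.gh') : D.κL (D.iL f) = 0 := by
  have := linearMap_eq_zero (L := D.κL.comp D.iL) 0
    (fun N f hf => D.κL_graded.fil _ _ (D.iL_graded.fil _ _ hf))
    (by simp [iL_one, D.κL_isDer.map_one]) fun a f hf => ?_
  · exact LinearMap.congr_fun this f
  · simp only [LinearMap.comp_apply] at hf ⊢
    rw [iL_mul, D.κL_isDer.leibniz, hf, iL_X, κL_linForm', D.pr_κ, linForm_zero, zero_mul, mul_zero,
      add_zero]

theorem pL_κL (f : FormalFun 𝕜 D.gh) : D.pL (D.κL f) = 0 := by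
  have := linearMap_eq_zero (L := D.pL.comp D.κL) 0
    (fun N f hf => D.pL_graded.fil _ _ (D.κL_graded.fil _ _ hf))
    (by simp [D.κL_isDer.map_one]) fun a f hf => ?_
  · exact LinearMap.congr_fun this f
  · simp only [LinearMap.comp_apply] at hf ⊢
    rw [D.κL_isDer.leibniz, map_add, pL_mul, pL_mul, hf, κL_X, pL_linForm, D.κ_inc, linForm_zero,
      zero_mul, mul_zero, add_zero]

theorem Q₀L_iL (f : FormalFun 𝕜 D.gh') : D.Q₀L (D.iL f) = D.iL (D.Q₀L' f) := by
  have hd' : IsDer 1 D.Q₀L' := vfL_isDer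
    (fun i => linForm_homogeneous fun j h => D.d'_deg i j h) fun i => linForm_mem_Fil _ i
  have := linearMap_ext (L := D.Q₀L.comp D.iL) (L' := D.iL.comp D.Q₀L') 0
    (fun N f hf => D.Q₀L_graded.fil _ _ (D.iL_graded.fil _ _ hf))
    (fun N f hf => D.iL_graded.fil _ _ (hd'.fil _ _ hf))
    (by simp [iL_one, D.Q₀L_isDer.map_one, hd'.map_one]) fun a f hf => ?_
  · exact LinearMap.congr_fun this f
  · simp only [LinearMap.comp_apply] at hf ⊢
    rw [iL_mul, D.Q₀L_isDer.leibniz, hf, iL_X, Q₀L_linForm, hd'.leibniz, map_add, iL_mul, iL_mul,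
      D.pr_chain, Q₀L', vfL_X, iL_linForm, tw_homogeneous (isHomogeneous_X a),
      tw_homogeneous (D.pr_isMap.hom a), map_smul, iL_X]

theorem pL_Q₀L (f : FormalFun 𝕜 D.gh) : D.pL (D.Q₀L f) = D.Q₀L' (D.pL f) := by
  have hd' : IsDer 1 D.Q₀L' := vfL_isDer
    (fun i => linForm_homogeneous fun j h => D.d'_deg i j h) fun i => linForm_mem_Fil _ i
  have hlin : ∀ {k : ℕ} (M : Matrix (Fin k) (Fin n') 𝕜) (i : Fin k),
      D.Q₀L' (linForm D.gh' M i) = linForm D.gh' (M * D.d') i := fun M i => by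
    rw [map_linForm, ← sum_smul_linForm]; simp [Q₀L', vfL_X]
  have := linearMap_ext (L := D.pL.comp D.Q₀L) (L' := D.Q₀L'.comp D.pL) 0
    (fun N f hf => D.pL_graded.fil _ _ (D.Q₀L_graded.fil _ _ hf))
    (fun N f hf => hd'.fil _ _ (D.pL_graded.fil _ _ hf))
    (by simp [pL_one, D.Q₀L_isDer.map_one, hd'.map_one]) fun a f hf => ?_
  · exact LinearMap.congr_fun this f
  · simp only [LinearMap.comp_apply] at hf ⊢
    rw [pL_mul, D.Q₀L_isDer.leibniz, map_add, pL_mul, pL_mul, hf, Q₀L_X, pL_linForm, hd'.leibniz,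
      pL_X, hlin, D.inc_chain, tw_homogeneous (isHomogeneous_X a),
      tw_homogeneous (D.inc_isMap.hom a), map_smul, pL_X]

theorem Q'₀_eq (f : FormalFun 𝕜 D.gh') : D.Q'₀ f = D.Q₀L' f := by
  rw [Q'₀, bracket_eq (quadraticAction_homogeneous D.ω'_deg D.d'_deg), Q₀L']
  congr 1
  congr 1
  ext1 k
  exact hamComp_quadraticAction D.ω'_symm D.ω'_nondeg D.d'_compat k

/-! ## The Green operator and the symmetrized homotopy -/

/-- The dilation by `t` of the ultraviolet fields. -/
def dil (t : 𝕜) : FormalFun 𝕜 D.gh →ₗ[𝕜] FormalFun 𝕜 D.gh :=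
  substL D.gh (linForm D.gh (D.inc * D.pr + t • (1 - D.inc * D.pr)))

omit [CharZero 𝕜] in
theorem incpr_deg {i j : Fin n} (h : (D.inc * D.pr) i j ≠ 0) : D.gh j = D.gh i := by
  rw [Matrix.mul_apply] at h
  obtain ⟨a, _, ha⟩ := Finset.exists_ne_zero_of_sum_ne_zero h
  have h1 := D.inc_deg i a (left_ne_zero_of_mul ha)
  have h2 := D.pr_deg a j (right_ne_zero_of_mul ha)
  omega

omit [CharZero 𝕜] in
theorem dil_isMap (t : 𝕜) :
    IsMap D.gh (linForm D.gh (D.inc * D.pr + t • (1 - D.inc * D.pr))) := by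
  refine linForm_isMap fun i j h => ?_
  by_contra hne
  have h1 : (D.inc * D.pr) i j = 0 := by
    by_contra h; exact hne (D.incpr_deg h)
  have h2 : (1 : Matrix (Fin n) (Fin n) 𝕜) i j = 0 :=
    Matrix.one_apply_ne (by rintro rfl; exact hne rfl)
  simp [h1, h2] at h

theorem dil_linForm (t : 𝕜) {k : ℕ} (M : Matrix (Fin k) (Fin n) 𝕜) (i : Fin k) :
    D.dil t (linForm D.gh M i) =
      linForm D.gh (M * (D.inc * D.pr + t • (1 - D.inc * D.pr))) i := by
  rw [map_linForm, ← sum_smul_linForm]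
  simp only [dil, substL_apply, subst_X (D.dil_isMap t)]

theorem dil_mul (t : 𝕜) (f g : FormalFun 𝕜 D.gh) : D.dil t (f * g) = D.dil t f * D.dil t g :=
  subst_mul (D.dil_isMap t) f g

omit [CharZero 𝕜] in
theorem incpr_sq : D.inc * D.pr * (D.inc * D.pr) = D.inc * D.pr := by
  rw [Matrix.mul_assoc, ← Matrix.mul_assoc D.pr, D.pr_inc, Matrix.one_mul]

/-- The functions homogeneous of degree `j` in the ultraviolet fields. -/
def UV (j : ℕ) : Submodule 𝕜 (FormalFun 𝕜 D.gh) where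
  carrier := {f | D.EL f = (j : 𝕜) • f ∧ ∀ t, D.dil t f = t ^ j • f}
  zero_mem' := by simp
  add_mem' hf hg := ⟨by rw [map_add, hf.1, hg.1, smul_add],
    fun t => by rw [map_add, hf.2, hg.2, smul_add]⟩
  smul_mem' c f hf := ⟨by rw [map_smul, hf.1, smul_comm],
    fun t => by rw [map_smul, hf.2, smul_comm]⟩

theorem mul_mem_UV {j k : ℕ} {f g : FormalFun 𝕜 D.gh} (hf : f ∈ D.UV j) (hg : g ∈ D.UV k) :
    f * g ∈ D.UV (j + k) := by
  refine ⟨?_, fun t => ?_⟩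
  · rw [D.EL_isDer.leibniz, hf.1, hg.1, tw_zero, smul_mul_assoc, mul_smul_comm, ← add_smul,
      Nat.cast_add]
  · rw [dil_mul, hf.2, hg.2, smul_mul_smul_comm, pow_add]

theorem incpr_mem_UV (i : Fin n) : linForm D.gh (D.inc * D.pr) i ∈ D.UV 0 := by
  refine ⟨?_, fun t => ?_⟩
  · rw [EL_linForm, Matrix.mul_sub, D.incpr_sq, Matrix.mul_one, sub_self, linForm_zero]; simp
  · rw [dil_linForm, Matrix.mul_add, Matrix.mul_smul, Matrix.mul_sub, D.incpr_sq, Matrix.mul_one,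
      sub_self]
    simp

theorem uv_mem_UV (i : Fin n) : linForm D.gh (1 - D.inc * D.pr) i ∈ D.UV 1 := by
  have h1 : (1 - D.inc * D.pr) * (D.inc * D.pr) = 0 := by
    rw [Matrix.sub_mul, D.incpr_sq, Matrix.one_mul, sub_self]
  have h2 : (1 - D.inc * D.pr) * (1 - D.inc * D.pr) = 1 - D.inc * D.pr := by
    rw [Matrix.mul_sub, h1, Matrix.mul_one, sub_zero]
  refine ⟨?_, fun t => ?_⟩
  · rw [EL_linForm, h2]; simp
  · rw [dil_linForm, Matrix.mul_add, Matrix.mul_smul, h1, h2, zero_add, linForm_smul, pow_one]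

/-- Decomposition of monomials with respect to the degree in the ultraviolet fields. -/
theorem exists_uv_decomp (w : List (Fin n)) : ∃ a : ℕ → FormalFun 𝕜 D.gh,
    (∀ k, a k ∈ D.UV k) ∧ (∀ k, a k ∈ Pol 𝕜 D.gh w.length) ∧ (∀ k, w.length < k → a k = 0) ∧
      (w.map X).prod = ∑ k ∈ Finset.range (w.length + 1), a k := by
  induction w with
  | nil =>
    refine ⟨fun k => if k = 0 then 1 else 0, fun k => ?_, fun k => ?_, fun k hk => ?_, by simp⟩
    · dsimp only
      split_ifs with h
      · subst h
        refine ⟨?_, fun t => ?_⟩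
        · rw [D.EL_isDer.map_one]; simp
        · rw [dil, substL_apply, subst_one (D.dil_isMap t)]; simp
      · exact Submodule.zero_mem _
    · dsimp only
      split_ifs
      · exact one_mem_Pol
      · exact Submodule.zero_mem _
    · simp only [List.length_nil] at hk
      simp [hk.ne']
  | cons i w ih =>
    obtain ⟨a, h1, h2, h3, h4⟩ := ih
    have hX : (X i : FormalFun 𝕜 D.gh) =
        linForm D.gh (D.inc * D.pr) i + linForm D.gh (1 - D.inc * D.pr) i := by
      rw [← linForm_add, add_sub_cancel, linForm_one]
    -- A coordinate is the sum of its infrared and ultraviolet parts. The first keeps the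
    -- ultraviolet degree of the remaining word and the second raises it by one.
    refine ⟨fun k => linForm D.gh (D.inc * D.pr) i * a k +
      if k = 0 then 0 else linForm D.gh (1 - D.inc * D.pr) i * a (k - 1), fun k => ?_, fun k => ?_, fun k hk => ?_, ?_⟩
    · refine Submodule.add_mem _ (by simpa using D.mul_mem_UV (D.incpr_mem_UV i) (h1 k)) ?_
      cases k with
      | zero => exact Submodule.zero_mem _
      | succ k => simpa [add_comm] using D.mul_mem_UV (D.uv_mem_UV i) (h1 k)
    · rw [List.length_cons, add_comm w.length]
      refine Submodule.add_mem _ (mul_mem_Pol (linForm_mem_Pol _ i) (h2 k)) ?_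
      cases k with
      | zero => exact Submodule.zero_mem _
      | succ k => simpa using mul_mem_Pol (linForm_mem_Pol _ i) (h2 k)
    · rw [List.length_cons] at hk
      cases k with
      | zero => omega
      | succ k => simp [h3 (k + 1) (by omega), h3 k (by omega)]
    · rw [List.map_cons, List.prod_cons, hX, add_mul, List.length_cons, Finset.sum_add_distrib,
        Finset.sum_range_succ' (fun k => if k = 0 then (0 : FormalFun 𝕜 D.gh) else
          linForm D.gh (1 - D.inc * D.pr) i * a (k - 1)),
        Finset.sum_range_succ (fun k => linForm D.gh (D.inc * D.pr) i * a k),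
        h3 (w.length + 1) (Nat.lt_succ_self _), mul_zero, add_zero, if_pos rfl, add_zero, h4, Finset.mul_sum,
        Finset.mul_sum]
      simp

theorem map_word_prod (m : Fin n →₀ ℕ) :
    ((word m).map X).prod = (mono D.gh m : FormalFun 𝕜 D.gh) := by
  rw [← subst_id (mono D.gh m), subst_mono isMap_X, prodPow, word, List.map_flatMap, List.flatMap,
    List.prod_flatten, List.map_map, List.ofFn_eq_map]
  congr 1
  refine List.map_congr_left fun i _ => ?_
  simp

theorem length_word (m : Fin n →₀ ℕ) : (word m).length = m.degree := by
  rw [word, List.length_flatMap, Finsupp.degree_eq_sum, ← List.sum_ofFn, List.ofFn_eq_map]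
  simp

/-- The inverse of `E` on the functions that vanish at infrared fields. -/
def green : FormalFun 𝕜 D.gh →ₗ[𝕜] FormalFun 𝕜 D.gh where
  toFun f := FormalFun.mk D.gh fun l => coeff l (Polynomial.aeval D.EL (greenPoly 𝕜 l.degree) f)
  map_add' f g := ext' fun l hl => by simp only [coeff_mk _ hl, map_add, coeff_add]
  map_smul' c f := ext' fun l hl => by
    simp only [coeff_mk _ hl, map_smul, coeff_smul, RingHom.id_apply]

omit [CharZero 𝕜] in
theorem coeff_green (l : Fin n →₀ ℕ) (f : FormalFun 𝕜 D.gh) :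
    coeff l (D.green f) = coeff l (Polynomial.aeval D.EL (greenPoly 𝕜 l.degree) f) := by
  by_cases h : Admissible D.gh l
  · exact coeff_mk (fun l => coeff l (Polynomial.aeval D.EL (greenPoly 𝕜 l.degree) f)) h
  · simp [coeff_of_not _ h]

omit [CharZero 𝕜] in
theorem green_graded : IsGraded D.green where
  fil N f hf l hl := by rw [coeff_green]; exact (D.EL_graded.aeval _).fil N f hf l hl
  pol N f hf l hl := by rw [coeff_green]; exact (D.EL_graded.aeval _).pol N f hf l hl

-- In each polynomial degree `green` is a polynomial in `E`, so it commutes with every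
-- degree-preserving operator that commutes with `E`.
omit [CharZero 𝕜] in
theorem green_comm {L : Module.End 𝕜 (FormalFun 𝕜 D.gh)} (hL : IsGraded L) (h : Commute L D.EL)
    (f : FormalFun 𝕜 D.gh) : L (D.green f) = D.green (L f) := by
  refine ext' fun l _ => ?_
  rw [coeff_green, hL.coeff_congr hL (g := Polynomial.aeval D.EL (greenPoly 𝕜 l.degree) f)
    (fun _ _ => rfl) (fun m hm => by rw [coeff_green, hm])]
  have : Commute L (Polynomial.aeval D.EL (greenPoly 𝕜 l.degree)) :=
    Polynomial.induction_on' (motive := fun q => Commute L (Polynomial.aeval D.EL q))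
      (greenPoly 𝕜 l.degree)
      (fun p q hp hq => by rw [map_add]; exact hp.add_right hq)
      fun k c => by
        rw [Polynomial.aeval_monomial]
        exact (Algebra.commute_algebraMap_right c L).mul_right (h.pow_right k)
  exact congrArg _ (LinearMap.congr_fun this.eq f)

omit [CharZero 𝕜] in
theorem aeval_EL_of_mem_UV {j : ℕ} {f : FormalFun 𝕜 D.gh} (hf : f ∈ D.UV j) (q : Polynomial 𝕜) :
    Polynomial.aeval D.EL q f = q.eval (j : 𝕜) • f := by
  induction q using Polynomial.induction_on' with
  | add p q hp hq => rw [map_add, LinearMap.add_apply, hp, hq, Polynomial.eval_add, add_smul]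
  | monomial k c =>
    rw [Polynomial.aeval_monomial, Polynomial.eval_monomial, ← Algebra.smul_def,
      LinearMap.smul_apply, mul_smul]
    congr 1
    induction k with
    | zero => simp
    | succ k ih =>
      rw [pow_succ', Module.End.mul_apply, ih, map_smul, hf.1, smul_smul, pow_succ]

theorem dil_zero (f : FormalFun 𝕜 D.gh) : D.dil 0 f = D.iL (D.pL f) := by
  rw [dil, substL_apply, zero_smul, add_zero, iL, pL, substL_apply, substL_apply,
    subst_subst D.pr_isMap D.inc_isMap]
  congr 1
  ext1 i
  have := D.iL_linForm D.inc i
  rw [← this]; rfl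

/-- A monomial of degree `N` has components of ultraviolet degree `0, ..., N` only. The product is
`1` at eigenvalue `0` and `0` at `1, ..., N`, just as the dilation by `t = 0`, which is the
projection `i p`. -/
theorem aeval_prod_mono (m : Fin n →₀ ℕ) : Polynomial.aeval D.EL (∏ k ∈ Finset.range m.degree,
      (1 - Polynomial.C (((k : 𝕜) + 1)⁻¹) * Polynomial.X)) (mono D.gh m) =
    D.iL (D.pL (mono D.gh m)) := by
  obtain ⟨a, h1, _, _, h4⟩ := D.exists_uv_decomp (word m)
  rw [map_word_prod, length_word] at h4
  rw [← dil_zero, h4, map_sum, map_sum]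
  refine Finset.sum_congr rfl fun j hj => ?_
  rw [D.aeval_EL_of_mem_UV (h1 j), (h1 j).2 0]
  cases j with
  | zero => simp [Polynomial.eval_prod]
  | succ j =>
    rw [eval_prod_eq_zero (Nat.succ_le_succ (Nat.zero_le j)) (by simpa [Nat.lt_succ_iff] using hj)]
    simp

/-- On terms of degree `N`, the operator `∏ (1 - E / k)` is the projection to infrared functions. -/
theorem coeff_aeval_prod {l : Fin n →₀ ℕ} (f : FormalFun 𝕜 D.gh) :
    coeff l (Polynomial.aeval D.EL (∏ k ∈ Finset.range l.degree,
      (1 - Polynomial.C (((k : 𝕜) + 1)⁻¹) * Polynomial.X)) f) = coeff l (D.iL (D.pL f)) :=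
  (D.EL_graded.aeval _).coeff_congr (D.iL_graded.comp D.pL_graded)
    (fun m hm => by rw [← hm, aeval_prod_mono]; rfl) fun _ _ => rfl

/-- In degree `N` the composite is `X * greenPoly` evaluated at `E`, that is, `1` minus the product
that projects to infrared functions. -/
theorem EL_green (f : FormalFun 𝕜 D.gh) : D.EL (D.green f) = f - D.iL (D.pL f) := by
  refine ext' fun l _ => ?_
  rw [D.EL_graded.coeff_congr D.EL_graded
    (g := Polynomial.aeval D.EL (greenPoly 𝕜 l.degree) f)
    (fun _ _ => rfl) (fun m hm => by rw [coeff_green, hm])]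
  have h : D.EL * Polynomial.aeval D.EL (greenPoly 𝕜 l.degree) =
      Polynomial.aeval D.EL (Polynomial.X * greenPoly 𝕜 l.degree) := by
    rw [map_mul, Polynomial.aeval_X]
  rw [← Module.End.mul_apply, h, X_mul_greenPoly, map_sub, LinearMap.sub_apply, coeff_sub,
    coeff_aeval_prod, map_one, Module.End.one_apply, coeff_sub]

end CharZero

end FreeBVRetract

/-! ### The symmetrized homotopy as a composition of `κhat` with the Green operator. -/

namespace FreeBVRetract

variable {𝕜 : Type*} [Field 𝕜] {n n' : ℕ} (D : FreeBVRetract 𝕜 n n')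

/-- The factors in the terms of the symmetrized homotopy. -/
def Kfactor (w : List (Fin n)) (k : Fin w.length) (s : Finset (Fin w.length)) (l : Fin w.length) :
    FormalFun 𝕜 D.gh :=
  if l = k then linForm D.gh D.κ (w.get l)
    else if l ∈ s then linForm D.gh (D.inc * D.pr) (w.get l) else X (w.get l)

theorem Kword_eq (w : List (Fin n)) : D.Kword w =
    ∑ k : Fin w.length, ∑ s ∈ (Finset.univ.erase k).powerset,
      (((s.card.factorial * (w.length - 1 - s.card).factorial : ℕ) : 𝕜) / (w.length.factorial : 𝕜) *
        ∏ l ∈ Finset.univ.filter (· < k), sg 𝕜 (D.gh (w.get l))) •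
      (List.ofFn (D.Kfactor w k s)).prod := rfl

theorem Kword_mem_Pol (w : List (Fin n)) : D.Kword w ∈ Pol 𝕜 D.gh w.length := by
  rw [Kword_eq]
  refine Submodule.sum_mem _ fun k _ => Submodule.sum_mem _ fun s _ => Submodule.smul_mem _ _ ?_
  have := list_prod_mem_Pol (List.ofFn (D.Kfactor w k s)) fun f hf => by
    rw [List.mem_ofFn] at hf
    obtain ⟨l, rfl⟩ := hf
    unfold Kfactor
    split_ifs
    · exact linForm_mem_Pol _ _
    · exact linForm_mem_Pol _ _
    · exact X_mem_Pol _
  rwa [List.length_ofFn] at this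

/-- The symmetrized homotopy as a linear map. -/
def KL : FormalFun 𝕜 D.gh →ₗ[𝕜] FormalFun 𝕜 D.gh where
  toFun := D.K
  map_add' f g := ext' fun l hl => by
    simp only [K, coeff_mk _ hl, coeff_add, add_mul, Finset.sum_add_distrib]
  map_smul' c f := ext' fun l hl => by
    simp only [K, coeff_mk _ hl, coeff_smul, mul_assoc, Finset.mul_sum, RingHom.id_apply]

theorem coeff_KL (l : Fin n →₀ ℕ) (f : FormalFun 𝕜 D.gh) : coeff l (D.KL f) =
    ∑ m ∈ Finset.finsuppAntidiag (Finset.univ : Finset (Fin n)) l.degree,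
      coeff m f * coeff l (D.Kword (word m)) := by
  by_cases h : Admissible D.gh l
  · exact coeff_mk (fun l => ∑ m ∈ Finset.finsuppAntidiag (Finset.univ : Finset (Fin n)) l.degree,
      coeff m f * coeff l (D.Kword (word m))) h
  · simp [coeff_of_not _ h]

theorem KL_graded : IsGraded D.KL where
  fil N f hf l hl := by
    rw [coeff_KL]
    refine Finset.sum_eq_zero fun m hm => ?_
    rw [mem_finsuppAntidiag_iff_degree] at hm
    rw [hf m (hm ▸ hl), zero_mul]
  pol N f hf l hl := by
    rw [coeff_KL]
    refine Finset.sum_eq_zero fun m hm => ?_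
    rw [mem_finsuppAntidiag_iff_degree] at hm
    rw [hf m (hm ▸ hl), zero_mul]

variable [CharZero 𝕜]

omit [CharZero 𝕜] in
theorem KL_mono {m : Fin n →₀ ℕ} (hm : Admissible D.gh m) :
    D.KL (mono D.gh m) = D.Kword (word m) := by
  refine ext' fun l _ => ?_
  rw [coeff_KL]
  by_cases h : m.degree = l.degree
  · rw [Finset.sum_eq_single m]
    · rw [coeff_mono hm, if_pos rfl, one_mul]
    · intro b _ hb
      rw [coeff_mono_of_ne hb, zero_mul]
    · intro h'
      exact absurd (mem_finsuppAntidiag_iff_degree.2 h) h'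
  · rw [D.Kword_mem_Pol (word m) l (by rw [length_word]; exact Ne.symm h)]
    refine Finset.sum_eq_zero fun b hb => ?_
    rw [mem_finsuppAntidiag_iff_degree] at hb
    rw [coeff_mono_of_ne (by rintro rfl; exact h hb), zero_mul]

theorem dil_X (t : 𝕜) (i : Fin n) : D.dil t (X i) =
    (1 - t) • linForm D.gh (D.inc * D.pr) i + t • X i := by
  rw [dil, substL_apply, subst_X (D.dil_isMap t), linForm_add, linForm_smul,
    show 1 - D.inc * D.pr = 1 + (-1 : 𝕜) • (D.inc * D.pr) by rw [neg_one_smul, sub_eq_add_neg],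
    linForm_add, linForm_smul, linForm_one]
  module

theorem dil_list_prod (t : 𝕜) (w : List (Fin n)) : D.dil t (w.map X).prod =
    (List.ofFn fun l => (1 - t) • linForm D.gh (D.inc * D.pr) (w.get l) + t • X (w.get l)).prod := by
  have h : ∀ w : List (Fin n), D.dil t (w.map X).prod = (w.map fun i => D.dil t (X i)).prod := by
    intro w
    induction w with
    | nil => exact subst_one (D.dil_isMap t)
    | cons i w ih => rw [List.map_cons, List.prod_cons, dil_mul, ih, List.map_cons, List.prod_cons]
  rw [h]
  congr 1
  conv_lhs => rw [← List.ofFn_get w, List.map_ofFn]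
  congr 1
  ext1 l
  exact D.dil_X t _

/-- Expansion of the derivative of a dilated monomial. -/
theorem κL_dil_word (t : 𝕜) (w : List (Fin n)) : D.κL (D.dil t (w.map X).prod) =
    ∑ k : Fin w.length, ∑ s ∈ (Finset.univ.erase k).powerset,
      ((∏ l ∈ Finset.univ.filter (· < k), sg 𝕜 (D.gh (w.get l))) *
        ((1 - t) ^ s.card * t ^ (w.length - s.card))) • (List.ofFn (D.Kfactor w k s)).prod := by
  rw [dil_list_prod, D.κL_isDer.list_prod _ (fun l => D.gh (w.get l)) fun l => by
    rw [← D.dil_X]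
    exact subst_homogeneous (D.dil_isMap t) (isHomogeneous_X _)]
  refine Finset.sum_congr rfl fun k _ => ?_
  rw [Finset.prod_congr rfl fun l _ => (show sg 𝕜 (-1 * D.gh (w.get l)) = sg 𝕜 (D.gh (w.get l)) by
    rw [neg_one_mul, sg_neg])]
  simp only [mul_smul, ← Finset.smul_sum]
  congr 1
  let m : Fin w.length → FormalFun 𝕜 D.gh := fun l => (1 - t) • linForm D.gh (D.inc * D.pr) (w.get l)
  let m' : Fin w.length → FormalFun 𝕜 D.gh := fun l =>
    if l = k then t • linForm D.gh D.κ (w.get l) else t • X (w.get l)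
  -- At position `k` the infrared part is killed because `π κ = 0`, so only `t κ` remains. The other
  -- positions still carry the sum of two terms, to be expanded multilinearly.
  have h1 : Function.update (fun l => (1 - t) • linForm D.gh (D.inc * D.pr) (w.get l) +
      t • X (w.get l)) k (D.κL ((1 - t) • linForm D.gh (D.inc * D.pr) (w.get k) +
      t • X (w.get k))) = (Finset.univ.erase k).piecewise (m + m') m' := by
    ext1 l
    by_cases hl : l = k
    · subst hl
      rw [Function.update_self, Finset.piecewise_eq_of_notMem _ _ _ (by simp), map_add, map_smul,
        map_smul, κL_linForm', κL_X, Matrix.mul_assoc, D.pr_κ, Matrix.mul_zero, linForm_zero,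
        smul_zero, zero_add]
      simp [m']
    · rw [Function.update_of_ne hl, Finset.piecewise_eq_of_mem _ _ _ (by simp [hl])]
      simp [m, m', hl]
  rw [h1]
  -- The ordered product is viewed as a multilinear map, so that the expansion over subsets and the
  -- extraction of scalars keep the order of the factors.
  let _ : Algebra 𝕜 (FormalFun 𝕜 D.gh) := Algebra.ofModule smul_mul' mul_smul'
  have h2 := (MultilinearMap.mkPiAlgebraFin 𝕜 w.length (FormalFun 𝕜 D.gh)).map_piecewise_add m m'
    (Finset.univ.erase k)
  simp only [MultilinearMap.mkPiAlgebraFin_apply] at h2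
  rw [h2]
  refine Finset.sum_congr rfl fun s hs => ?_
  have hk : k ∉ s := fun h => by simpa using Finset.mem_powerset.1 hs h
  have h3 : s.piecewise m m' = fun l => (if l ∈ s then 1 - t else t) • D.Kfactor w k s l := by
    ext1 l
    by_cases hl : l ∈ s
    · have hlk : l ≠ k := by rintro rfl; exact hk hl
      simp [m, Kfactor, hl, hlk]
    · by_cases hlk : l = k <;> simp [m', Kfactor, hl, hlk]
      subst hlk
      simp [hl]
  -- Positions in `s` contribute `1 - t`. All others, including `k`, contribute `t`.
  have h4 := (MultilinearMap.mkPiAlgebraFin 𝕜 w.length (FormalFun 𝕜 D.gh)).map_smul_univ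
    (fun l => if l ∈ s then 1 - t else t) (D.Kfactor w k s)
  simp only [MultilinearMap.mkPiAlgebraFin_apply] at h4
  rw [h3, h4, Finset.prod_ite, Finset.prod_const, Finset.prod_const, ← mul_smul,
    show Finset.univ.filter (fun l => l ∈ s) = s by ext; simp,
    show Finset.univ.filter (fun l => l ∉ s) = sᶜ by ext; simp, Finset.card_compl, Fintype.card_fin]

/-- Both sides are the integral over the unit interval of `κhat` of the dilated word against `dt/t`.
Expanding in ultraviolet degree gives `∑ κhat(aⱼ)/j`, which is the Green operator. Expanding the
product gives `∫ (1-t)^M t^N dt = M! N!/(M+N+1)!`, which is the symmetrization. -/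
theorem Kword_eq_κL_green (w : List (Fin n)) : D.Kword w = D.κL (D.green (w.map X).prod) := by
  obtain ⟨a, h1, h2, _, h4⟩ := D.exists_uv_decomp w
  have hgreen : ∀ j, D.green (a j) = (greenPoly 𝕜 w.length).eval (j : 𝕜) • a j := by
    intro j
    refine ext' fun l _ => ?_
    rw [coeff_green, D.aeval_EL_of_mem_UV (h1 j), coeff_smul, coeff_smul]
    by_cases hl : l.degree = w.length
    · rw [hl]
    · rw [h2 j l hl, mul_zero, mul_zero]
  -- The component of ultraviolet degree zero is fixed by `i p`, and `κhat i = 0`.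
  have h0 : D.κL (a 0) = 0 := by
    have := (h1 0).2 0
    rw [dil_zero, pow_zero, one_smul] at this
    rw [← this, κL_iL]
  -- At `j = 0` the coefficient is the default `0⁻¹ = 0`; it is harmless since `a 0` is killed by
  -- `κhat`, whatever `greenPoly` takes as its value at `0`.
  have hR : D.κL (D.green (w.map X).prod) =
      ∑ j ∈ Finset.range (w.length + 1), ((j : 𝕜)⁻¹) • D.κL (a j) := by
    rw [h4, map_sum, map_sum]
    refine Finset.sum_congr rfl fun j hj => ?_
    rw [hgreen, map_smul]
    cases j with
    | zero => simp [h0]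
    | succ j =>
      rw [eval_greenPoly (Nat.succ_le_succ (Nat.zero_le j)) (by simpa [Nat.lt_succ_iff] using hj)]
  rw [hR, Kword_eq]
  refine ext' fun l _ => ?_
  let q1 : Polynomial 𝕜 := ∑ k : Fin w.length, ∑ s ∈ (Finset.univ.erase k).powerset,
    ((∏ l ∈ Finset.univ.filter (· < k), sg 𝕜 (D.gh (w.get l))) *
      coeff l (List.ofFn (D.Kfactor w k s)).prod) •
        ((1 - Polynomial.X) ^ s.card * Polynomial.X ^ (w.length - s.card))
  let q2 : Polynomial 𝕜 := ∑ j ∈ Finset.range (w.length + 1),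
    Polynomial.monomial j (coeff l (D.κL (a j)))
  -- The two expansions agree for every scalar `t` and the field is infinite, so they agree as
  -- polynomials and `logInt` may be applied.
  have hq : q1 = q2 := by
    refine Polynomial.funext fun t => ?_
    have h := congrArg (coeff l) (D.κL_dil_word t w)
    rw [h4, map_sum, map_sum, coeff_sum] at h
    simp only [(h1 _).2, map_smul, coeff_smul, coeff_sum] at h
    simp only [q1, q2, Polynomial.eval_finsetSum, Polynomial.eval_smul, Polynomial.eval_mul,
      Polynomial.eval_pow, Polynomial.eval_sub, Polynomial.eval_one, Polynomial.eval_X,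
      Polynomial.eval_monomial, smul_eq_mul]
    rw [Finset.sum_congr rfl fun j _ => mul_comm (coeff l (D.κL (a j))) (t ^ j), h]
    exact Finset.sum_congr rfl fun k _ => Finset.sum_congr rfl fun s _ => by ring
  have hl := congrArg logInt hq
  simp only [q1, q2, map_sum, map_smul, logInt_monomial] at hl
  simp only [coeff_sum, coeff_smul]
  rw [← hl]
  refine Finset.sum_congr rfl fun k _ => Finset.sum_congr rfl fun s hs => ?_
  -- The position `k` never belongs to `s`, so `t` occurs at least once and the division by `t` is
  -- legitimate.
  have hcard : s.card + 1 ≤ w.length := by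
    have h := Finset.card_le_card (Finset.mem_powerset.1 hs)
    rw [Finset.card_erase_of_mem (Finset.mem_univ k), Finset.card_univ, Fintype.card_fin] at h
    have := k.pos
    omega
  rw [show w.length - s.card = (w.length - 1 - s.card) + 1 by omega, logInt_beta,
    show s.card + (w.length - 1 - s.card) + 1 = w.length by omega]
  push_cast
  rw [smul_eq_mul]
  ring

/-- The symmetrized homotopy is `κhat` composed with the inverse of `E`. -/
theorem KL_eq : D.KL = D.κL.comp D.green := by
  rw [← sub_eq_zero]
  refine linearMap_eq_zero_of_mono 0 (fun N f hf => Submodule.sub_mem _ (D.KL_graded.fil N f hf)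
    (D.κL_graded.fil _ _ (D.green_graded.fil N f hf))) fun m => ?_
  by_cases hm : Admissible D.gh m
  · rw [LinearMap.sub_apply, D.KL_mono hm, Kword_eq_κL_green, map_word_prod, LinearMap.comp_apply,
      sub_self]
  · rw [mono_of_not hm, map_zero]

theorem KL_eq_apply (f : FormalFun 𝕜 D.gh) : D.KL f = D.κL (D.green f) :=
  LinearMap.congr_fun D.KL_eq f

/-- Since `κhat² = 0`, both products equal `κhat Q₀ κhat`. -/
theorem κL_comm_EL : Commute (D.κL : Module.End 𝕜 (FormalFun 𝕜 D.gh)) D.EL := by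
  ext1 f
  simp [EL, Module.End.mul_apply, κL_κL]

theorem Q₀L_comm_EL : Commute (D.Q₀L : Module.End 𝕜 (FormalFun 𝕜 D.gh)) D.EL := by
  ext1 f
  simp [EL, Module.End.mul_apply, Q₀L_Q₀L]

theorem KL_eq_apply' (f : FormalFun 𝕜 D.gh) : D.KL f = D.green (D.κL f) := by
  rw [KL_eq_apply]
  exact D.green_comm D.κL_graded D.κL_comm_EL f

theorem κL_KL (f : FormalFun 𝕜 D.gh) : D.κL (D.KL f) = 0 := by rw [KL_eq_apply, κL_κL]

theorem KL_κL (f : FormalFun 𝕜 D.gh) : D.KL (D.κL f) = 0 := by rw [KL_eq_apply', κL_κL, map_zero]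

theorem KL_KL (f : FormalFun 𝕜 D.gh) : D.KL (D.KL f) = 0 := by
  rw [KL_eq_apply' D (D.KL f), κL_KL, map_zero]

theorem KL_iL (f : FormalFun 𝕜 D.gh') : D.KL (D.iL f) = 0 := by
  rw [KL_eq_apply', κL_iL, map_zero]

theorem pL_KL (f : FormalFun 𝕜 D.gh) : D.pL (D.KL f) = 0 := by rw [KL_eq_apply, pL_κL]

/-- The Green operator commutes with `Q₀`, so the anticommutator of `Q₀` with `K = κhat G` is `E G =
1 - i p`. -/
theorem Q₀L_KL_add (f : FormalFun 𝕜 D.gh) :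
    D.Q₀L (D.KL f) + D.KL (D.Q₀L f) = f - D.iL (D.pL f) := by
  rw [← EL_green, KL_eq_apply, KL_eq_apply, ← D.green_comm D.Q₀L_graded D.Q₀L_comm_EL, EL,
    LinearMap.add_apply, LinearMap.comp_apply, LinearMap.comp_apply, add_comm]

omit [CharZero 𝕜] in
theorem aeval_homogeneous {k : ℤ} (L : Module.End 𝕜 (FormalFun 𝕜 D.gh))
    (hL : ∀ f, IsHomogeneous k f → IsHomogeneous k (L f)) (q : Polynomial 𝕜) {f : FormalFun 𝕜 D.gh}
    (hf : IsHomogeneous k f) : IsHomogeneous k (Polynomial.aeval L q f) := by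
  induction q using Polynomial.induction_on' with
  | add p q hp hq => rw [map_add]; exact hp.add hq
  | monomial r c =>
    rw [Polynomial.aeval_monomial, ← Algebra.smul_def, LinearMap.smul_apply]
    refine IsHomogeneous.smul ?_ c
    induction r with
    | zero => simpa using hf
    | succ r ih => rw [pow_succ', Module.End.mul_apply]; exact hL _ ih

omit [CharZero 𝕜] in
theorem κL_homogeneous {k : ℤ} {f : FormalFun 𝕜 D.gh} (hf : IsHomogeneous k f) :
    IsHomogeneous (k - 1) (D.κL f) := vfL_homogeneous D.κ_linForm_hom hf

omit [CharZero 𝕜] in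
theorem EL_homogeneous {k : ℤ} {f : FormalFun 𝕜 D.gh} (hf : IsHomogeneous k f) :
    IsHomogeneous k (D.EL f) := by
  have h1 := D.κL_homogeneous (vfL_homogeneous D.d_linForm_hom hf)
  have h2 := vfL_homogeneous D.d_linForm_hom (D.κL_homogeneous hf)
  rw [add_sub_cancel_right] at h1
  rw [sub_add_cancel] at h2
  exact h1.add h2

theorem KL_homogeneous {k : ℤ} {f : FormalFun 𝕜 D.gh} (hf : IsHomogeneous k f) :
    IsHomogeneous (k - 1) (D.KL f) := by
  rw [KL_eq_apply]
  refine D.κL_homogeneous fun l hl => ?_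
  rw [coeff_green] at hl
  exact D.aeval_homogeneous D.EL (fun f hf => D.EL_homogeneous hf) _ hf l hl

end FreeBVRetract

/-! ## Geometric series of operators raising the polynomial degree -/

section Geometric

variable {𝕜 : Type*} [Field 𝕜] {n n' : ℕ} {gh : Fin n → ℤ} {gh' : Fin n' → ℤ}

/-- The operator raises the polynomial degree. -/
def Raises (T : Module.End 𝕜 (FormalFun 𝕜 gh)) : Prop :=
  ∀ N f, f ∈ Fil 𝕜 gh N → T f ∈ Fil 𝕜 gh (N + 1)

theorem Raises.pow_mem {T : Module.End 𝕜 (FormalFun 𝕜 gh)} (hT : Raises T) (k : ℕ)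
    (f : FormalFun 𝕜 gh) : (T ^ k) f ∈ Fil 𝕜 gh k := by
  induction k with
  | zero => exact mem_Fil_zero _
  | succ k ih => rw [pow_succ', Module.End.mul_apply]; exact hT _ _ ih

/-- The geometric series `∑ Tᵏ`. -/
def geo (T : Module.End 𝕜 (FormalFun 𝕜 gh)) : Module.End 𝕜 (FormalFun 𝕜 gh) where
  toFun f := FormalFun.mk gh fun l => coeff l (∑ k ∈ Finset.range (l.degree + 1), (T ^ k) f)
  map_add' f g := ext' fun l hl => by
    simp only [coeff_mk _ hl, map_add, coeff_add, Finset.sum_add_distrib]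
  map_smul' c f := ext' fun l hl => by
    simp only [coeff_mk _ hl, map_smul, coeff_smul, ← Finset.smul_sum, RingHom.id_apply]

theorem coeff_geo (T : Module.End 𝕜 (FormalFun 𝕜 gh)) (f : FormalFun 𝕜 gh) (l : Fin n →₀ ℕ) :
    coeff l (geo T f) = coeff l (∑ k ∈ Finset.range (l.degree + 1), (T ^ k) f) := by
  by_cases h : Admissible gh l
  · exact coeff_mk (fun l => coeff l (∑ k ∈ Finset.range (l.degree + 1), (T ^ k) f)) h
  · simp [coeff_of_not _ h]

/-- The `k`-th power lands in filtration `k`, so the terms from `N` on do not affect coefficients of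
degree below `N`. -/
theorem geo_sub_mem {T : Module.End 𝕜 (FormalFun 𝕜 gh)} (hT : Raises T) (N : ℕ)
    (f : FormalFun 𝕜 gh) : geo T f - ∑ k ∈ Finset.range N, (T ^ k) f ∈ Fil 𝕜 gh N := by
  intro l hl
  rw [coeff_sub, coeff_geo, sub_eq_zero, coeff_sum, coeff_sum]
  refine Finset.sum_subset (Finset.range_mono hl) fun k _ hk => ?_
  rw [Finset.mem_range, not_lt] at hk
  exact hT.pow_mem k f l (Nat.lt_of_succ_le hk)

theorem geo_eq_add {T : Module.End 𝕜 (FormalFun 𝕜 gh)} (hT : Raises T) (f : FormalFun 𝕜 gh) :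
    geo T f = f + T (geo T f) := by
  rw [← sub_eq_zero]
  refine eq_zero_of_mem_Fil fun N => ?_
  have h1 := geo_sub_mem hT N f
  have h2 := Fil_antitone (Nat.le_succ N) (hT _ _ h1)
  have h3 := hT.pow_mem N f
  have h4 : T (∑ k ∈ Finset.range N, (T ^ k) f) + f = ∑ k ∈ Finset.range N, (T ^ k) f + (T ^ N) f := by
    rw [← Finset.sum_range_succ, Finset.sum_range_succ', map_sum]
    simp [pow_succ', Module.End.mul_apply]
  rw [map_sub] at h2
  have := Submodule.sub_mem _ (Submodule.sub_mem _ h1 h2) h3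
  convert this using 1
  rw [eq_sub_of_add_eq h4]
  abel

theorem geo_eq_add' {T : Module.End 𝕜 (FormalFun 𝕜 gh)} (hT : Raises T) (f : FormalFun 𝕜 gh) :
    geo T f = f + geo T (T f) := by
  refine ext' fun l _ => ?_
  have h0 := hT.pow_mem (l.degree + 1) f l (Nat.lt_succ_self _)
  rw [coeff_geo, coeff_add, coeff_geo, Finset.sum_range_succ', Finset.sum_range_succ, coeff_add,
    coeff_add]
  simp only [← Module.End.mul_apply, ← pow_succ]
  rw [h0]
  simp [add_comm]

theorem geo_homogeneous {T : Module.End 𝕜 (FormalFun 𝕜 gh)} {k : ℤ}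
    (hT : ∀ f, IsHomogeneous k f → IsHomogeneous k (T f)) {f : FormalFun 𝕜 gh}
    (hf : IsHomogeneous k f) : IsHomogeneous k (geo T f) := by
  intro l hl
  rw [coeff_geo] at hl
  refine IsHomogeneous.sum (fun r hr => ?_) l hl
  clear hr
  induction r with
  | zero => simpa using hf
  | succ r ih => rw [pow_succ', Module.End.mul_apply]; exact hT _ ih

theorem geo_mem_Fil {T : Module.End 𝕜 (FormalFun 𝕜 gh)} (hT : Raises T) {N : ℕ} {f : FormalFun 𝕜 gh}
    (hf : f ∈ Fil 𝕜 gh N) : geo T f ∈ Fil 𝕜 gh N := by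
  intro l hl
  rw [coeff_geo]
  refine Submodule.sum_mem (Fil 𝕜 gh N) (fun r hr => ?_) l hl
  clear hr
  induction r with
  | zero => simpa using hf
  | succ r ih => rw [pow_succ', Module.End.mul_apply]; exact Fil_antitone (Nat.le_succ N) (hT _ _ ih)

/-! ### Coefficientwise convergence of geometric series. -/

section Topology

variable [TopologicalSpace 𝕜]

omit [TopologicalSpace 𝕜] in
theorem coeff_eq_apply (f : FormalFun 𝕜 gh) (m : {m : Fin n →₀ ℕ // Admissible gh m}) :
    f m = coeff m.1 f := by rw [coeff, dif_pos m.2]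

theorem tendsto_iff_coeff {α : Type*} {F : Filter α} {u : α → FormalFun 𝕜 gh} {v : FormalFun 𝕜 gh} :
    Tendsto u F (𝓝 v) ↔ ∀ m, Tendsto (fun a => coeff m (u a)) F (𝓝 (coeff m v)) := by
  have : Tendsto u F (𝓝 v) ↔ ∀ m, Tendsto (fun a => u a m) F (𝓝 (v m)) := tendsto_pi_nhds
  rw [this]
  refine ⟨fun h m => ?_, fun h m => ?_⟩
  · by_cases hm : Admissible gh m
    · simpa only [coeff_eq_apply] using h ⟨m, hm⟩
    · simpa only [coeff_of_not _ hm] using tendsto_const_nhds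
  · simpa only [coeff_eq_apply] using h m.1

theorem hasSum_iff_coeff {u : ℕ → FormalFun 𝕜 gh} {v : FormalFun 𝕜 gh} :
    HasSum u v ↔ ∀ m, HasSum (fun k => coeff m (u k)) (coeff m v) := by
  unfold HasSum
  rw [tendsto_iff_coeff]
  simp only [coeff_sum]

instance [T2Space 𝕜] : T2Space (FormalFun 𝕜 gh) := inferInstanceAs (T2Space (_ → 𝕜))

/-- Termwise application of a continuous linear map to a geometric series. -/
theorem hasSum_geo {T : Module.End 𝕜 (FormalFun 𝕜 gh)} (hT : Raises T)
    (L : FormalFun 𝕜 gh →ₗ[𝕜] FormalFun 𝕜 gh') (hL : ∀ N f, f ∈ Fil 𝕜 gh N → L f ∈ Fil 𝕜 gh' N)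
    (f : FormalFun 𝕜 gh) : HasSum (fun k => L ((T ^ k) f)) (L (geo T f)) := by
  rw [hasSum_iff_coeff]
  intro m
  have h := hL _ _ (geo_sub_mem hT (m.degree + 1) f) m (Nat.lt_succ_self _)
  rw [map_sub, coeff_sub, sub_eq_zero, map_sum, coeff_sum] at h
  rw [h]
  refine hasSum_sum_of_ne_finset_zero fun k hk => ?_
  rw [Finset.mem_range, not_lt] at hk
  exact hL _ _ (hT.pow_mem k f) m (Nat.lt_of_succ_le hk)

end Topology

end Geometric

/-! ## The perturbation lemma -/

/-- The data of the perturbation lemma: `A` stands for `(1 + δ K)⁻¹ δ`. -/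
structure IsPerturbation {𝕜 V V' : Type*} [Field 𝕜] [AddCommGroup V] [Module 𝕜 V] [AddCommGroup V']
    [Module 𝕜 V'] (d K δ A : V →ₗ[𝕜] V) (d' : V' →ₗ[𝕜] V') (i : V' →ₗ[𝕜] V) (p : V →ₗ[𝕜] V') :
    Prop where
  homotopy : ∀ x, d (K x) + K (d x) = x - i (p x)
  K_K : ∀ x, K (K x) = 0
  K_i : ∀ y, K (i y) = 0
  p_K : ∀ x, p (K x) = 0
  p_i : ∀ y, p (i y) = y
  d_i : ∀ y, d (i y) = i (d' y)
  p_d : ∀ x, p (d x) = d' (p x)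
  d_d : ∀ x, d (d x) = 0
  square : ∀ x, d (δ x) + δ (d x) + δ (δ x) = 0
  A_K_δ : ∀ x, A (K (δ x)) = δ x - A x
  δ_K_A : ∀ x, δ (K (A x)) = δ x - A x

namespace IsPerturbation

variable {𝕜 V V' : Type*} [Field 𝕜] [AddCommGroup V] [Module 𝕜 V] [AddCommGroup V']
    [Module 𝕜 V'] {d K δ A : V →ₗ[𝕜] V} {d' : V' →ₗ[𝕜] V'} {i : V' →ₗ[𝕜] V} {p : V →ₗ[𝕜] V'}
  (h : IsPerturbation d K δ A d' i p)

include h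

/-- The flatness equation for `A`, equivalent to `(d + δ)² = 0` through the resolvent. Writing `x =
y + K δ y` turns `A x` into `δ y`. The equation is then a combination of `A` applied to the homotopy
relation at `δ y`, `A K` applied to flatness of `δ`, and flatness itself. -/
theorem key (x : V) : A (i (p (A x))) + A (d x) + d (A x) = 0 := by
  -- The operator `1 - K A` is the inverse of `1 + K δ`, since `δ (x - K A x) = A x`.
  obtain ⟨y, rfl⟩ : ∃ y, x = y + K (δ y) := ⟨x - K (A x), by
    rw [map_sub δ, h.δ_K_A, sub_sub_cancel, sub_add_cancel]⟩
  have h1 : A (y + K (δ y)) = δ y := by rw [map_add, h.A_K_δ]; abel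
  have h2 := congrArg A (h.homotopy (δ y))
  have h3 := congrArg (fun z => A (K z)) (h.square y)
  have h4 := h.square y
  simp only [map_add, map_sub, h.A_K_δ, map_zero] at h2 h3
  rw [h1, map_add d, map_add A]
  linear_combination (norm := module) h2 - h3 + h4

theorem d'_d' (y : V') : d' (d' y) = 0 := by
  have := h.d_d (i y)
  rw [h.d_i, h.d_i] at this
  rw [← h.p_i (d' (d' y)), this, map_zero]

/-- In the closed forms `i - K A i`, `p - p A K`, `K - K A K` and `d' + p A i`, each relation of the
perturbed retraction is a linear combination of the unperturbed ones, the resolvent identities and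
images of `key`. -/
theorem chain_i (y : V') : (d + δ) (i y - K (A (i y))) =
    i (d' y + p (A (i y))) - K (A (i (d' y + p (A (i y))))) := by
  have h1 := h.δ_K_A (i y)
  have h2 := h.homotopy (A (i y))
  have h3 := congrArg K (h.key (i y))
  have h4 := h.d_i y
  simp only [LinearMap.add_apply, map_add, map_sub, map_zero, h4] at *
  linear_combination (norm := module) -h1 - h2 + h3

theorem chain_p (x : V) : p ((d + δ) x - A (K ((d + δ) x))) =
    d' (p (x - A (K x))) + p (A (i (p (x - A (K x))))) := by
  have h1 := h.A_K_δ x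
  have h2 := congrArg (fun z => p (A z)) (h.homotopy x)
  have h3 := congrArg p (h.key (K x))
  have h4 := h.p_d (A (K x))
  have h5 := h.p_d x
  simp only [LinearMap.add_apply, map_add, map_sub, map_zero] at *
  have h6 := congrArg p h1
  simp only [map_sub] at h6
  linear_combination (norm := module) h5 - h6 - h2 + h3 - h4

theorem square_p (y : V') : d' (d' y + p (A (i y))) + p (A (i (d' y + p (A (i y))))) = 0 := by
  have h1 := congrArg p (h.key (i y))
  have h2 := h.p_d (A (i y))
  have h3 := h.d_i y
  have h4 := h.d'_d' y
  simp only [map_add, map_zero, h3] at *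
  linear_combination (norm := module) h1 + h4 - h2

theorem homotopy_int (x : V) : (d + δ) (K x - K (A (K x))) + (K ((d + δ) x) - K (A (K ((d + δ) x)))) =
    x - (i (p (x - A (K x))) - K (A (i (p (x - A (K x)))))) := by
  have h1 := h.homotopy x
  have h2 := congrArg (fun z => K (A z)) (h.homotopy x)
  have h3 := h.homotopy (A (K x))
  have h4 := congrArg K (h.key (K x))
  have h5 := h.δ_K_A (K x)
  have h6 := congrArg K (h.A_K_δ x)
  simp only [LinearMap.add_apply, map_add, map_sub, map_zero] at *
  linear_combination (norm := module) h1 - h2 - h3 + h4 - h5 - h6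

theorem p_i_int (y : V') : p ((i y - K (A (i y))) - A (K (i y - K (A (i y))))) = y := by
  simp only [map_sub, h.K_i, h.K_K, h.p_K, h.p_i, map_zero, sub_zero]

theorem K_K_int (x : V) : K (K x - K (A (K x))) - K (A (K (K x - K (A (K x))))) = 0 := by
  simp only [map_sub, h.K_K, map_zero, sub_zero]

theorem K_i_int (y : V') : K (i y - K (A (i y))) - K (A (K (i y - K (A (i y))))) = 0 := by
  simp only [map_sub, h.K_K, h.K_i, map_zero, sub_zero]

theorem p_K_int (x : V) : p (K x - K (A (K x)) - A (K (K x - K (A (K x))))) = 0 := by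
  simp only [map_sub, h.K_K, h.p_K, map_zero, sub_zero]

end IsPerturbation

namespace FreeBVRetract

variable {𝕜 : Type*} [Field 𝕜] {n n' : ℕ} (D : FreeBVRetract 𝕜 n n') (Sint : FormalFun 𝕜 D.gh)

/-! ## The interacting classical retraction -/

/-- `Q_int` as a linear map. -/
def QintL : Module.End 𝕜 (FormalFun 𝕜 D.gh) := vfL (hamComp D.ω Sint)

/-- `Q` as a linear map. -/
def QL : Module.End 𝕜 (FormalFun 𝕜 D.gh) := vfL (hamComp D.ω (D.S Sint))

/-- The operator `(1 + Q_int K)⁻¹`. -/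
def resL : Module.End 𝕜 (FormalFun 𝕜 D.gh) := geo (-(D.QintL Sint * D.KL))

/-- The operator `(1 + Q_int K)⁻¹ Q_int`. -/
def AL : Module.End 𝕜 (FormalFun 𝕜 D.gh) := D.resL Sint * D.QintL Sint

/-- `i_int` as a linear map. -/
def iIntL : FormalFun 𝕜 D.gh' →ₗ[𝕜] FormalFun 𝕜 D.gh :=
  D.iL - D.KL.comp ((D.AL Sint).comp D.iL)

/-- `p_int` as a linear map. -/
def pIntL : FormalFun 𝕜 D.gh →ₗ[𝕜] FormalFun 𝕜 D.gh' :=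
  D.pL - D.pL.comp ((D.AL Sint).comp D.KL)

/-- `K_int` as a linear map. -/
def KIntL : FormalFun 𝕜 D.gh →ₗ[𝕜] FormalFun 𝕜 D.gh :=
  D.KL - D.KL.comp ((D.AL Sint).comp D.KL)

/-- The induced differential as a linear map. -/
def QIntL' : FormalFun 𝕜 D.gh' →ₗ[𝕜] FormalFun 𝕜 D.gh' :=
  D.Q₀L' + D.pL.comp ((D.AL Sint).comp D.iL)

theorem iIntL_apply (f : FormalFun 𝕜 D.gh') :
    D.iIntL Sint f = D.iL f - D.KL (D.AL Sint (D.iL f)) := rfl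

theorem pIntL_apply (f : FormalFun 𝕜 D.gh) :
    D.pIntL Sint f = D.pL (f - D.AL Sint (D.KL f)) := by
  rw [map_sub]; rfl

theorem KIntL_apply (f : FormalFun 𝕜 D.gh) :
    D.KIntL Sint f = D.KL f - D.KL (D.AL Sint (D.KL f)) := rfl

variable {Sint} (h : D.IsInteraction Sint)

include h

theorem S_homogeneous : IsHomogeneous 0 (D.S Sint) := D.isHomogeneous_S₀.add h.1

theorem S_mem_Fil : D.S Sint ∈ Fil 𝕜 D.gh 2 :=
  Submodule.add_mem _ quadraticAction_mem_Fil (Fil_antitone (by omega) h.2)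

theorem Qint_eq (f : FormalFun 𝕜 D.gh) : D.Qint Sint f = D.QintL Sint f := bracket_eq h.1 f

theorem Q_eq (f : FormalFun 𝕜 D.gh) : D.Q Sint f = D.QL Sint f := bracket_eq (D.S_homogeneous h) f

theorem QintL_raises : Raises (D.QintL Sint) := by
  intro N f hf
  rw [QintL, vfL_apply']
  refine Submodule.sum_mem _ fun i _ => ?_
  have hv : hamComp D.ω Sint i ∈ Fil 𝕜 D.gh 2 := hamComp_mem_Fil (show Sint ∈ Fil 𝕜 D.gh 3 from h.2) i
  cases N with
  | zero => exact Fil_antitone (by omega) (mul_mem_Fil_right hv _)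
  | succ N => exact Fil_antitone (by omega) (mul_mem_Fil hv (dL_mem_Fil hf))

theorem QintL_KL_raises : Raises (-(D.QintL Sint * D.KL)) := fun N f hf =>
  Submodule.neg_mem _ (D.QintL_raises h N _ (D.KL_graded.fil N f hf))

theorem KL_QintL_raises : Raises (-(D.KL * D.QintL Sint) : Module.End 𝕜 (FormalFun 𝕜 D.gh)) :=
  fun N _ hf => Submodule.neg_mem _ (D.KL_graded.fil _ _ (D.QintL_raises h N _ hf))

theorem QintL_KL_resL (f : FormalFun 𝕜 D.gh) :
    D.QintL Sint (D.KL (D.resL Sint f)) = f - D.resL Sint f := by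
  have := geo_eq_add (D.QintL_KL_raises h) f
  rw [eq_sub_iff_add_eq]
  rw [LinearMap.neg_apply, Module.End.mul_apply] at this
  rw [add_comm]
  exact eq_add_neg_iff_add_eq.1 this

theorem resL_QintL_KL (f : FormalFun 𝕜 D.gh) :
    D.resL Sint (D.QintL Sint (D.KL f)) = f - D.resL Sint f := by
  have := geo_eq_add' (D.QintL_KL_raises h) f
  rw [eq_sub_iff_add_eq]
  rw [LinearMap.neg_apply, Module.End.mul_apply, map_neg] at this
  rw [add_comm]
  exact eq_add_neg_iff_add_eq.1 this

theorem resL_eq (f : FormalFun 𝕜 D.gh) : D.resL Sint f = f - D.AL Sint (D.KL f) := by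
  rw [AL, Module.End.mul_apply, D.resL_QintL_KL h, sub_sub_cancel]

/-- The push-through identity `(1 + K Q)⁻¹ = 1 - K (1 + Q K)⁻¹ Q` with `Q = Q_int`. It brings the
series for `i_int` into the closed form of the perturbation lemma. -/
theorem geo_KL_QintL (f : FormalFun 𝕜 D.gh) :
    geo (-(D.KL * D.QintL Sint) : Module.End 𝕜 (FormalFun 𝕜 D.gh)) f = f - D.KL (D.AL Sint f) := by
  have h1 : f = (f - D.KL (D.AL Sint f)) + D.KL (D.QintL Sint (f - D.KL (D.AL Sint f))) := by
    rw [map_sub, AL, Module.End.mul_apply, D.QintL_KL_resL h, sub_sub_cancel, sub_add_cancel]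
  have h2 := geo_eq_add' (D.KL_QintL_raises h) (f - D.KL (D.AL Sint f))
  rw [LinearMap.neg_apply, Module.End.mul_apply, map_neg, eq_add_neg_iff_add_eq, ← map_add, ← h1] at h2
  exact h2

theorem AL_fil {N : ℕ} {f : FormalFun 𝕜 D.gh} (hf : f ∈ Fil 𝕜 D.gh N) :
    D.AL Sint f ∈ Fil 𝕜 D.gh (N + 1) := geo_mem_Fil (D.QintL_KL_raises h) (D.QintL_raises h N f hf)

theorem iIntL_fil {N : ℕ} {f : FormalFun 𝕜 D.gh'} (hf : f ∈ Fil 𝕜 D.gh' N) :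
    D.iIntL Sint f ∈ Fil 𝕜 D.gh N :=
  Submodule.sub_mem _ (D.iL_graded.fil _ _ hf) (D.KL_graded.fil _ _ (Fil_antitone (Nat.le_succ N)
    (D.AL_fil h (D.iL_graded.fil _ _ hf))))

theorem pIntL_fil {N : ℕ} {f : FormalFun 𝕜 D.gh} (hf : f ∈ Fil 𝕜 D.gh N) :
    D.pIntL Sint f ∈ Fil 𝕜 D.gh' N :=
  Submodule.sub_mem _ (D.pL_graded.fil _ _ hf) (D.pL_graded.fil _ _ (Fil_antitone (Nat.le_succ N)
    (D.AL_fil h (D.KL_graded.fil _ _ hf))))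

theorem KIntL_fil {N : ℕ} {f : FormalFun 𝕜 D.gh} (hf : f ∈ Fil 𝕜 D.gh N) :
    D.KIntL Sint f ∈ Fil 𝕜 D.gh N :=
  Submodule.sub_mem _ (D.KL_graded.fil _ _ hf) (D.KL_graded.fil _ _ (Fil_antitone (Nat.le_succ N)
    (D.AL_fil h (D.KL_graded.fil _ _ hf))))

omit h in
theorem QL_eq_add [CharZero 𝕜] : D.QL Sint = D.Q₀L + D.QintL Sint := by
  ext1 f
  rw [LinearMap.add_apply, QL, Q₀L, QintL, vfL_apply', vfL_apply', vfL_apply', ← Finset.sum_add_distrib]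
  refine Finset.sum_congr rfl fun j _ => ?_
  rw [S, hamComp_add, S₀, hamComp_quadraticAction D.ω_symm D.ω_nondeg D.d_compat, add_mul]

theorem QL_isDer : IsDer 1 (D.QL Sint) :=
  ham_isDer D.ω_deg D.ω_nondeg (D.S_homogeneous h) (D.S_mem_Fil h)

theorem QL_X_hom (i : Fin n) : IsHomogeneous (D.gh i + 1) (D.QL Sint (X i)) := by
  rw [QL, vfL_X]
  exact hamComp_homogeneous D.ω_deg D.ω_nondeg (D.S_homogeneous h) i

theorem QL_homogeneous {k : ℤ} {f : FormalFun 𝕜 D.gh} (hf : IsHomogeneous k f) :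
    IsHomogeneous (k + 1) (D.QL Sint f) :=
  vfL_homogeneous (hamComp_homogeneous D.ω_deg D.ω_nondeg (D.S_homogeneous h)) hf

theorem QintL_homogeneous {k : ℤ} {f : FormalFun 𝕜 D.gh} (hf : IsHomogeneous k f) :
    IsHomogeneous (k + 1) (D.QintL Sint f) :=
  vfL_homogeneous (hamComp_homogeneous D.ω_deg D.ω_nondeg h.1) hf

variable [CharZero 𝕜]

theorem AL_homogeneous {k : ℤ} {f : FormalFun 𝕜 D.gh} (hf : IsHomogeneous k f) :
    IsHomogeneous (k + 1) (D.AL Sint f) := by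
  refine geo_homogeneous (fun g hg => ?_) (D.QintL_homogeneous h hf)
  have := D.QintL_homogeneous h (D.KL_homogeneous hg)
  rw [sub_add_cancel] at this
  exact this.neg

omit [CharZero 𝕜] h in
theorem iL_homogeneous {k : ℤ} {f : FormalFun 𝕜 D.gh'} (hf : IsHomogeneous k f) :
    IsHomogeneous k (D.iL f) := subst_homogeneous D.pr_isMap hf

omit [CharZero 𝕜] h in
theorem pL_homogeneous {k : ℤ} {f : FormalFun 𝕜 D.gh} (hf : IsHomogeneous k f) :
    IsHomogeneous k (D.pL f) := subst_homogeneous D.inc_isMap hf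

theorem iIntL_homogeneous {k : ℤ} {f : FormalFun 𝕜 D.gh'} (hf : IsHomogeneous k f) :
    IsHomogeneous k (D.iIntL Sint f) := by
  have := D.KL_homogeneous (D.AL_homogeneous h (D.iL_homogeneous hf))
  rw [add_sub_cancel_right] at this
  rw [iIntL_apply, sub_eq_add_neg]
  exact (D.iL_homogeneous hf).add this.neg

theorem pIntL_homogeneous {k : ℤ} {f : FormalFun 𝕜 D.gh} (hf : IsHomogeneous k f) :
    IsHomogeneous k (D.pIntL Sint f) := by
  have := D.AL_homogeneous h (D.KL_homogeneous hf)
  rw [sub_add_cancel] at this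
  rw [pIntL_apply, sub_eq_add_neg]
  exact D.pL_homogeneous (hf.add this.neg)

theorem KIntL_homogeneous {k : ℤ} {f : FormalFun 𝕜 D.gh} (hf : IsHomogeneous k f) :
    IsHomogeneous (k - 1) (D.KIntL Sint f) := by
  have := D.AL_homogeneous h (D.KL_homogeneous hf)
  rw [sub_add_cancel] at this
  rw [KIntL_apply, sub_eq_add_neg (D.KL f)]
  exact (D.KL_homogeneous hf).add (D.KL_homogeneous this).neg

/-- Flatness of the perturbation is `Q² = 0` expanded around `Q₀² = 0`; the two relations for `A`
are the two one-sided resolvent identities. -/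
theorem isPerturbation (hsq : ∀ f, D.QL Sint (D.QL Sint f) = 0) :
    IsPerturbation D.Q₀L D.KL (D.QintL Sint) (D.AL Sint) D.Q₀L' D.iL D.pL where
  homotopy := D.Q₀L_KL_add
  K_K := D.KL_KL
  K_i := D.KL_iL
  p_K := D.pL_KL
  p_i := D.pL_iL
  d_i := D.Q₀L_iL
  p_d := D.pL_Q₀L
  d_d := D.Q₀L_Q₀L
  square f := by
    have h1 := hsq f
    rw [D.QL_eq_add] at h1
    simp only [LinearMap.add_apply, map_add, D.Q₀L_Q₀L, zero_add] at h1
    rw [← h1]; abel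
  A_K_δ f := by
    rw [AL, Module.End.mul_apply, Module.End.mul_apply, D.resL_QintL_KL h]
  δ_K_A f := by
    rw [AL, Module.End.mul_apply, D.QintL_KL_resL h]

variable [TopologicalSpace 𝕜]

omit [TopologicalSpace 𝕜] [CharZero 𝕜] h in
theorem iterate_neg_mul (L M : Module.End 𝕜 (FormalFun 𝕜 D.gh)) (k : ℕ) (f : FormalFun 𝕜 D.gh) :
    (fun v => -L (M v))^[k] f = ((-(L * M)) ^ k) f := by
  rw [Module.End.pow_apply]; rfl

omit [TopologicalSpace 𝕜] [CharZero 𝕜] in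
theorem Qint_eq_coe : D.Qint Sint = ⇑(D.QintL Sint) := funext (D.Qint_eq h)

omit [CharZero 𝕜] in
theorem hasSum_iInt (f : FormalFun 𝕜 D.gh') :
    HasSum (fun k : ℕ => (fun v => -D.K (D.Qint Sint v))^[k] (D.i f)) (D.iIntL Sint f) := by
  have := hasSum_geo (D.KL_QintL_raises h) LinearMap.id (fun N f hf => hf) (D.iL f)
  simp only [LinearMap.id_apply, D.geo_KL_QintL h, ← iterate_neg_mul] at this
  rw [D.Qint_eq_coe h]
  exact this

omit [CharZero 𝕜] in
theorem hasSum_pInt (f : FormalFun 𝕜 D.gh) :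
    HasSum (fun k : ℕ => D.p ((fun v => -D.Qint Sint (D.K v))^[k] f)) (D.pIntL Sint f) := by
  have := hasSum_geo (D.QintL_KL_raises h) D.pL D.pL_graded.fil f
  simp only [← iterate_neg_mul] at this
  rw [D.Qint_eq_coe h, pIntL_apply, ← D.resL_eq h]
  exact this

omit [CharZero 𝕜] in
theorem hasSum_KInt (f : FormalFun 𝕜 D.gh) :
    HasSum (fun k : ℕ => D.K ((fun v => -D.Qint Sint (D.K v))^[k] f)) (D.KIntL Sint f) := by
  have := hasSum_geo (D.QintL_KL_raises h) D.KL D.KL_graded.fil f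
  simp only [← iterate_neg_mul] at this
  rw [D.Qint_eq_coe h, KIntL_apply, ← map_sub, ← D.resL_eq h]
  exact this

omit [CharZero 𝕜] in
theorem hasSum_QInt' (f : FormalFun 𝕜 D.gh') :
    HasSum (fun k : ℕ => D.p ((fun v => -D.Qint Sint (D.K v))^[k] (D.Qint Sint (D.i f))))
      (D.pL (D.AL Sint (D.iL f))) := by
  have := hasSum_geo (D.QintL_KL_raises h) D.pL D.pL_graded.fil (D.QintL Sint (D.iL f))
  simp only [← iterate_neg_mul] at this
  rw [D.Qint_eq_coe h]
  exact this

omit [CharZero 𝕜] in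
theorem hplConverges : HPLConverges D.p D.K (D.Qint Sint) D.i where
  conv_i f := (D.hasSum_iInt h f).summable
  conv_p f := (D.hasSum_pInt h f).summable
  conv_K f := (D.hasSum_KInt h f).summable
  conv_d f := (D.hasSum_QInt' h f).summable

variable [T2Space 𝕜]

omit [CharZero 𝕜] in
theorem iInt_eq (f : FormalFun 𝕜 D.gh') : D.iInt Sint f = D.iIntL Sint f := (D.hasSum_iInt h f).tsum_eq

omit [CharZero 𝕜] in
theorem pInt_eq (f : FormalFun 𝕜 D.gh) : D.pInt Sint f = D.pIntL Sint f := (D.hasSum_pInt h f).tsum_eq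

omit [CharZero 𝕜] in
theorem KInt_eq (f : FormalFun 𝕜 D.gh) : D.KInt Sint f = D.KIntL Sint f := (D.hasSum_KInt h f).tsum_eq

theorem QInt'_eq (f : FormalFun 𝕜 D.gh') : D.QInt' Sint f = D.QIntL' Sint f := by
  rw [QInt', hplD, (D.hasSum_QInt' h f).tsum_eq, Q'₀_eq]; rfl

end FreeBVRetract

namespace FreeBVRetract

variable {𝕜 : Type*} [Field 𝕜] [CharZero 𝕜] {n n' : ℕ} (D : FreeBVRetract 𝕜 n n')
  (Sint : FormalFun 𝕜 D.gh)

/-! ## The Hamiltonian `H = [κhat, Q]` -/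

/-- `H` as a linear map. -/
def HL : Module.End 𝕜 (FormalFun 𝕜 D.gh) := D.κL.comp (D.QL Sint) + (D.QL Sint).comp D.κL

omit [CharZero 𝕜] in
theorem HL_apply (f : FormalFun 𝕜 D.gh) :
    D.HL Sint f = D.κL (D.QL Sint f) + D.QL Sint (D.κL f) := rfl

variable {Sint} (h : D.IsInteraction Sint)

/-- This identity and the next two use that `κhat` and `K` compose to zero in either order, which is
where the factorization of the symmetrized homotopy through `κhat` on both sides enters. -/
theorem κL_iIntL (f : FormalFun 𝕜 D.gh') : D.κL (D.iIntL Sint f) = 0 := by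
  rw [iIntL_apply, map_sub, κL_iL, κL_KL, sub_zero]

theorem pIntL_κL (f : FormalFun 𝕜 D.gh) : D.pIntL Sint (D.κL f) = 0 := by
  rw [pIntL_apply, KL_κL, map_zero, sub_zero, pL_κL]

theorem KIntL_κL (f : FormalFun 𝕜 D.gh) : D.KIntL Sint (D.κL f) = 0 := by
  rw [KIntL_apply, KL_κL, map_zero, map_zero, sub_zero]

theorem pIntL_iL (f : FormalFun 𝕜 D.gh') : D.pIntL Sint (D.iL f) = f := by
  rw [pIntL_apply, KL_iL, map_zero, sub_zero, pL_iL]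

theorem pL_iIntL (f : FormalFun 𝕜 D.gh') : D.pL (D.iIntL Sint f) = f := by
  rw [iIntL_apply, map_sub, pL_KL, sub_zero, pL_iL]

theorem HL_κL (f : FormalFun 𝕜 D.gh) : D.HL Sint (D.κL f) = D.κL (D.HL Sint f) := by
  simp only [HL_apply, κL_κL, map_add, map_zero, add_zero, zero_add]

include h

omit [CharZero 𝕜] in
theorem HL_isDer : IsDer 0 (D.HL Sint) :=
  IsDer.anticomm (by decide) odd_one D.κL_isDer (D.QL_isDer h) D.κL_X_hom (D.QL_X_hom h)

omit [CharZero 𝕜] in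
theorem HL_homogeneous {k : ℤ} {f : FormalFun 𝕜 D.gh} (hf : IsHomogeneous k f) :
    IsHomogeneous k (D.HL Sint f) := by
  have h1 := D.κL_homogeneous (D.QL_homogeneous h hf)
  have h2 := D.QL_homogeneous h (D.κL_homogeneous hf)
  rw [add_sub_cancel_right] at h1
  rw [sub_add_cancel] at h2
  exact h1.add h2

/-- The difference is the commutator of `κhat` with `Q_int`, which raises the degree. To leading
order `H` thus has the eigenvalues of `E`. -/
theorem HL_sub_EL_mem {N : ℕ} {f : FormalFun 𝕜 D.gh} (hf : f ∈ Fil 𝕜 D.gh N) :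
    D.HL Sint f - D.EL f ∈ Fil 𝕜 D.gh (N + 1) := by
  have : D.HL Sint f - D.EL f = D.κL (D.QintL Sint f) + D.QintL Sint (D.κL f) := by
    rw [HL_apply, D.QL_eq_add, EL]
    simp only [LinearMap.add_apply, LinearMap.comp_apply, map_add]
    abel
  rw [this]
  exact Submodule.add_mem _ (D.κL_graded.fil _ _ (D.QintL_raises h _ _ hf))
    (D.QintL_raises h _ _ (D.κL_graded.fil _ _ hf))

omit [CharZero 𝕜] in
theorem H_eq (f : FormalFun 𝕜 D.gh) : D.H Sint f = D.HL Sint f := by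
  rw [H, D.Q_eq h, D.Q_eq h, HL_apply, κL_apply, κL_apply]

variable (hsq : ∀ f, D.QL Sint (D.QL Sint f) = 0)

include hsq

theorem QL_iIntL (f : FormalFun 𝕜 D.gh') :
    D.QL Sint (D.iIntL Sint f) = D.iIntL Sint (D.QIntL' Sint f) := by
  rw [QL_eq_add]; exact (D.isPerturbation h hsq).chain_i f

theorem pIntL_QL (f : FormalFun 𝕜 D.gh) :
    D.pIntL Sint (D.QL Sint f) = D.QIntL' Sint (D.pIntL Sint f) := by
  rw [pIntL_apply, pIntL_apply, QL_eq_add]; exact (D.isPerturbation h hsq).chain_p f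

theorem QL_KIntL_add (f : FormalFun 𝕜 D.gh) : D.QL Sint (D.KIntL Sint f) +
    D.KIntL Sint (D.QL Sint f) = f - D.iIntL Sint (D.pIntL Sint f) := by
  rw [pIntL_apply, QL_eq_add]; exact (D.isPerturbation h hsq).homotopy_int f

theorem pIntL_iIntL (f : FormalFun 𝕜 D.gh') : D.pIntL Sint (D.iIntL Sint f) = f := by
  rw [pIntL_apply]; exact (D.isPerturbation h hsq).p_i_int f

theorem KIntL_KIntL (f : FormalFun 𝕜 D.gh) : D.KIntL Sint (D.KIntL Sint f) = 0 :=
  (D.isPerturbation h hsq).K_K_int f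

theorem KIntL_iIntL (f : FormalFun 𝕜 D.gh') : D.KIntL Sint (D.iIntL Sint f) = 0 :=
  (D.isPerturbation h hsq).K_i_int f

theorem pIntL_KIntL (f : FormalFun 𝕜 D.gh) : D.pIntL Sint (D.KIntL Sint f) = 0 := by
  rw [pIntL_apply]; exact (D.isPerturbation h hsq).p_K_int f

theorem QIntL'_QIntL' (f : FormalFun 𝕜 D.gh') : D.QIntL' Sint (D.QIntL' Sint f) = 0 :=
  (D.isPerturbation h hsq).square_p f

/-- Both terms of `H` contain `κhat`, and `p_int` moves past `Q` to meet it. -/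
theorem pIntL_HL (f : FormalFun 𝕜 D.gh) : D.pIntL Sint (D.HL Sint f) = 0 := by
  rw [HL_apply, map_add, pIntL_κL, D.pIntL_QL h hsq, pIntL_κL, map_zero, add_zero]

theorem HL_iIntL (f : FormalFun 𝕜 D.gh') : D.HL Sint (D.iIntL Sint f) = 0 := by
  rw [HL_apply, D.QL_iIntL h hsq, κL_iIntL, κL_iIntL, map_zero, add_zero]

/-- The homotopy relation applied to `κhat f`, where two of its four terms vanish. This is the
differential form of the integral formula for `K_int`. -/
theorem KIntL_HL (f : FormalFun 𝕜 D.gh) : D.KIntL Sint (D.HL Sint f) = D.κL f := by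
  have := D.QL_KIntL_add h hsq (D.κL f)
  rw [KIntL_κL, pIntL_κL, map_zero, map_zero, zero_add, sub_zero] at this
  rw [HL_apply, map_add, KIntL_κL, zero_add, this]

/-- Since `p_int i = 1`, the induced differential is `p_int Q i`, and the property passes from the
factors. The same formula gives the filtration bound and the derivation property. -/
theorem QIntL'_homogeneous {k : ℤ} {f : FormalFun 𝕜 D.gh'} (hf : IsHomogeneous k f) :
    IsHomogeneous (k + 1) (D.QIntL' Sint f) := by
  have := D.pIntL_homogeneous h (D.QL_homogeneous h (D.iL_homogeneous hf))
  rwa [D.pIntL_QL h hsq, pIntL_iL] at this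

theorem QIntL'_fil {N : ℕ} {f : FormalFun 𝕜 D.gh'} (hf : f ∈ Fil 𝕜 D.gh' N) :
    D.QIntL' Sint f ∈ Fil 𝕜 D.gh' N := by
  have := D.pIntL_fil h ((D.QL_isDer h).fil _ _ (D.iL_graded.fil _ _ hf))
  rwa [D.pIntL_QL h hsq, pIntL_iL] at this

theorem isSDR [TopologicalSpace 𝕜] [T2Space 𝕜] : IsSDR (D.Q Sint) (D.QInt' Sint) (D.iInt Sint)
    (D.pInt Sint) (D.KInt Sint) := by
  have e1 : D.Q Sint = ⇑(D.QL Sint) := funext (D.Q_eq h)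
  have e2 : D.QInt' Sint = ⇑(D.QIntL' Sint) := funext (D.QInt'_eq h)
  have e3 : D.iInt Sint = ⇑(D.iIntL Sint) := funext (D.iInt_eq h)
  have e4 : D.pInt Sint = ⇑(D.pIntL Sint) := funext (D.pInt_eq h)
  have e5 : D.KInt Sint = ⇑(D.KIntL Sint) := funext (D.KInt_eq h)
  rw [e1, e2, e3, e4, e5]
  exact
    { linear_i := (D.iIntL Sint).isLinear
      linear_p := (D.pIntL Sint).isLinear
      linear_K := (D.KIntL Sint).isLinear
      degree_i := fun _ _ => D.iIntL_homogeneous h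
      degree_p := fun _ _ => D.pIntL_homogeneous h
      degree_K := fun _ _ => D.KIntL_homogeneous h
      square := hsq
      square' := D.QIntL'_QIntL' h hsq
      chain_i := D.QL_iIntL h hsq
      chain_p := D.pIntL_QL h hsq
      homotopy := D.QL_KIntL_add h hsq
      p_i := D.pIntL_iIntL h hsq
      K_K := D.KIntL_KIntL h hsq
      K_i := D.KIntL_iIntL h hsq
      p_K := D.pIntL_KIntL h hsq }

omit [CharZero 𝕜] h hsq in
theorem comm_homogeneous {k l : ℤ} {f g : FormalFun 𝕜 D.gh} (hf : IsHomogeneous k f)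
    (hg : IsHomogeneous l g) : f * g = (-1 : 𝕜) ^ (k * l).natAbs • (g * f) := by
  rw [mul_comm_tw hf, tw_homogeneous hg, smul_mul_assoc]; rfl

omit [CharZero 𝕜] in
theorem isDGCommAlgebra : IsDGCommAlgebra (D.Q Sint) := by
  rw [show D.Q Sint = ⇑(D.QL Sint) from funext (D.Q_eq h)]
  refine ⟨(D.QL Sint).isLinear, fun _ _ => D.QL_homogeneous h, hsq, fun k f g hf => ?_,
    fun k l f g hf hg => D.comm_homogeneous hf hg⟩
  rw [(D.QL_isDer h).leibniz, tw_homogeneous hf, smul_mul_assoc, one_mul]; rfl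

end FreeBVRetract

/-! ## One-parameter groups of operators on formal functions -/

section Flow

variable {𝕜 : Type*} [RCLike 𝕜] {n n' : ℕ} {gh : Fin n → ℤ} {gh' : Fin n' → ℤ}

/-- The exponents of nonzero monomials of degree at most `N`. -/
abbrev Idx (gh : Fin n → ℤ) (N : ℕ) : Type := {m : Fin n →₀ ℕ // m ∈ mons n N ∧ Admissible gh m}

instance (N : ℕ) : Finite (Idx gh N) :=
  Finite.of_injective (fun m : Idx gh N => (⟨m.1, m.2.1⟩ : {m // m ∈ mons n N}))
    fun _ _ hab => Subtype.ext (congrArg (fun x => x.1) hab)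

instance (N : ℕ) : Fintype (Idx gh N) := Fintype.ofFinite _

/-- The coefficients up to degree `N`. -/
def jet (𝕜 : Type*) [RCLike 𝕜] (gh : Fin n → ℤ) (N : ℕ) : FormalFun 𝕜 gh →ₗ[𝕜] (Idx gh N → 𝕜) where
  toFun f m := coeff m.1 f
  map_add' f g := funext fun _ => coeff_add _ f g
  map_smul' c f := funext fun _ => coeff_smul _ c f

@[simp] theorem jet_apply (N : ℕ) (f : FormalFun 𝕜 gh) (m : Idx gh N) : jet 𝕜 gh N f m = coeff m.1 f :=
  rfl

open scoped Classical in
/-- The polynomial with prescribed coefficients. -/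
def ofJet (𝕜 : Type*) [RCLike 𝕜] (gh : Fin n → ℤ) (N : ℕ) :
    (Idx gh N → 𝕜) →ₗ[𝕜] FormalFun 𝕜 gh where
  toFun v := FormalFun.mk gh fun m => if hm : m ∈ mons n N ∧ Admissible gh m then v ⟨m, hm⟩ else 0
  map_add' v w := ext' fun m hm => by
    simp only [coeff_mk _ hm, coeff_add, Pi.add_apply]; split_ifs <;> simp
  map_smul' c v := ext' fun m hm => by
    simp only [coeff_mk _ hm, coeff_smul, Pi.smul_apply, RingHom.id_apply]; split_ifs <;> first | rfl | simp

theorem jet_ofJet (N : ℕ) (v : Idx gh N → 𝕜) : jet 𝕜 gh N (ofJet 𝕜 gh N v) = v := by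
  ext m
  rw [jet_apply, ofJet, LinearMap.coe_mk, AddHom.coe_mk, coeff_mk _ m.2.2, dif_pos m.2]

theorem jet_eq_zero {N : ℕ} {f : FormalFun 𝕜 gh} (hf : f ∈ Fil 𝕜 gh (N + 1)) : jet 𝕜 gh N f = 0 := by
  ext m
  exact hf m.1 (Nat.lt_succ_of_le (mem_mons.1 m.2.1))

theorem jet_eq_iff {N : ℕ} {f g : FormalFun 𝕜 gh} :
    jet 𝕜 gh N f = jet 𝕜 gh N g ↔ f - g ∈ Fil 𝕜 gh (N + 1) := by
  refine ⟨fun h m hm => ?_, fun h => ?_⟩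
  · by_cases hadm : Admissible gh m
    · have := congrFun h ⟨m, mem_mons.2 (Nat.le_of_lt_succ hm), hadm⟩
      rw [coeff_sub, sub_eq_zero]
      exact this
    · exact coeff_of_not _ hadm
  · rw [← sub_eq_zero, ← map_sub, jet_eq_zero h]

variable (L : Module.End 𝕜 (FormalFun 𝕜 gh))

/-- The operator induced on coefficients up to degree `N`. -/
def jetOp (N : ℕ) : (Idx gh N → 𝕜) →L[𝕜] (Idx gh N → 𝕜) :=
  LinearMap.toContinuousLinearMap ((jet 𝕜 gh N).comp (L.comp (ofJet 𝕜 gh N)))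

/-- `L` preserves the filtration by polynomial degree. -/
def Filtered (L : FormalFun 𝕜 gh →ₗ[𝕜] FormalFun 𝕜 gh') : Prop :=
  ∀ N f, f ∈ Fil 𝕜 gh N → L f ∈ Fil 𝕜 gh' N

variable {L}

theorem jetOp_jet (hL : Filtered L) (N : ℕ) (f : FormalFun 𝕜 gh) :
    jetOp L N (jet 𝕜 gh N f) = jet 𝕜 gh N (L f) := by
  change jet 𝕜 gh N (L (ofJet 𝕜 gh N (jet 𝕜 gh N f))) = _
  rw [jet_eq_iff, ← map_sub]
  exact hL _ _ (jet_eq_iff.1 (jet_ofJet N _))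

variable (L)

/-- `y` solves `y' = -L y`, coefficientwise. -/
def IsSol (y : ℝ → FormalFun 𝕜 gh) : Prop :=
  ∀ T m, HasDerivAt (fun t => coeff m (y t)) (-coeff m (L (y T))) T

variable {L}

theorem IsSol.hasDerivAt_jet (hL : Filtered L) {y : ℝ → FormalFun 𝕜 gh} (hy : IsSol L y) (N : ℕ)
    (T : ℝ) : HasDerivAt (fun t => jet 𝕜 gh N (y t)) (-jetOp L N (jet 𝕜 gh N (y T))) T := by
  rw [jetOp_jet hL, hasDerivAt_pi]
  exact fun m => hy T m.1

theorem linear_ode_unique {V : Type*} [NormedAddCommGroup V] [NormedSpace 𝕜 V] [NormedSpace ℝ V]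
    (A : V →L[𝕜] V) {x y : ℝ → V} (hx : ∀ T, HasDerivAt x (-A (x T)) T)
    (hy : ∀ T, HasDerivAt y (-A (y T)) T) (h0 : x 0 = y 0) : x = y :=
  ODE_solution_unique_univ (v := fun _ z => -A z) (s := fun _ => Set.univ) (K := ‖-A‖₊) (t₀ := 0)
    (fun _ => ((-A).lipschitz).lipschitzOnWith) (fun t => ⟨hx t, Set.mem_univ _⟩)
    (fun t => ⟨hy t, Set.mem_univ _⟩) h0

theorem IsSol.unique (hL : Filtered L) {y z : ℝ → FormalFun 𝕜 gh} (hy : IsSol L y) (hz : IsSol L z)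
    (h0 : y 0 = z 0) : y = z := by
  funext T
  refine ext' fun m hm => ?_
  have := linear_ode_unique (jetOp L m.degree) (hy.hasDerivAt_jet hL m.degree)
    (hz.hasDerivAt_jet hL m.degree) (by rw [h0])
  exact congrFun (congrFun this T) ⟨m, mem_mons.2 le_rfl, hm⟩

theorem exists_jet_sol {N : ℕ} (A : (Idx gh N → 𝕜) →L[𝕜] (Idx gh N → 𝕜)) (v : Idx gh N → 𝕜) :
    ∃ x : ℝ → (Idx gh N → 𝕜), (∀ T, HasDerivAt x (-A (x T)) T) ∧ x 0 = v := by
  let B : (Idx gh N → 𝕜) →L[ℝ] (Idx gh N → 𝕜) := (-A).restrictScalars ℝ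
  refine ⟨fun t => NormedSpace.exp (t • B) v, fun T => ?_, by
    change NormedSpace.exp ((0 : ℝ) • B) v = v
    rw [show (0 : ℝ) • B = 0 from zero_smul ℝ B, NormedSpace.exp_zero]; rfl⟩
  have := (hasDerivAt_exp_smul_const' B T).clm_apply (hasDerivAt_const T v)
  simpa [B] using this

/-- The solution of `y' = -L y` with `y 0 = f`. -/
theorem exists_sol (hL : Filtered L) (f : FormalFun 𝕜 gh) :
    ∃ y : ℝ → FormalFun 𝕜 gh, IsSol L y ∧ y 0 = f := by
  choose x hx h0 using fun N => exists_jet_sol (jetOp L N) (jet 𝕜 gh N f)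
  -- Truncating the solution at level `N` to level `M` solves the equation at level `M`, because `L`
  -- respects the filtration. By uniqueness the truncated solutions are compatible.
  have hr : ∀ {M N : ℕ} (hMN : M ≤ N) (T) (m : Idx gh M), x M T m =
      x N T ⟨m.1, mem_mons.2 ((mem_mons.1 m.2.1).trans hMN), m.2.2⟩ := by
    intro M N hMN T m
    let r : (Idx gh N → 𝕜) →L[𝕜] (Idx gh M → 𝕜) :=
      LinearMap.toContinuousLinearMap ((jet 𝕜 gh M).comp (ofJet 𝕜 gh N))
    have hr : ∀ g, r (jet 𝕜 gh N g) = jet 𝕜 gh M g := fun g => by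
      change jet 𝕜 gh M (ofJet 𝕜 gh N (jet 𝕜 gh N g)) = _
      rw [jet_eq_iff]
      exact Fil_antitone (by omega) (jet_eq_iff.1 (jet_ofJet N _))
    have hr' : ∀ v : Idx gh N → 𝕜, ∃ g, jet 𝕜 gh N g = v := fun v => ⟨_, jet_ofJet N v⟩
    have := linear_ode_unique (jetOp L M) (hx M) (y := fun t => r (x N t)) (fun T => by
      have h1 := (r.restrictScalars ℝ).hasFDerivAt.comp_hasDerivAt T (hx N T)
      obtain ⟨g, hg⟩ := hr' (x N T)
      have h2 : -jetOp L M (r (x N T)) = (r.restrictScalars ℝ) (-jetOp L N (x N T)) := by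
        rw [← hg, hr, jetOp_jet hL, jetOp_jet hL, map_neg]
        exact congrArg _ (hr _).symm
      rw [h2]; exact h1) (by simp only [h0, hr])
    rw [this]
    obtain ⟨g, hg⟩ := hr' (x N T)
    simp only [← hg, hr]
    rfl
  -- Each coefficient is read off at the lowest truncation in which it appears.
  let y : ℝ → FormalFun 𝕜 gh := fun T =>
    FormalFun.mk gh fun m => coeff m (ofJet 𝕜 gh m.degree (x m.degree T))
  have hy : ∀ T (m : Fin n →₀ ℕ) (hm : Admissible gh m),
      coeff m (y T) = x m.degree T ⟨m, mem_mons.2 le_rfl, hm⟩ := fun T m hm =>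
    (coeff_mk _ hm).trans (congrFun (jet_ofJet m.degree _) ⟨m, mem_mons.2 le_rfl, hm⟩)
  refine ⟨y, fun T m => ?_, ?_⟩
  · by_cases hm : Admissible gh m
    · have hj : ∀ T, jet 𝕜 gh m.degree (y T) = x m.degree T := fun T => by
        funext l
        rw [jet_apply, hy T l.1 l.2.2]
        exact hr (mem_mons.1 l.2.1) T _
      have h1 := (hasDerivAt_pi.1 (hx m.degree T)) ⟨m, mem_mons.2 le_rfl, hm⟩
      rw [← hj T, jetOp_jet hL] at h1
      simp only [hy _ m hm]
      exact h1
    · simp only [coeff_of_not _ hm, neg_zero]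
      exact hasDerivAt_const _ _
  · refine ext' fun m hm => ?_
    rw [hy 0 m hm, h0, jet_apply]

theorem IsSol.add {y z : ℝ → FormalFun 𝕜 gh} (hy : IsSol L y) (hz : IsSol L z) :
    IsSol L (fun t => y t + z t) := fun T m => by
  simp only [coeff_add, map_add, neg_add]
  exact (hy T m).add (hz T m)

theorem IsSol.smul {y : ℝ → FormalFun 𝕜 gh} (hy : IsSol L y) (c : 𝕜) :
    IsSol L (fun t => c • y t) := fun T m => by
  simp only [coeff_smul, map_smul, ← mul_neg]
  exact (hy T m).const_mul c

theorem isSol_const {f : FormalFun 𝕜 gh} (hf : L f = 0) : IsSol L (fun _ => f) := fun T m => by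
  rw [hf, coeff_zero, neg_zero]; exact hasDerivAt_const _ _

theorem hasDerivAt_coeff_linearMap {R : FormalFun 𝕜 gh →ₗ[𝕜] FormalFun 𝕜 gh'} (hR : Filtered R)
    {y : ℝ → FormalFun 𝕜 gh} {y' : FormalFun 𝕜 gh} {T : ℝ}
    (hy : ∀ m, HasDerivAt (fun t => coeff m (y t)) (coeff m y') T) (l : Fin n' →₀ ℕ) :
    HasDerivAt (fun t => coeff l (R (y t))) (coeff l (R y')) T := by
  rw [show (fun t => coeff l (R (y t))) = fun t => ∑ m ∈ mons n (l.degree + 0),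
      coeff l (R (mono gh m)) * coeff m (y t) from funext fun t => coeff_linearMap (c := 0) hR _ le_rfl,
    coeff_linearMap (c := 0) hR _ le_rfl]
  exact HasDerivAt.fun_sum fun m _ => (hy m).const_mul _

theorem tendsto_coeff_linearMap {R : FormalFun 𝕜 gh →ₗ[𝕜] FormalFun 𝕜 gh'} (hR : Filtered R)
    {ι : Type*} {F : Filter ι} {y : ι → FormalFun 𝕜 gh} {z : FormalFun 𝕜 gh}
    (hy : ∀ m, Tendsto (fun t => coeff m (y t)) F (𝓝 (coeff m z))) (l : Fin n' →₀ ℕ) :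
    Tendsto (fun t => coeff l (R (y t))) F (𝓝 (coeff l (R z))) := by
  rw [show (fun t => coeff l (R (y t))) = fun t => ∑ m ∈ mons n (l.degree + 0),
      coeff l (R (mono gh m)) * coeff m (y t) from funext fun t => coeff_linearMap (c := 0) hR _ le_rfl,
    coeff_linearMap (c := 0) hR _ le_rfl]
  exact tendsto_finsetSum _ fun m _ => (hy m).const_mul _

theorem hasDerivAt_coeff_mul {y z : ℝ → FormalFun 𝕜 gh} {y' z' : FormalFun 𝕜 gh} {T : ℝ}
    (hy : ∀ m, HasDerivAt (fun t => coeff m (y t)) (coeff m y') T)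
    (hz : ∀ m, HasDerivAt (fun t => coeff m (z t)) (coeff m z') T) (l : Fin n →₀ ℕ) :
    HasDerivAt (fun t => coeff l (y t * z t)) (coeff l (y' * z T + y T * z')) T := by
  by_cases hl : Admissible gh l
  · simp only [coeff_add, coeff_mul hl, ← Finset.sum_add_distrib, ← mul_add]
    exact HasDerivAt.fun_sum fun p _ => ((hy p.1).mul (hz p.2)).const_mul _
  · simp only [coeff_of_not _ hl]
    exact hasDerivAt_const _ _

theorem tendsto_coeff_mul {ι : Type*} {F : Filter ι} {y z : ι → FormalFun 𝕜 gh}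
    {y' z' : FormalFun 𝕜 gh} (hy : ∀ m, Tendsto (fun t => coeff m (y t)) F (𝓝 (coeff m y')))
    (hz : ∀ m, Tendsto (fun t => coeff m (z t)) F (𝓝 (coeff m z'))) (l : Fin n →₀ ℕ) :
    Tendsto (fun t => coeff l (y t * z t)) F (𝓝 (coeff l (y' * z'))) := by
  by_cases hl : Admissible gh l
  · simp only [coeff_mul hl]
    exact tendsto_finsetSum _ fun p _ => ((hy p.1).mul (hz p.2)).const_mul _
  · simp only [coeff_of_not _ hl]
    exact tendsto_const_nhds

/-- For an even derivation the product rule in time matches the Leibniz rule of the generator. This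
makes the flow act by algebra homomorphisms. -/
theorem IsSol.mul (hL : IsDer 0 L) {y z : ℝ → FormalFun 𝕜 gh} (hy : IsSol L y) (hz : IsSol L z) :
    IsSol L (fun t => y t * z t) := fun T m => by
  have := hasDerivAt_coeff_mul (y' := -L (y T)) (z' := -L (z T)) (T := T)
    (fun m => by rw [coeff_neg]; exact hy T m) (fun m => by rw [coeff_neg]; exact hz T m) m
  rw [hL.leibniz, tw_zero, ← coeff_neg]
  convert this using 2
  simp [add_comm]

theorem IsSol.map (hR : Filtered R) {L' : Module.End 𝕜 (FormalFun 𝕜 gh')}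
    (hc : ∀ f, R (L f) = L' (R f)) {y : ℝ → FormalFun 𝕜 gh} (hy : IsSol L y) :
    IsSol L' (fun t => R (y t)) := fun T m => by
  have := hasDerivAt_coeff_linearMap hR (y' := -L (y T)) (T := T)
    (fun m => by rw [coeff_neg]; exact hy T m) m
  rwa [map_neg, coeff_neg, hc] at this

/-- The one-parameter group `exp (-T L)`. -/
def flowL (hL : Filtered L) (T : ℝ) : Module.End 𝕜 (FormalFun 𝕜 gh) where
  toFun f := (exists_sol hL f).choose T
  map_add' f g := congrFun ((exists_sol hL (f + g)).choose_spec.1.unique hL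
    ((exists_sol hL f).choose_spec.1.add (exists_sol hL g).choose_spec.1)
    (by simp only [(exists_sol hL _).choose_spec.2])) T
  map_smul' c f := congrFun ((exists_sol hL (c • f)).choose_spec.1.unique hL
    ((exists_sol hL f).choose_spec.1.smul c)
    (by simp only [(exists_sol hL _).choose_spec.2])) T

variable (hL : Filtered L)

theorem isSol_flowL (f : FormalFun 𝕜 gh) : IsSol L fun t => flowL hL t f :=
  (exists_sol hL f).choose_spec.1

theorem flowL_zero (f : FormalFun 𝕜 gh) : flowL hL 0 f = f := (exists_sol hL f).choose_spec.2

variable {hL}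

theorem IsSol.eq_flowL {y : ℝ → FormalFun 𝕜 gh} (hy : IsSol L y) (T : ℝ) :
    y T = flowL hL T (y 0) :=
  congrFun (hy.unique hL (isSol_flowL hL (y 0)) (flowL_zero hL _).symm) T

theorem flowL_of_eq_zero {f : FormalFun 𝕜 gh} (hf : L f = 0) (T : ℝ) : flowL hL T f = f :=
  ((isSol_const hf).eq_flowL T).symm

theorem flowL_mul (hd : IsDer 0 L) (T : ℝ) (f g : FormalFun 𝕜 gh) :
    flowL hL T (f * g) = flowL hL T f * flowL hL T g := by
  have := ((isSol_flowL hL f).mul hd (isSol_flowL hL g)).eq_flowL (hL := hL) T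
  simpa only [flowL_zero] using this.symm

/-- The image of a solution under an intertwiner solves the second equation, so uniqueness applies.
-/
theorem map_flowL {R : FormalFun 𝕜 gh →ₗ[𝕜] FormalFun 𝕜 gh'} (hR : Filtered R)
    {L' : Module.End 𝕜 (FormalFun 𝕜 gh')} (hL' : Filtered L') (hc : ∀ f, R (L f) = L' (R f)) (T : ℝ)
    (f : FormalFun 𝕜 gh) : R (flowL hL T f) = flowL hL' T (R f) := by
  have := ((isSol_flowL hL f).map hR hc).eq_flowL (hL := hL') T
  simpa only [flowL_zero] using this

/-- The truncation of the solution starts at zero and satisfies a linear equation, so it remains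
zero. -/
theorem flowL_mem_Fil {N : ℕ} {f : FormalFun 𝕜 gh} (hf : f ∈ Fil 𝕜 gh N) (T : ℝ) :
    flowL hL T f ∈ Fil 𝕜 gh N := by
  cases N with
  | zero => exact mem_Fil_zero _
  | succ N =>
    have := linear_ode_unique (jetOp L N) ((isSol_flowL hL f).hasDerivAt_jet hL N)
      (y := fun _ => 0) (fun T => by simpa using hasDerivAt_const T (0 : Idx gh N → 𝕜))
      (by rw [flowL_zero, jet_eq_zero hf])
    have h1 := jet_eq_iff (f := flowL hL T f) (g := 0).1 (by rw [map_zero]; exact congrFun this T)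
    rwa [sub_zero] at h1

open scoped Classical in
/-- The component of ghost number `k`. -/
def ghPart (𝕜 : Type*) [Field 𝕜] (gh : Fin n → ℤ) (k : ℤ) : Module.End 𝕜 (FormalFun 𝕜 gh) where
  toFun f := FormalFun.mk gh fun m => if gd gh m = k then coeff m f else 0
  map_add' f g := ext' fun m hm => by
    simp only [coeff_mk _ hm, coeff_add]; split_ifs <;> simp
  map_smul' c f := ext' fun m hm => by
    simp only [coeff_mk _ hm, coeff_smul, RingHom.id_apply]; split_ifs <;> simp

open scoped Classical in
theorem coeff_ghPart (k : ℤ) (f : FormalFun 𝕜 gh) (m : Fin n →₀ ℕ) :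
    coeff m (ghPart 𝕜 gh k f) = if gd gh m = k then coeff m f else 0 := by
  by_cases hm : Admissible gh m
  · exact coeff_mk (fun m => if gd gh m = k then coeff m f else 0) hm
  · simp [coeff_of_not _ hm]

theorem ghPart_filtered (k : ℤ) : Filtered (ghPart 𝕜 gh k) := fun N f hf m hm => by
  rw [coeff_ghPart, hf m hm, ite_self]

theorem ghPart_homogeneous {k l : ℤ} {f : FormalFun 𝕜 gh} (hf : IsHomogeneous l f) :
    ghPart 𝕜 gh k f = if l = k then f else 0 := by
  refine ext' fun m _ => ?_
  rw [coeff_ghPart]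
  by_cases h0 : coeff m f = 0
  · split_ifs <;> simp [h0, coeff_zero]
  · rw [isHomogeneous_iff.1 hf m h0]
    split_ifs <;> simp [coeff_zero]

theorem isHomogeneous_ghPart (k : ℤ) (f : FormalFun 𝕜 gh) : IsHomogeneous k (ghPart 𝕜 gh k f) := by
  rw [isHomogeneous_iff]
  intro m hm
  rw [coeff_ghPart] at hm
  exact (ite_ne_right_iff.1 hm).1

theorem ghPart_comm (hL : Filtered L) (hh : ∀ k f, IsHomogeneous k f → IsHomogeneous k (L f)) (k : ℤ)
    (f : FormalFun 𝕜 gh) : ghPart 𝕜 gh k (L f) = L (ghPart 𝕜 gh k f) := by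
  have := linearMap_eq_zero_of_mono (L := (ghPart 𝕜 gh k).comp L - L.comp (ghPart 𝕜 gh k)) 0
    (fun N f hf => Submodule.sub_mem _ (ghPart_filtered k _ _ (hL _ _ hf))
      (hL _ _ (ghPart_filtered k _ _ hf))) fun m => by
    have hm : IsHomogeneous (gd gh m) (mono gh m : FormalFun 𝕜 gh) := by
      rw [isHomogeneous_iff]
      intro l hl
      by_contra hne
      exact hl (coeff_mono_of_ne (𝕜 := 𝕜) (by rintro rfl; exact hne rfl))
    simp only [LinearMap.sub_apply, LinearMap.comp_apply, ghPart_homogeneous hm,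
      ghPart_homogeneous (hh _ _ hm)]
    split_ifs <;> simp
  exact sub_eq_zero.1 (LinearMap.congr_fun this f)

/-- The flow commutes with the projection to a fixed ghost number, because its generator does. -/
theorem flowL_homogeneous (hh : ∀ k f, IsHomogeneous k f → IsHomogeneous k (L f)) {k : ℤ}
    {f : FormalFun 𝕜 gh} (hf : IsHomogeneous k f) (T : ℝ) : IsHomogeneous k (flowL hL T f) := by
  have := map_flowL (hL := hL) (ghPart_filtered k) hL (ghPart_comm hL hh k) T f
  rw [ghPart_homogeneous hf, if_pos rfl] at this
  rw [← this]
  exact isHomogeneous_ghPart k _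

end Flow

/-! ### Differential equations for pullbacks by time-dependent formal maps. -/

section Pullback

variable {𝕜 : Type*} [RCLike 𝕜] {n n' : ℕ} {gh : Fin n → ℤ} {gh' : Fin n' → ℤ}
  {L : Module.End 𝕜 (FormalFun 𝕜 gh)}

/-- The equation `V' = -V L` has its generator on the right. By continuity of the operators it is
enough to follow one coefficient of the images of the finitely many monomials of degree at most
`|m|`. -/
theorem operator_ode_unique {V W : ℝ → FormalFun 𝕜 gh →ₗ[𝕜] FormalFun 𝕜 gh'}
    (hVf : ∀ t, Filtered (V t)) (hWf : ∀ t, Filtered (W t))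
    (hV : ∀ f T m, HasDerivAt (fun t => coeff m (V t f)) (-coeff m (V T (L f))) T)
    (hW : ∀ f T m, HasDerivAt (fun t => coeff m (W t f)) (-coeff m (W T (L f))) T)
    (h0 : V 0 = W 0) : V = W := by
  funext T
  refine LinearMap.ext fun f => ext' fun m _ => ?_
  let N := m.degree + 0
  -- For a fixed output coefficient the images of these monomials satisfy a closed linear system,
  -- whose matrix is the transpose of that of `L`.
  let A : ({l // l ∈ mons n N} → 𝕜) →L[𝕜] ({l // l ∈ mons n N} → 𝕜) :=
    LinearMap.toContinuousLinearMap
      (Matrix.mulVecLin (Matrix.of fun l l' => coeff l'.1 (L (mono gh l.1))))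
  have hA : ∀ r l, A r l = ∑ l', coeff l'.1 (L (mono gh l.1)) * r l' := fun r l => rfl
  have key : ∀ V : ℝ → FormalFun 𝕜 gh →ₗ[𝕜] FormalFun 𝕜 gh', (∀ t, Filtered (V t)) →
      (∀ f T m, HasDerivAt (fun t => coeff m (V t f)) (-coeff m (V T (L f))) T) → ∀ T,
      HasDerivAt (fun t (l : {l // l ∈ mons n N}) => coeff m (V t (mono gh l.1)))
        (-A fun l => coeff m (V T (mono gh l.1))) T := by
    intro V hVf hV T
    rw [hasDerivAt_pi]
    intro l
    refine (hV (mono gh l.1) T m).congr_deriv ?_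
    rw [Pi.neg_apply, hA, coeff_linearMap (c := 0) (hVf T) _ le_rfl, ← Finset.sum_coe_sort]
    exact congrArg _ (Finset.sum_congr rfl fun l' _ => mul_comm _ _)
  have := linear_ode_unique A (key V hVf hV) (key W hWf hW) (by rw [h0])
  rw [coeff_linearMap (c := 0) (hVf T) _ le_rfl, coeff_linearMap (c := 0) (hWf T) _ le_rfl]
  exact Finset.sum_congr rfl fun l hl => by rw [congrFun (congrFun this T) ⟨l, hl⟩]

/-- The chain rule for the pullback by the flow of a vector field. -/
theorem hasDerivAt_pullback (hd : IsDer 0 L) {Ψ : ℝ → FormalMap 𝕜 gh' gh} {T : ℝ}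
    (hΨ : ∀ i m, HasDerivAt (fun t => coeff m ((Ψ t).comp i)) (-coeff m ((Ψ T).pullback (L (X i)))) T)
    (f : FormalFun 𝕜 gh) (m : Fin n' →₀ ℕ) :
    HasDerivAt (fun t => coeff m ((Ψ t).pullback f)) (-coeff m ((Ψ T).pullback (L f))) T := by
  have hfil : ∀ t, Filtered (substL gh (Ψ t).comp) := fun t N f hf => subst_mem_Fil (Ψ t).isMap.fil hf
  have hmono : ∀ l : Fin n →₀ ℕ, ∀ m, HasDerivAt (fun t => coeff m ((Ψ t).pullback (mono gh l)))
      (coeff m (-(Ψ T).pullback (L (mono gh l)))) T := by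
    intro l
    refine mono_induction (P := fun f => ∀ m, HasDerivAt (fun t => coeff m ((Ψ t).pullback f))
      (coeff m (-(Ψ T).pullback (L f))) T) (fun m => ?_) (fun i f hf m => ?_) (fun c f hf m => ?_) l
    · rw [hd.map_one]
      simp only [FormalMap.pullback, subst_one (Ψ _).isMap]
      rw [show subst (Ψ T).comp (0 : FormalFun 𝕜 gh) = 0 from map_zero (substL gh (Ψ T).comp), neg_zero,
        coeff_zero]
      exact hasDerivAt_const _ _
    · simp only [FormalMap.pullback, subst_X_mul (Ψ _).isMap] at hf ⊢
      have := hasDerivAt_coeff_mul (fun m => by rw [coeff_neg]; exact hΨ i m) hf m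
      convert this using 2
      rw [hd.leibniz, tw_zero, subst_add, subst_mul (Ψ T).isMap, subst_X_mul (Ψ T).isMap]
      simp only [FormalMap.pullback, neg_mul, mul_neg]
      abel
    · have := (hf m).const_mul c
      simp only [FormalMap.pullback, ← substL_apply (ghT := gh), map_smul, coeff_smul, ← smul_neg] at this ⊢
      exact this
  have h1 : ∀ t, coeff m ((Ψ t).pullback f) =
      ∑ l ∈ mons n (m.degree + 0), coeff l f * coeff m ((Ψ t).pullback (mono gh l)) := fun t => by
    refine (coeff_linearMap (c := 0) (hfil t) f le_rfl).trans
      (Finset.sum_congr rfl fun l _ => mul_comm _ _)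
  have h2 : coeff m ((Ψ T).pullback (L f)) =
      ∑ l ∈ mons n (m.degree + 0), coeff l f * coeff m ((Ψ T).pullback (L (mono gh l))) :=
    (coeff_linearMap (L := (substL gh (Ψ T).comp).comp L) (c := 0)
      (fun N f hf => hfil T _ _ (hd.fil _ _ hf)) f le_rfl).trans
      (Finset.sum_congr rfl fun l _ => mul_comm _ _)
  simp only [h1, h2, ← Finset.sum_neg_distrib, ← mul_neg, ← coeff_neg]
  exact HasDerivAt.fun_sum fun l _ => (hmono l m).const_mul _

end Pullback

/-! ## Exponential decay -/

section Decay

variable {𝕜 : Type*} [RCLike 𝕜] {n : ℕ} {gh : Fin n → ℤ} {L : Module.End 𝕜 (FormalFun 𝕜 gh)}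

/-- Variation of constants: `exp((k+1)t) u` has derivative `-exp((k+1)t) h`, whose norm is at most
`C exp((k+1/2)t)`. The forced solution inherits the decay rate `1/2` since this is strictly less
than `k + 1`. -/
theorem exp_decay_of_ode {u h : ℝ → 𝕜} {k : ℕ} {C : ℝ}
    (hu : ∀ t, HasDerivAt u (-((k + 1 : 𝕜) * u t) - h t) t)
    (hh : ∀ t, 0 ≤ t → ‖h t‖ ≤ C * Real.exp (-(1 / 2) * t)) :
    ∃ C', ∀ t, 0 ≤ t → ‖u t‖ ≤ C' * Real.exp (-(1 / 2) * t) := by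
  -- The growth rate `k + 1/2` is at least `1/2`, so the factor `2` makes the derivative of the
  -- comparison function dominate.
  refine ⟨‖u 0‖ + 2 * C, fun t ht => ?_⟩
  have hC : 0 ≤ C := by
    have := (norm_nonneg _).trans (hh 0 le_rfl)
    simpa using this
  let a : ℝ := k + 1
  have hv : ∀ x, HasDerivAt (fun s : ℝ => Real.exp (a * s) • u s) (-(Real.exp (a * x) • h x)) x := by
    intro x
    have h1 : HasDerivAt (fun s : ℝ => Real.exp (a * s)) (Real.exp (a * x) * a) x := by
      simpa using ((hasDerivAt_id x).const_mul a).exp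
    have h2 := h1.smul (hu x)
    refine h2.congr_deriv ?_
    simp only [RCLike.real_smul_eq_coe_mul, a]
    push_cast
    ring
  have hB : ∀ x, HasDerivAt (fun s : ℝ => (‖u 0‖ + 2 * C) * Real.exp ((a - 1 / 2) * s))
      ((‖u 0‖ + 2 * C) * (Real.exp ((a - 1 / 2) * x) * (a - 1 / 2))) x := by
    intro x
    have h1 : HasDerivAt (fun s : ℝ => Real.exp ((a - 1 / 2) * s))
        (Real.exp ((a - 1 / 2) * x) * (a - 1 / 2)) x := by
      simpa using ((hasDerivAt_id x).const_mul (a - 1 / 2)).exp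
    exact h1.const_mul _
  have key := image_norm_le_of_norm_deriv_right_le_deriv_boundary (a := 0) (b := t)
    (f := fun s : ℝ => Real.exp (a * s) • u s) (f' := fun x => -(Real.exp (a * x) • h x))
    (fun x _ => (hv x).continuousAt.continuousWithinAt) (fun x _ => (hv x).hasDerivWithinAt)
    (B := fun s : ℝ => (‖u 0‖ + 2 * C) * Real.exp ((a - 1 / 2) * s))
    (B' := fun x => (‖u 0‖ + 2 * C) * (Real.exp ((a - 1 / 2) * x) * (a - 1 / 2)))
    (by simpa using hC) hB (fun x hx => by
      have h1 := hh x hx.1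
      have h2 : Real.exp (a * x) * Real.exp (-(1 / 2) * x) = Real.exp ((a - 1 / 2) * x) := by
        rw [← Real.exp_add]; ring_nf
      have h3 : (1 / 2 : ℝ) ≤ a - 1 / 2 := by simp only [a]; linarith [(Nat.cast_nonneg k : (0:ℝ) ≤ k)]
      rw [norm_neg, norm_smul, Real.norm_eq_abs, Real.abs_exp]
      calc Real.exp (a * x) * ‖h x‖ ≤ Real.exp (a * x) * (C * Real.exp (-(1 / 2) * x)) := by gcongr
        _ = (2 * C) * (Real.exp ((a - 1 / 2) * x) * (1 / 2)) := by rw [← h2]; ring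
        _ ≤ _ := by
          gcongr
          linarith [norm_nonneg (u 0)]) (Set.right_mem_Icc.2 ht)
  simp only [norm_smul, Real.norm_eq_abs, Real.abs_exp] at key
  have h2 : Real.exp ((a - 1 / 2) * t) = Real.exp (a * t) * Real.exp (-(1 / 2) * t) := by
    rw [← Real.exp_add]; ring_nf
  rw [h2, mul_left_comm] at key
  exact le_of_mul_le_mul_left key (Real.exp_pos _)

/-- The result of applying `L - (k + 1)` successively for the elements `k` of a list. -/
def shifts (L : Module.End 𝕜 (FormalFun 𝕜 gh)) (ls : List ℕ) (f : FormalFun 𝕜 gh) : FormalFun 𝕜 gh :=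
  ls.foldl (fun g (k : ℕ) => L g - (k + 1 : 𝕜) • g) f

/-- A coefficient `u` of the flow of `f` satisfies `u' = -(k+1) u - h`, where `h` is that of `(L -
(k+1)) f`. Decay of `h` implies decay of `u`, so one factor is removed at a time, until the
filtration kills the coefficient. -/
theorem flowL_decay {hL : Filtered L} {N : ℕ} (ls : List ℕ) {f : FormalFun 𝕜 gh}
    (hf : shifts L ls f ∈ Fil 𝕜 gh N) {m : Fin n →₀ ℕ} (hm : m.degree < N) :
    ∃ C, ∀ T, 0 ≤ T → ‖coeff m (flowL hL T f)‖ ≤ C * Real.exp (-(1 / 2) * T) := by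
  induction ls generalizing f with
  | nil => exact ⟨0, fun T _ => by rw [flowL_mem_Fil (f := f) hf T m hm]; simp⟩
  | cons k ls ih =>
    obtain ⟨C, hC⟩ := ih hf
    refine exp_decay_of_ode (k := k) (fun t => ?_) hC
    refine (isSol_flowL hL f t m).congr_deriv ?_
    rw [map_sub, map_smul, coeff_sub, coeff_smul, map_flowL hL hL (fun _ => rfl)]
    ring

theorem shifts_mem_Fil (hL : Filtered L) {N : ℕ} (ls : List ℕ) {f : FormalFun 𝕜 gh}
    (hf : f ∈ Fil 𝕜 gh N) : shifts L ls f ∈ Fil 𝕜 gh N := by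
  induction ls generalizing f with
  | nil => exact hf
  | cons k ls ih => exact ih (Submodule.sub_mem _ (hL _ _ hf) (Submodule.smul_mem _ _ hf))

/-- On elements of filtration `N`, the degree `N` part of the result depends only on the leading
part of the operator. This replaces `H` by `E`. -/
theorem shifts_sub_mem (hL : Filtered L) {L' : Module.End 𝕜 (FormalFun 𝕜 gh)} (hL' : Filtered L') {N : ℕ}
    (hLL : ∀ f, f ∈ Fil 𝕜 gh N → L f - L' f ∈ Fil 𝕜 gh (N + 1)) (ls : List ℕ) {f g : FormalFun 𝕜 gh}
    (hf : f ∈ Fil 𝕜 gh N) (hfg : f - g ∈ Fil 𝕜 gh (N + 1)) :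
    shifts L ls f - shifts L' ls g ∈ Fil 𝕜 gh (N + 1) := by
  induction ls generalizing f g with
  | nil => exact hfg
  | cons k ls ih =>
    refine ih (Submodule.sub_mem _ (hL _ _ hf) (Submodule.smul_mem _ _ hf)) ?_
    have : L f - (k + 1 : 𝕜) • f - (L' g - (k + 1 : 𝕜) • g) =
        (L f - L' f) + L' (f - g) - (k + 1 : 𝕜) • (f - g) := by
      rw [map_sub, smul_sub]; abel
    rw [this]
    exact Submodule.sub_mem _ (Submodule.add_mem _ (hLL f hf) (hL' _ _ hfg)) (Submodule.smul_mem _ _ hfg)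

-- Identifies the successive shifts with a multiple of the spectral projection product used for the
-- Green operator.
open Polynomial in
theorem shifts_range (N : ℕ) (f : FormalFun 𝕜 gh) :
    shifts L (List.range N) f = (∏ k ∈ Finset.range N, (-(k + 1) : 𝕜)) •
      aeval L (∏ k ∈ Finset.range N, (1 - C (((k : 𝕜) + 1)⁻¹) * Polynomial.X)) f := by
  induction N with
  | zero => simp [shifts]
  | succ N ih =>
    have e : aeval L (∏ k ∈ Finset.range (N + 1), (1 - C (((k : 𝕜) + 1)⁻¹) * Polynomial.X)) =
        aeval L (1 - C (((N : 𝕜) + 1)⁻¹) * Polynomial.X) *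
          aeval L (∏ k ∈ Finset.range N, (1 - C (((k : 𝕜) + 1)⁻¹) * Polynomial.X)) := by
      rw [Finset.prod_range_succ, mul_comm, map_mul]
    rw [e, shifts, List.range_succ, List.foldl_append, ← shifts.eq_def L (List.range N) f, ih, List.foldl_cons, List.foldl_nil,
      Finset.prod_range_succ, Module.End.mul_apply,
      map_smul]
    have : (N + 1 : 𝕜) ≠ 0 := Nat.cast_add_one_ne_zero N
    simp only [map_sub, map_one, map_mul, aeval_X, aeval_C, LinearMap.sub_apply, Module.End.mul_apply,
      Module.End.one_apply, Module.algebraMap_end_apply, smul_sub, smul_smul, mul_assoc]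
    rw [neg_mul, mul_inv_cancel₀ this]
    module

end Decay

namespace FreeBVRetract

variable {𝕜 : Type*} [RCLike 𝕜] {n n' : ℕ} (D : FreeBVRetract 𝕜 n n') {Sint : FormalFun 𝕜 D.gh}
  (h : D.IsInteraction Sint)

/-! ## The flow of `-H` -/

include h

theorem HL_filtered : Filtered (D.HL Sint) := (D.HL_isDer h).fil

/-- The pullback by the flow of `-H`. -/
def flowPullback (T : ℝ) : Module.End 𝕜 (FormalFun 𝕜 D.gh) := flowL (D.HL_filtered h) T

theorem flowPullback_fil {N : ℕ} {f : FormalFun 𝕜 D.gh} (hf : f ∈ Fil 𝕜 D.gh N) (T : ℝ) :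
    D.flowPullback h T f ∈ Fil 𝕜 D.gh N := flowL_mem_Fil hf T

theorem flowPullback_mul (T : ℝ) (f g : FormalFun 𝕜 D.gh) :
    D.flowPullback h T (f * g) = D.flowPullback h T f * D.flowPullback h T g :=
  flowL_mul (D.HL_isDer h) T f g

theorem flowPullback_homogeneous {k : ℤ} {f : FormalFun 𝕜 D.gh} (hf : IsHomogeneous k f) (T : ℝ) :
    IsHomogeneous k (D.flowPullback h T f) :=
  flowL_homogeneous (fun _ _ => D.HL_homogeneous h) hf T

theorem flowPullback_one (T : ℝ) : D.flowPullback h T 1 = 1 := flowL_of_eq_zero (D.HL_isDer h).map_one T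

theorem flowPullback_κL (T : ℝ) (f : FormalFun 𝕜 D.gh) :
    D.κL (D.flowPullback h T f) = D.flowPullback h T (D.κL f) :=
  map_flowL (D.κL_isDer).fil _ (fun f => (D.HL_κL f).symm) T f

theorem flowPullback_HL (T : ℝ) (f : FormalFun 𝕜 D.gh) :
    D.HL Sint (D.flowPullback h T f) = D.flowPullback h T (D.HL Sint f) :=
  map_flowL (D.HL_filtered h) _ (fun _ => rfl) T f

/-- The flow of `-H`. -/
def flow (T : ℝ) : FormalMap 𝕜 D.gh D.gh where
  comp i := D.flowPullback h T (X i)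
  homogeneous i := D.flowPullback_homogeneous h (isHomogeneous_X i) T
  constantCoeff i := mem_Fil_one.1 (D.flowPullback_fil h (X_mem_Fil i) T)

theorem pullback_flow (T : ℝ) (f : FormalFun 𝕜 D.gh) :
    (D.flow h T).pullback f = D.flowPullback h T f :=
  (LinearMap.congr_fun (eq_subst_of_mul (D.flow h T).isMap (fun _ _ hf => D.flowPullback_fil h hf T)
    (D.flowPullback_one h T) fun i f => D.flowPullback_mul h T (X i) f) f).symm

theorem isFlow_flow : D.IsFlow Sint (D.flow h) := by
  refine ⟨fun i => flowL_zero _ _, fun T i m => ?_⟩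
  rw [D.H_eq h, pullback_flow, ← flowPullback_HL]
  exact isSol_flowL (D.HL_filtered h) (X i) T m

/-- The equation for the components of a flow is nonlinear, but the chain rule extends it to a
linear equation for the pullback on all functions, whose solution is unique. -/
theorem isFlow_unique {Ψ : ℝ → FormalMap 𝕜 D.gh D.gh} (hΨ : D.IsFlow Sint Ψ) : Ψ = D.flow h := by
  have key : ∀ {Ψ : ℝ → FormalMap 𝕜 D.gh D.gh}, D.IsFlow Sint Ψ → ∀ f T m,
      HasDerivAt (fun t => coeff m (substL D.gh (Ψ t).comp f))
        (-coeff m (substL D.gh (Ψ T).comp (D.HL Sint f))) T := fun {Ψ} hΨ f T m =>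
    hasDerivAt_pullback (D.HL_isDer h) (fun i m => by rw [← D.H_eq h]; exact hΨ.2 T i m) f m
  have h1 := operator_ode_unique (V := fun t => substL D.gh (Ψ t).comp)
    (W := fun t => substL D.gh (D.flow h t).comp) (fun t N f hf => subst_mem_Fil (Ψ t).isMap.fil hf)
    (fun t N f hf => subst_mem_Fil (D.flow h t).isMap.fil hf) (key hΨ) (key (D.isFlow_flow h))
    (by rw [show (Ψ 0).comp = (D.flow h 0).comp from
      funext fun i => (hΨ.1 i).trans ((D.isFlow_flow h).1 i).symm])
  funext T
  ext1
  funext i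
  have := LinearMap.congr_fun (congrFun h1 T) (X i)
  simpa only [substL_apply, subst_X (FormalMap.isMap _)] using this

/-! ## Convergence of the flow -/

variable (hsq : ∀ f, D.QL Sint (D.QL Sint f) = 0)

-- The difference is `p A K`, and `A` raises the polynomial degree.
omit hsq in
theorem pIntL_sub_pL_mem {N : ℕ} {f : FormalFun 𝕜 D.gh} (hf : f ∈ Fil 𝕜 D.gh N) :
    D.pL f - D.pIntL Sint f ∈ Fil 𝕜 D.gh' (N + 1) := by
  rw [pIntL_apply, map_sub, sub_sub_cancel]
  exact D.pL_graded.fil _ _ (D.AL_fil h (D.KL_graded.fil _ _ hf))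

include hsq

theorem pIntL_shifts (ls : List ℕ) {f : FormalFun 𝕜 D.gh} (hf : D.pIntL Sint f = 0) :
    D.pIntL Sint (shifts (D.HL Sint) ls f) = 0 := by
  induction ls generalizing f with
  | nil => exact hf
  | cons k ls ih =>
    refine ih (f := D.HL Sint f - (k + 1 : 𝕜) • f) ?_
    rw [map_sub, map_smul, hf, D.pIntL_HL h hsq, smul_zero, sub_zero]

/-- Degree by degree, products of shifts `H - (k+1)` annihilate the kernel of `p_int`. If the
element starts in degree `N`, its degree `N` part is killed by `p` to leading order, hence has no
component of ultraviolet degree zero. The shifts by `1, ..., N` then remove all the eigenvalues of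
`E` that remain there. -/
theorem exists_shifts {f : FormalFun 𝕜 D.gh} (hf : D.pIntL Sint f = 0) (N : ℕ) :
    ∃ ls, shifts (D.HL Sint) ls f ∈ Fil 𝕜 D.gh N := by
  induction N with
  | zero => exact ⟨[], mem_Fil_zero _⟩
  | succ N ih =>
    obtain ⟨ls, hls⟩ := ih
    refine ⟨ls ++ List.range N, ?_⟩
    set g := shifts (D.HL Sint) ls f with hg
    have e : shifts (D.HL Sint) (ls ++ List.range N) f = shifts (D.HL Sint) (List.range N) g :=
      List.foldl_append
    -- The shifted element is still in the kernel of `p_int`, because `p_int H = 0`, and `p` agrees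
    -- with `p_int` up to higher degree.
    have hp : D.pL g ∈ Fil 𝕜 D.gh' (N + 1) := by
      have := D.pIntL_sub_pL_mem h hls
      rwa [D.pIntL_shifts h hsq ls hf, sub_zero] at this
    have h1 := shifts_sub_mem (D.HL_filtered h) D.EL_graded.fil (fun f => D.HL_sub_EL_mem h)
      (List.range N) hls (g := g) (by rw [sub_self]; exact Submodule.zero_mem _)
    rw [e, ← sub_add_cancel (shifts (D.HL Sint) _ g) (shifts D.EL (List.range N) g)]
    refine Submodule.add_mem _ h1 fun m hm => ?_
    -- Below degree `N` there is nothing. In degree `N` the product of shifts of `E` is a multiple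
    -- of `i p`, and `p g` vanishes to that order.
    rcases Nat.lt_succ_iff_lt_or_eq.1 hm with hm | rfl
    · exact shifts_mem_Fil D.EL_graded.fil _ hls m hm
    · rw [shifts_range, coeff_smul, D.coeff_aeval_prod, D.iL_graded.fil _ _ hp m hm, mul_zero]

theorem flow_decay {f : FormalFun 𝕜 D.gh} (hf : D.pIntL Sint f = 0) (m : Fin n →₀ ℕ) :
    ∃ C, ∀ T, 0 ≤ T → ‖coeff m (D.flowPullback h T f)‖ ≤ C * Real.exp (-(1 / 2) * T) := by
  obtain ⟨ls, hls⟩ := D.exists_shifts h hsq hf (m.degree + 1)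
  exact flowL_decay ls hls (Nat.lt_succ_self _)

theorem tendsto_flow_zero {f : FormalFun 𝕜 D.gh} (hf : D.pIntL Sint f = 0) (m : Fin n →₀ ℕ) :
    Tendsto (fun T => coeff m (D.flowPullback h T f)) atTop (𝓝 0) := by
  obtain ⟨C, hC⟩ := D.flow_decay h hsq hf m
  refine squeeze_zero_norm' (eventually_atTop.2 ⟨0, hC⟩) ?_
  have : Tendsto (fun T : ℝ => Real.exp (-(1 / 2) * T)) atTop (𝓝 0) :=
    Real.tendsto_exp_atBot.comp (tendsto_id.const_mul_atTop_of_neg (by norm_num))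
  simpa using this.const_mul C

/-- The element splits into a part in the kernel of `p_int`, which decays, and a part in the image
of `i_int`, which is stationary because `H i_int = 0`. -/
theorem tendsto_flow (f : FormalFun 𝕜 D.gh) (m : Fin n →₀ ℕ) :
    Tendsto (fun T => coeff m (D.flowPullback h T f)) atTop
      (𝓝 (coeff m (D.iIntL Sint (D.pIntL Sint f)))) := by
  have h1 : ∀ T, D.flowPullback h T f = D.flowPullback h T (f - D.iIntL Sint (D.pIntL Sint f)) +
      D.iIntL Sint (D.pIntL Sint f) := fun T => by
    have : D.flowPullback h T (D.iIntL Sint (D.pIntL Sint f)) = D.iIntL Sint (D.pIntL Sint f) :=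
      flowL_of_eq_zero (D.HL_iIntL h hsq _) T
    rw [map_sub, this, sub_add_cancel]
  simp only [h1, coeff_add]
  have := (D.tendsto_flow_zero h hsq (f := f - D.iIntL Sint (D.pIntL Sint f))
    (by rw [map_sub, D.pIntL_iIntL h hsq, sub_self]) m).add_const
      (coeff m (D.iIntL Sint (D.pIntL Sint f)))
  rwa [zero_add] at this

/-- The flow commutes with `κhat`, and `κhat f` lies in the kernel of `p_int`, where the decay is
exponential. -/
theorem integrableOn_flow (f : FormalFun 𝕜 D.gh) (m : Fin n →₀ ℕ) :
    MeasureTheory.IntegrableOn (fun T => coeff m (D.κL (D.flowPullback h T f))) (Set.Ioi 0) := by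
  simp only [flowPullback_κL]
  obtain ⟨C, hC⟩ := D.flow_decay h hsq (D.pIntL_κL f) m
  refine ((exp_neg_integrableOn_Ioi 0 (b := 1 / 2) (by norm_num)).const_mul C).mono' ?_ ?_
  · exact (continuous_iff_continuousAt.2 fun T =>
      (isSol_flowL (D.HL_filtered h) (D.κL f) T m).continuousAt).aestronglyMeasurable
  · filter_upwards [MeasureTheory.ae_restrict_mem measurableSet_Ioi] with T hT
    exact hC T (le_of_lt hT)

/-- By `K_int H = κhat` the integrand is minus the time derivative of `K_int` applied to the flow.
The value at infinity is `K_int i_int p_int f = 0`. -/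
theorem integral_flow (f : FormalFun 𝕜 D.gh) (m : Fin n →₀ ℕ) :
    coeff m (D.KIntL Sint f) =
      ∫ T in Set.Ioi (0 : ℝ), coeff m (D.κL (D.flowPullback h T f)) := by
  have hd : ∀ T, HasDerivAt (fun t => -coeff m (D.KIntL Sint (D.flowPullback h t f)))
      (coeff m (D.κL (D.flowPullback h T f))) T := fun T => by
    have := hasDerivAt_coeff_linearMap (fun N f => D.KIntL_fil h) (T := T)
      (y := fun t => D.flowPullback h t f) (y' := -D.HL Sint (D.flowPullback h T f))
      (fun m => by rw [coeff_neg]; exact isSol_flowL (D.HL_filtered h) f T m) m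
    rw [map_neg, D.KIntL_HL h hsq, coeff_neg] at this
    exact this.neg.congr_deriv (neg_neg _)
  have hl := (tendsto_coeff_linearMap (fun N f => D.KIntL_fil h) (D.tendsto_flow h hsq f) m).neg
  rw [D.KIntL_iIntL h hsq, coeff_zero, neg_zero] at hl
  rw [MeasureTheory.integral_Ioi_of_hasDerivAt_of_tendsto (hd 0).continuousAt.continuousWithinAt
    (fun T _ => hd T) (D.integrableOn_flow h hsq f m) hl, zero_sub, neg_neg]
  congr 2
  exact (flowL_zero (D.HL_filtered h) f).symm

end FreeBVRetract

/-! ### Sign twists and derivations under degree-preserving maps. -/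

section General

variable {𝕜 : Type*} [Field 𝕜] [CharZero 𝕜] {n k : ℕ} {gh : Fin n → ℤ} {ghT : Fin k → ℤ}

omit [CharZero 𝕜] in
theorem map_tw {R : FormalFun 𝕜 ghT →ₗ[𝕜] FormalFun 𝕜 gh}
    (hR : ∀ N f, f ∈ Fil 𝕜 ghT N → R f ∈ Fil 𝕜 gh N)
    (hh : ∀ k f, IsHomogeneous k f → IsHomogeneous k (R f)) (e : ℤ) (f : FormalFun 𝕜 ghT) :
    R (tw ghT e f) = tw gh e (R f) := by
  have := linearMap_eq_zero_of_mono (L := R.comp (tw ghT e) - (tw gh e).comp R) 0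
    (fun N f hf => Submodule.sub_mem _ (hR _ _ (tw_mem_Fil hf)) (tw_mem_Fil (hR _ _ hf)))
    fun m => by
      have hm : IsHomogeneous (gd ghT m) (mono ghT m : FormalFun 𝕜 ghT) := by
        rw [isHomogeneous_iff]
        intro l hl
        by_contra hne
        exact hl (coeff_mono_of_ne (𝕜 := 𝕜) (by rintro rfl; exact hne rfl))
      simp only [LinearMap.sub_apply, LinearMap.comp_apply, tw_homogeneous hm,
        tw_homogeneous (hh _ _ hm), map_smul, sub_self]
  exact sub_eq_zero.1 (LinearMap.congr_fun this f)

/-- A pullback kills the image of a derivation if it does so on coordinates. -/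
theorem subst_isDer_eq_zero {g : Fin k → FormalFun 𝕜 gh} (hg : IsMap ghT g) {e : ℤ}
    {L : FormalFun 𝕜 ghT →ₗ[𝕜] FormalFun 𝕜 ghT} (hL : IsDer e L)
    (hX : ∀ i, subst g (L (X i)) = 0) (f : FormalFun 𝕜 ghT) : subst g (L f) = 0 := by
  have := linearMap_eq_zero (L := (substL ghT g).comp L) 0
    (fun N f hf => subst_mem_Fil hg.fil (hL.fil _ _ hf))
    (by rw [LinearMap.comp_apply, hL.map_one, map_zero]) fun i f hf => by
      rw [LinearMap.comp_apply, substL_apply] at hf ⊢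
      rw [hL.leibniz, subst_add, subst_mul hg, subst_mul hg, hX, hf, zero_mul, mul_zero, add_zero]
  exact LinearMap.congr_fun this f

end General

namespace FreeBVRetract

variable {𝕜 : Type*} [RCLike 𝕜] {n n' : ℕ} (D : FreeBVRetract 𝕜 n n') {Sint : FormalFun 𝕜 D.gh}
  (h : D.IsInteraction Sint) (hsq : ∀ f, D.QL Sint (D.QL Sint f) = 0)

include h hsq

/-! ## The maps `p_int` and `i_int` as pullbacks -/

theorem tendsto_pL_flow (f : FormalFun 𝕜 D.gh) (m : Fin n' →₀ ℕ) :
    Tendsto (fun T => coeff m (D.pL (D.flowPullback h T f))) atTop (𝓝 (coeff m (D.pIntL Sint f))) := by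
  have := tendsto_coeff_linearMap D.pL_graded.fil (D.tendsto_flow h hsq f) m
  rwa [pL_iIntL] at this

/-- A coefficientwise limit of the algebra homomorphisms `p Φ_T^*` is an algebra homomorphism. -/
theorem pIntL_mul (f g : FormalFun 𝕜 D.gh) :
    D.pIntL Sint (f * g) = D.pIntL Sint f * D.pIntL Sint g := by
  refine ext' fun m _ => tendsto_nhds_unique (D.tendsto_pL_flow h hsq (f * g) m) ?_
  simp only [flowPullback_mul, pL_mul]
  exact tendsto_coeff_mul (D.tendsto_pL_flow h hsq f) (D.tendsto_pL_flow h hsq g) m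

omit h hsq in
theorem pIntL_one : D.pIntL Sint 1 = 1 := by
  rw [← iL_one, pIntL_iL]

theorem tendsto_flow_iL (f : FormalFun 𝕜 D.gh') (m : Fin n →₀ ℕ) :
    Tendsto (fun T => coeff m (D.flowPullback h T (D.iL f))) atTop (𝓝 (coeff m (D.iIntL Sint f))) := by
  have := D.tendsto_flow h hsq (D.iL f) m
  rwa [pIntL_iL] at this

theorem iIntL_mul (f g : FormalFun 𝕜 D.gh') :
    D.iIntL Sint (f * g) = D.iIntL Sint f * D.iIntL Sint g := by
  refine ext' fun m _ => tendsto_nhds_unique (D.tendsto_flow_iL h hsq (f * g) m) ?_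
  simp only [flowPullback_mul, iL_mul]
  exact tendsto_coeff_mul (D.tendsto_flow_iL h hsq f) (D.tendsto_flow_iL h hsq g) m

theorem iIntL_one : D.iIntL Sint 1 = 1 := by
  refine ext' fun m _ => tendsto_nhds_unique (D.tendsto_flow_iL h hsq 1 m) ?_
  simp only [iL_one, flowPullback_one]
  exact tendsto_const_nhds

omit hsq in
/-- The formal map with pullback `p_int`. -/
def ιInt : FormalMap 𝕜 D.gh' D.gh where
  comp i := D.pIntL Sint (X i)
  homogeneous i := D.pIntL_homogeneous h (isHomogeneous_X i)
  constantCoeff i := mem_Fil_one.1 (D.pIntL_fil h (X_mem_Fil i))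

omit hsq in
/-- The formal map with pullback `i_int`. -/
def πInt : FormalMap 𝕜 D.gh D.gh' where
  comp a := D.iIntL Sint (X a)
  homogeneous a := D.iIntL_homogeneous h (isHomogeneous_X a)
  constantCoeff a := mem_Fil_one.1 (D.iIntL_fil h (X_mem_Fil a))

theorem ιInt_pullback (f : FormalFun 𝕜 D.gh) : (D.ιInt h).pullback f = D.pIntL Sint f :=
  (LinearMap.congr_fun (eq_subst_of_mul (D.ιInt h).isMap (fun _ _ => D.pIntL_fil h) D.pIntL_one
    fun i f => D.pIntL_mul h hsq (X i) f) f).symm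

theorem πInt_pullback (f : FormalFun 𝕜 D.gh') : (D.πInt h).pullback f = D.iIntL Sint f :=
  (LinearMap.congr_fun (eq_subst_of_mul (D.πInt h).isMap (fun _ _ => D.iIntL_fil h) (D.iIntL_one h hsq)
    fun i f => D.iIntL_mul h hsq (X i) f) f).symm

theorem isDGAlgHom_pInt : IsDGAlgHom (D.Q Sint) (D.QInt' Sint) (D.pInt Sint) := by
  rw [show D.Q Sint = ⇑(D.QL Sint) from funext (D.Q_eq h),
    show D.QInt' Sint = ⇑(D.QIntL' Sint) from funext (D.QInt'_eq h),
    show D.pInt Sint = ⇑(D.pIntL Sint) from funext (D.pInt_eq h)]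
  exact ⟨(D.pIntL Sint).isLinear, D.pIntL_one, D.pIntL_mul h hsq, fun _ _ => D.pIntL_homogeneous h,
    D.pIntL_QL h hsq⟩

theorem isDGAlgHom_iInt : IsDGAlgHom (D.QInt' Sint) (D.Q Sint) (D.iInt Sint) := by
  rw [show D.Q Sint = ⇑(D.QL Sint) from funext (D.Q_eq h),
    show D.QInt' Sint = ⇑(D.QIntL' Sint) from funext (D.QInt'_eq h),
    show D.iInt Sint = ⇑(D.iIntL Sint) from funext (D.iInt_eq h)]
  exact ⟨(D.iIntL Sint).isLinear, D.iIntL_one h hsq, D.iIntL_mul h hsq,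
    fun _ _ => D.iIntL_homogeneous h, fun f => (D.QL_iIntL h hsq f).symm⟩

theorem QIntL'_eq (f : FormalFun 𝕜 D.gh') : D.QIntL' Sint f = D.pIntL Sint (D.QL Sint (D.iL f)) := by
  rw [D.pIntL_QL h hsq, pIntL_iL]

/-- In `p_int Q i` the outer maps are algebra homomorphisms with `p_int i = 1`, so the Leibniz rule
of `Q` descends. -/
theorem QIntL'_isDer : IsDer 1 (D.QIntL' Sint) where
  leibniz f g := by
    rw [D.QIntL'_eq h hsq, iL_mul, (D.QL_isDer h).leibniz, map_add, D.pIntL_mul h hsq,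
      D.pIntL_mul h hsq, D.QIntL'_eq h hsq, D.QIntL'_eq h hsq, pIntL_iL,
      map_tw (fun _ _ => D.pIntL_fil h) (fun _ _ => D.pIntL_homogeneous h), pIntL_iL]
  fil N f := D.QIntL'_fil h hsq

theorem isDGCommAlgebra' : IsDGCommAlgebra (D.QInt' Sint) := by
  rw [show D.QInt' Sint = ⇑(D.QIntL' Sint) from funext (D.QInt'_eq h)]
  refine ⟨(D.QIntL' Sint).isLinear, fun _ _ => D.QIntL'_homogeneous h hsq, D.QIntL'_QIntL' h hsq,
    fun k f g hf => ?_, fun k l f g hf hg => ?_⟩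
  · rw [(D.QIntL'_isDer h hsq).leibniz, tw_homogeneous hf, smul_mul_assoc, one_mul]; rfl
  · rw [mul_comm_tw hf, tw_homogeneous hg, smul_mul_assoc]; rfl

/-! ## Critical points in the directions of the gauge-fixing Lagrangian -/

-- Lowering an index with `ω` expresses `∂S` through the functions `Q xᵏ`, and compatibility with
-- `ω` moves `κ` onto the coordinate. The degrees force `gh k = -2 - gh j`, so the sign depends only
-- on `gh j`.
omit h hsq in
theorem sum_κ_dL (j : Fin n) : ∑ i, D.κ i j • dL i (D.S Sint) =
    -(sg 𝕜 (D.gh j) • ∑ l, D.ω j l • D.QL Sint (D.κL (X l))) := by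
  have h1 : ∀ i, dL i (D.S Sint) = ∑ k, D.ω i k • D.QL Sint (X k) := fun i => by
    simp only [QL, vfL_X]
    exact (sum_hamComp_mul_of_symm D.ω_symm D.ω_nondeg _ i).symm
  have h2 : ∀ k, (D.ω * D.κ) k j = -(sg 𝕜 (D.gh j) * (D.ω * D.κ) j k) := fun k => by
    rw [D.κ_compat j k]
    congr 1
    by_cases h0 : (D.ω * D.κ) j k = 0
    · simp [h0]
    · rw [Matrix.mul_apply] at h0
      obtain ⟨l, _, hl⟩ := Finset.exists_ne_zero_of_sum_ne_zero h0
      have e1 := D.ω_deg _ _ (left_ne_zero_of_mul hl)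
      have e2 := D.κ_deg _ _ (right_ne_zero_of_mul hl)
      congr 1
      refine sg_congr 𝕜 ?_
      rw [show D.gh k = -2 - D.gh j by omega]
      obtain ⟨r, hr⟩ := Int.even_mul_succ_self (D.gh j)
      exact ⟨-r - D.gh j, by linear_combination -hr⟩
  have h3 : ∑ i, D.κ i j • dL i (D.S Sint) = ∑ k, (D.ω * D.κ) k j • D.QL Sint (X k) := by
    simp only [h1, Finset.smul_sum, smul_smul, Matrix.mul_apply, Finset.sum_smul]
    rw [Finset.sum_comm]
    refine Finset.sum_congr rfl fun k _ => Finset.sum_congr rfl fun i _ => ?_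
    rw [mul_comm, D.ω_symm.apply]
  rw [h3]
  simp only [h2, κL_X, linForm, map_sum, map_smul, Finset.smul_sum, smul_smul, Matrix.mul_apply,
    neg_smul, Finset.sum_neg_distrib, Finset.mul_sum, Finset.sum_smul]
  rw [Finset.sum_comm]

-- Invertibility of `ω` turns criticality along the Lagrangian into the vanishing of the pullbacks
-- of `Q κhat xᵃ`, a condition adapted to the operators `H` and `p_int`.
omit h hsq in
theorem isCriticalAlongL_iff {k : ℕ} {ghY : Fin k → ℤ} (g : Fin n → FormalFun 𝕜 ghY) :
    D.IsCriticalAlongL Sint g ↔ ∀ a, subst g (D.QL Sint (D.κL (X a))) = 0 := by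
  have e : ∀ j, ∑ i, D.κ i j • subst g (dL i (D.S Sint)) =
      -(sg 𝕜 (D.gh j) • ∑ l, D.ω j l • subst g (D.QL Sint (D.κL (X l)))) := fun j => by
    have := congrArg (substL D.gh g) (D.sum_κ_dL (Sint := Sint) j)
    simpa only [map_sum, map_smul, map_neg, substL_apply] using this
  simp only [IsCriticalAlongL, e, neg_eq_zero, smul_eq_zero, sg_ne_zero, false_or]
  refine ⟨fun h a => ?_, fun h j => by simp [h]⟩
  have h1 : ∑ j, D.ω⁻¹ a j • ∑ l, D.ω j l • subst g (D.QL Sint (D.κL (X l))) =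
      ∑ l, (D.ω⁻¹ * D.ω) a l • subst g (D.QL Sint (D.κL (X l))) := by
    simp only [Finset.smul_sum, smul_smul, Matrix.mul_apply, Finset.sum_smul]
    rw [Finset.sum_comm]
  rw [Matrix.nonsing_inv_mul _ D.ω_nondeg] at h1
  simpa [h, Matrix.one_apply] using h1.symm

/-- As `p_int` is a chain map with `p_int κhat = 0`, it kills `Q κhat xᵃ`. -/
theorem ιInt_isCritical : D.IsCriticalAlongL Sint (D.ιInt h).comp :=
  (D.isCriticalAlongL_iff _).2 fun a => by
    have := D.ιInt_pullback h hsq (D.QL Sint (D.κL (X a)))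
    rw [D.pIntL_QL h hsq, pIntL_κL, map_zero] at this
    exact this

omit hsq in
/-- The map `cr`. -/
def cr : FormalMap 𝕜 D.gh' D.gh where
  comp i := D.pIntL Sint (X i) - linForm D.gh' D.inc i
  homogeneous i := by
    rw [sub_eq_add_neg]
    exact ((D.ιInt h).homogeneous i).add (D.inc_isMap.hom i).neg
  constantCoeff i := mem_Fil_one.1
    (Submodule.sub_mem _ (D.pIntL_fil h (X_mem_Fil i)) (linForm_mem_Fil _ i))

omit hsq in
theorem ιInt_comp (i : Fin n) : (D.ιInt h).comp i = linForm D.gh' D.inc i + (D.cr h).comp i :=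
  (add_sub_cancel (linForm D.gh' D.inc i) _).symm

omit hsq in
theorem sum_κ_cr (i : Fin n) : ∑ j, D.κ i j • (D.cr h).comp j = 0 := by
  have : ∑ j, D.κ i j • (D.cr h).comp j =
      D.pIntL Sint (D.κL (X i)) - ∑ j, D.κ i j • linForm D.gh' D.inc j := by
    rw [κL_X, map_linForm, ← Finset.sum_sub_distrib]
    exact Finset.sum_congr rfl fun j _ => smul_sub _ _ _
  rw [this, pIntL_κL, sum_smul_linForm, D.κ_inc, linForm_zero, sub_zero]

omit hsq in
theorem sum_pr_cr (a : Fin n') : ∑ j, D.pr a j • (D.cr h).comp j = 0 := by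
  have : ∑ j, D.pr a j • (D.cr h).comp j =
      D.pIntL Sint (D.iL (X a)) - ∑ j, D.pr a j • linForm D.gh' D.inc j := by
    rw [iL_X, map_linForm, ← Finset.sum_sub_distrib]
    exact Finset.sum_congr rfl fun j _ => smul_sub _ _ _
  rw [this, pIntL_iL, sum_smul_linForm, D.pr_inc, linForm_one, sub_self]

-- The homotopy relation applied to a vector annihilated by `κ` and by `π` exhibits it as `κ d` of
-- itself, hence in the image of `κ`.
omit hsq in
theorem cr_eq (i : Fin n) :
    (D.cr h).comp i = ∑ j, D.κ i j • ∑ k, D.d j k • (D.cr h).comp k := by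
  have e : ∀ {k l : ℕ} (A : Matrix (Fin n) (Fin k) 𝕜) (B : Matrix (Fin k) (Fin l) 𝕜)
      (y : Fin l → FormalFun 𝕜 D.gh'), ∑ j, A i j • ∑ k, B j k • y k = ∑ k, (A * B) i k • y k := by
    intro k l A B y
    simp only [Finset.smul_sum, smul_smul, Matrix.mul_apply, Finset.sum_smul]
    rw [Finset.sum_comm]
  have h1 : ∑ k, (D.d * D.κ + D.κ * D.d) i k • (D.cr h).comp k =
      ∑ k, (1 - D.inc * D.pr : Matrix (Fin n) (Fin n) 𝕜) i k • (D.cr h).comp k := by rw [D.homotopy]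
  simp only [Matrix.add_apply, Matrix.sub_apply, add_smul, sub_smul, Finset.sum_add_distrib,
    Finset.sum_sub_distrib, ← e, sum_κ_cr, sum_pr_cr, smul_zero, Finset.sum_const_zero, zero_add,
    sub_zero, Matrix.one_apply, ite_smul, one_smul, zero_smul, Finset.sum_ite_eq, Finset.mem_univ,
    if_true] at h1
  exact h1.symm

omit hsq in
theorem cr_range (m : Fin n' →₀ ℕ) :
    (fun i => coeff m ((D.cr h).comp i)) ∈ LinearMap.range D.κ.mulVecLin := by
  refine ⟨fun j => coeff m (∑ k, D.d j k • (D.cr h).comp k), funext fun i => ?_⟩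
  conv_rhs => rw [cr_eq]
  simp [Matrix.mulVec, dotProduct, coeff_sum, coeff_smul]

theorem isCr_cr : D.IsCr Sint (D.cr h) := by
  refine ⟨D.cr_range h, ?_⟩
  simp only [← ιInt_comp]
  exact D.ιInt_isCritical h hsq

omit h hsq in
theorem linForm_range (m : Fin n' →₀ ℕ) :
    (fun i => coeff m (linForm D.gh' D.inc i)) ∈ LinearMap.range D.inc.mulVecLin := by
  refine ⟨fun a => coeff m (X a : FormalFun 𝕜 D.gh'), funext fun i => ?_⟩
  simp [Matrix.mulVec, dotProduct, linForm, coeff_sum, coeff_smul]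

omit h hsq in
theorem mapsToZ_of_isCr {cr g : FormalMap 𝕜 D.gh' D.gh} (hcr : D.IsCr Sint cr)
    (hg : ∀ i, g.comp i = linForm D.gh' D.inc i + cr.comp i) : D.MapsToZ Sint g := by
  refine ⟨fun m => ?_, by rw [show g.comp = _ from funext hg]; exact hcr.2⟩
  simp only [hg, coeff_add]
  exact Submodule.add_mem_sup (D.linForm_range m) (hcr.1 m)

/-- Pullback along `z` kills `κhat` and `H`, so it is unchanged by the flow and equals its limit
`z^* i_int p_int`. As `i_int` differs from `i` by the image of `κhat`, this is `z^* i p_int`, the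
pullback along `ι_int ∘ π ∘ z`. -/
theorem eq_of_mapsToZ {k : ℕ} {ghY : Fin k → ℤ} {z : FormalMap 𝕜 ghY D.gh} (hz : D.MapsToZ Sint z)
    (i : Fin n) : z.comp i = subst (fun a => ∑ j, D.pr a j • z.comp j) ((D.ιInt h).comp i) := by
  -- The values lie in `im ι + im κ`, which `κ` annihilates because `κ ι = 0` and `κ² = 0`.
  have h1 : ∀ i, subst z.comp (D.κL (X i)) = 0 := fun i => by
    rw [κL_X, ← substL_apply, map_linForm]
    simp only [substL_apply, subst_X z.isMap]
    refine ext' fun m _ => ?_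
    obtain ⟨u, ⟨u', rfl⟩, v, ⟨v', rfl⟩, huv⟩ := Submodule.mem_sup.1 (hz.1 m)
    have h2 : D.κ.mulVec (fun i => coeff m (z.comp i)) = 0 := by
      rw [← huv, Matrix.mulVec_add, Matrix.mulVecLin_apply, Matrix.mulVecLin_apply, Matrix.mulVec_mulVec,
        Matrix.mulVec_mulVec, D.κ_inc, D.κ_κ, Matrix.zero_mulVec, Matrix.zero_mulVec, add_zero]
    have := congrFun h2 i
    simpa [Matrix.mulVec, dotProduct, coeff_sum, coeff_smul, coeff_zero] using this
  have h2 := (D.isCriticalAlongL_iff z.comp).1 hz.2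
  have h3 := subst_isDer_eq_zero z.isMap D.κL_isDer h1
  -- On coordinates, the term `κhat Q` vanishes by `h3` and the term `Q κhat` by criticality; a
  -- derivation needs no further check.
  have h4 := subst_isDer_eq_zero z.isMap (D.HL_isDer h) fun i => by
    rw [HL_apply, subst_add, h3, h2, add_zero]
  have hfil : Filtered (substL D.gh z.comp) := fun N f hf => subst_mem_Fil z.isMap.fil hf
  have h5 : ∀ T f, subst z.comp (D.flowPullback h T f) = subst z.comp f := fun T f => by
    have h0 : Filtered (0 : Module.End 𝕜 (FormalFun 𝕜 ghY)) := fun _ _ _ => Submodule.zero_mem _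
    exact (map_flowL hfil h0 h4 T f).trans (flowL_of_eq_zero rfl T)
  have h6 : ∀ f, subst z.comp f = subst z.comp (D.iIntL Sint (D.pIntL Sint f)) := fun f =>
    ext' fun m _ => by
      have := tendsto_coeff_linearMap hfil (D.tendsto_flow h hsq f) m
      simp only [substL_apply, h5] at this
      exact tendsto_nhds_unique tendsto_const_nhds this
  -- The correction term in `i_int` begins with `K = κhat G`, which the pullback kills.
  have h7 : ∀ f, subst z.comp (D.iIntL Sint f) = subst z.comp (D.iL f) := fun f => by
    rw [iIntL_apply, ← substL_apply (ghT := D.gh), map_sub, KL_eq_apply, substL_apply, substL_apply, h3,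
      sub_zero]
  have h8 := h6 (X i)
  rw [subst_X z.isMap, h7, iL, substL_apply, subst_subst z.isMap D.pr_isMap] at h8
  rw [h8]
  congr 1
  funext a
  rw [← substL_apply (ghT := D.gh), map_linForm]
  simp only [substL_apply, subst_X z.isMap]

omit hsq in
theorem sum_pr_ιInt (a : Fin n') : ∑ i, D.pr a i • (D.ιInt h).comp i = X a := by
  simp only [ιInt, ← map_linForm, ← iL_X, pIntL_iL]

theorem isInverseOfPrOnZ : D.IsInverseOfPrOnZ Sint (D.ιInt h) :=
  ⟨D.mapsToZ_of_isCr (D.isCr_cr h hsq) (D.ιInt_comp h), D.sum_pr_ιInt h,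
    fun _ _ _ hz i => D.eq_of_mapsToZ h hsq hz i⟩

/-- The map `x' + cr' x'` goes into the critical locus and is a section of `π`, so it must be
`ι_int`. -/
theorem isCr_unique {cr' : FormalMap 𝕜 D.gh' D.gh} (hcr : D.IsCr Sint cr') : cr' = D.cr h := by
  let g : FormalMap 𝕜 D.gh' D.gh :=
    { comp := fun i => linForm D.gh' D.inc i + cr'.comp i
      homogeneous := fun i => (D.inc_isMap.hom i).add (cr'.homogeneous i)
      constantCoeff := fun i => mem_Fil_one.1
        (Submodule.add_mem _ (linForm_mem_Fil _ i) (cr'.isMap.fil i)) }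
  have h1 : ∀ a, ∑ j, D.pr a j • g.comp j = X a := fun a => by
    have h2 : ∑ j, D.pr a j • cr'.comp j = 0 := by
      refine ext' fun m _ => ?_
      obtain ⟨v, hv⟩ := hcr.1 m
      have h2 : D.pr.mulVec (fun i => coeff m (cr'.comp i)) = 0 := by
        rw [← hv, Matrix.mulVecLin_apply, Matrix.mulVec_mulVec, D.pr_κ, Matrix.zero_mulVec]
      simpa [Matrix.mulVec, dotProduct, coeff_sum, coeff_smul, coeff_zero] using congrFun h2 a
    simp only [g, smul_add, Finset.sum_add_distrib, h2, sum_smul_linForm, D.pr_inc, linForm_one, add_zero]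
  ext1
  funext i
  have h2 := D.eq_of_mapsToZ h hsq (D.mapsToZ_of_isCr (g := g) hcr fun _ => rfl) i
  simp only [h1] at h2
  rw [subst_id, ιInt_comp] at h2
  exact add_left_cancel h2

/-! ## The induced action -/

/-- Both sides are derivations, so coordinates suffice. The derivatives of `S ∘ ι_int` reduce to the
infrared directions by criticality, and compatibility of `ι` and `π` with the symplectic forms
matches the two Poisson structures. -/
theorem QInt'_eq_bracket : D.QInt' Sint = bracket D.ω' ((D.ιInt h).pullback (D.S Sint)) := by
  have hS : IsHomogeneous 0 (D.pIntL Sint (D.S Sint)) := D.pIntL_homogeneous h (D.S_homogeneous h)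
  have hinv : D.inc * D.ω'⁻¹ = D.ω⁻¹ * D.pr.transpose := by
    calc D.inc * D.ω'⁻¹ = D.ω⁻¹ * (D.ω * D.inc) * D.ω'⁻¹ := by
          rw [← Matrix.mul_assoc, Matrix.nonsing_inv_mul _ D.ω_nondeg, Matrix.one_mul]
      _ = D.ω⁻¹ * D.pr.transpose := by
          rw [D.inc_compat, Matrix.mul_assoc, Matrix.mul_assoc, Matrix.mul_nonsing_inv _ D.ω'_nondeg,
            Matrix.mul_one]
  have hcrit : ∀ k, ∑ j, D.κ j k • D.pIntL Sint (dL j (D.S Sint)) = 0 := fun k => by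
    have := D.ιInt_isCritical h hsq k
    simpa only [← D.ιInt_pullback h hsq, FormalMap.pullback] using this
  have hdL : ∀ b, dL b (D.pIntL Sint (D.S Sint)) =
      ∑ j, D.inc j b • D.pIntL Sint (dL j (D.S Sint)) := fun b => by
    have h1 := dL_subst (D.ιInt h).isMap b (D.S Sint)
    rw [show subst (D.ιInt h).comp (D.S Sint) = _ from D.ιInt_pullback h hsq _] at h1
    have h2 : ∀ j, subst (D.ιInt h).comp (dL j (D.S Sint)) = _ := fun j => D.ιInt_pullback h hsq _
    -- Writing the nonlinear part as `κ d cr` shows its derivative as a combination of columns of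
    -- `κ`. Paired with the derivatives of `S`, these columns give zero by `hcrit`.
    have h3 : ∀ j, dL b ((D.ιInt h).comp j) = D.inc j b • 1 +
        ∑ k, D.κ j k • dL b (∑ l, D.d k l • (D.cr h).comp l) := fun j => by
      rw [ιInt_comp, cr_eq, ← dLL_apply, map_add, map_linForm, map_sum]
      simp only [map_smul, dLL_apply, dL_X]
      simp
    rw [h1]
    simp only [h2, h3, add_mul, Finset.sum_add_distrib, smul_mul_assoc, one_mul, Finset.sum_mul]
    rw [Finset.sum_comm (γ := Fin n)]
    simp only [← mul_smul_comm, ← Finset.mul_sum, hcrit, mul_zero, Finset.sum_const_zero, add_zero]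
  have hder := ham_isDer D.ω'_deg D.ω'_nondeg hS (D.pIntL_fil h (D.S_mem_Fil h))
  have key := (D.QIntL'_isDer h hsq).ext hder fun a => by
    have e1 : D.QIntL' Sint (X a) = ∑ i, D.pr a i • ∑ j, D.ω⁻¹ j i •
        D.pIntL Sint (dL j (D.S Sint)) := by
      rw [D.QIntL'_eq h hsq, iL_X, map_linForm, map_sum]
      simp only [map_smul, QL, vfL_X, hamComp, map_sum]
    rw [e1, vfL_X, hamComp]
    simp only [hdL, Finset.smul_sum, smul_smul]
    conv_lhs => rw [Finset.sum_comm]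
    conv_rhs => rw [Finset.sum_comm]
    refine Finset.sum_congr rfl fun j _ => ?_
    rw [← Finset.sum_smul, ← Finset.sum_smul]
    congr 1
    have := congrFun (congrFun hinv j) a
    simp only [Matrix.mul_apply, Matrix.transpose_apply] at this
    rw [Finset.sum_congr rfl fun b _ => mul_comm _ _, ← this]
    exact Finset.sum_congr rfl fun b _ => mul_comm _ _
  funext f
  rw [D.QInt'_eq h, D.ιInt_pullback h hsq, bracket_eq hS, key]

end FreeBVRetract

namespace FreeBVRetract

variable {𝕜 : Type*} [Field 𝕜] [CharZero 𝕜] {n n' : ℕ} (D : FreeBVRetract 𝕜 n n')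

/-! ## Pullback by maps depending on the odd parameter `dT` -/

omit [CharZero 𝕜] in
theorem isMap_succ (gh : Fin n → ℤ) :
    IsMap gh (fun j => (X j.succ : FormalFun 𝕜 (Fin.cons 1 gh : Fin (n + 1) → ℤ))) :=
  ⟨fun i => by simpa using
    isHomogeneous_X (𝕜 := 𝕜) (gh := (Fin.cons 1 gh : Fin (n + 1) → ℤ)) i.succ, fun i => X_mem_Fil _⟩

omit [CharZero 𝕜] in
theorem isMap_cons (gh : Fin n → ℤ) : IsMap (Fin.cons 1 gh : Fin (n + 1) → ℤ)
    (Fin.cons 0 X : Fin (n + 1) → FormalFun 𝕜 gh) := by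
  refine ⟨fun i => ?_, fun i => ?_⟩
  · refine Fin.cases ?_ (fun i => ?_) i
    · exact isHomogeneous_zero _
    · simpa using isHomogeneous_X i
  · refine Fin.cases ?_ (fun i => ?_) i
    · exact Submodule.zero_mem _
    · simpa using X_mem_Fil i

/-- The inclusion of the functions that do not depend on `dT`. -/
def liftDT : FormalFun 𝕜 D.gh →ₗ[𝕜] FormalFun 𝕜 (Fin.cons 1 D.gh : Fin (n + 1) → ℤ) :=
  substL D.gh fun j => X j.succ

theorem liftDT_mul (f g : FormalFun 𝕜 D.gh) : D.liftDT (f * g) = D.liftDT f * D.liftDT g :=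
  subst_mul (isMap_succ D.gh) f g

omit [CharZero 𝕜] in
theorem liftDT_homogeneous {k : ℤ} {f : FormalFun 𝕜 D.gh} (hf : IsHomogeneous k f) :
    IsHomogeneous k (D.liftDT f) := subst_homogeneous (isMap_succ D.gh) hf

omit [CharZero 𝕜] in
theorem liftDT_fil {N : ℕ} {f : FormalFun 𝕜 D.gh} (hf : f ∈ Fil 𝕜 D.gh N) :
    D.liftDT f ∈ Fil 𝕜 (Fin.cons 1 D.gh : Fin (n + 1) → ℤ) N := subst_mem_Fil (isMap_succ D.gh).fil hf

theorem dTPart_lift (f g : FormalFun 𝕜 D.gh) : D.dTPart (D.liftDT f + X 0 * D.liftDT g) = g := by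
  have h0 : ∀ f, dL 0 (D.liftDT f) = 0 := fun f => by
    rw [liftDT, substL_apply, dL_subst (isMap_succ D.gh)]
    refine Finset.sum_eq_zero fun j _ => ?_
    rw [dL_X, if_neg (Fin.succ_ne_zero j).symm, zero_mul]
  rw [dTPart, ← dLL_apply, map_add, dLL_apply, dLL_apply, h0, zero_add, dL_X_mul, if_pos rfl, h0, mul_zero,
    smul_zero, add_zero, liftDT, substL_apply, subst_subst (isMap_cons D.gh) (isMap_succ D.gh)]
  simp only [subst_X (isMap_cons D.gh), Fin.cons_succ]
  exact subst_id g

/-- The right side defines a multiplicative map of `O`, because `dT² = 0` and `κhat` is an odd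
derivation. So it is the substitution determined by its values on coordinates, which are those of
`(id + dT κ) ∘ φ`. -/
theorem pullbackWithDT_eq (φ : FormalMap 𝕜 D.gh D.gh) (O : FormalFun 𝕜 D.gh) :
    D.pullbackWithDT φ O = D.liftDT (φ.pullback O) + X 0 * D.liftDT (φ.pullback (D.κL O)) := by
  let P : FormalFun 𝕜 D.gh →ₗ[𝕜] FormalFun 𝕜 D.gh := substL D.gh φ.comp
  let x0 : FormalFun 𝕜 (Fin.cons 1 D.gh : Fin (n + 1) → ℤ) := X 0
  have hx0 : IsHomogeneous 1 x0 := isHomogeneous_X 0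
  have hP : ∀ {N f}, f ∈ Fil 𝕜 D.gh N → P f ∈ Fil 𝕜 D.gh N := fun hf => subst_mem_Fil φ.isMap.fil hf
  let Θ := D.liftDT.comp P + (LinearMap.mulLeft 𝕜 x0).comp (D.liftDT.comp (P.comp D.κL))
  have hΘ : ∀ f, Θ f = D.liftDT (P f) + x0 * D.liftDT (P (D.κL f)) := fun f => rfl
  let g : Fin n → FormalFun 𝕜 (Fin.cons 1 D.gh : Fin (n + 1) → ℤ) := fun i => Θ (X i)
  have hA : ∀ i, IsHomogeneous (D.gh i) (D.liftDT (P (X i))) := fun i =>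
    D.liftDT_homogeneous (subst_homogeneous φ.isMap (isHomogeneous_X i))
  have hB : ∀ i, IsHomogeneous (D.gh i + -1) (D.liftDT (P (D.κL (X i)))) := fun i =>
    D.liftDT_homogeneous (subst_homogeneous φ.isMap (D.κL_X_hom i))
  have hfil : ∀ N f, f ∈ Fil 𝕜 D.gh N → Θ f ∈ Fil 𝕜 (Fin.cons 1 D.gh : Fin (n + 1) → ℤ) N :=
    fun N f hf => Submodule.add_mem _ (D.liftDT_fil (hP hf))
      (mul_mem_Fil_left _ (D.liftDT_fil (hP (D.κL_graded.fil _ _ hf))))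
  have hg : IsMap D.gh g := ⟨fun i => (hA i).add (hx0.mul' (hB i) (by ring)),
    fun i => hfil 1 _ (X_mem_Fil i)⟩
  have key := eq_subst_of_mul hg hfil
    (by rw [hΘ, D.κL_isDer.map_one, map_zero, map_zero, mul_zero, add_zero]
        simp only [P, liftDT, substL_apply, subst_one φ.isMap, subst_one (isMap_succ D.gh)])
    fun i f => by
      have hPm : ∀ f g, P (f * g) = P f * P g := fun f g => subst_mul φ.isMap f g
      have e1 : D.liftDT (P (X i)) * x0 = sg 𝕜 (D.gh i) • (x0 * D.liftDT (P (X i))) := by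
        rw [mul_comm_tw (hA i), tw_homogeneous hx0, smul_mul_assoc, mul_one]
      -- The product of two `dT` terms contains `dT²` after moving one past the other factor. This
      -- removes the only term missing from the Leibniz rule.
      have e2 : x0 * D.liftDT (P (D.κL (X i))) * x0 = 0 := by
        rw [mul_assoc, mul_comm_tw (hB i), ← mul_assoc, tw_homogeneous hx0, mul_smul_comm,
          hx0.mul_self odd_one, smul_zero, zero_mul]
      have e3 : sg 𝕜 (-1 * D.gh i) = sg 𝕜 (D.gh i) := sg_congr 𝕜 ⟨-D.gh i, by ring⟩
      simp only [g, hΘ, hPm, liftDT_mul, D.κL_isDer.leibniz, map_add, tw_homogeneous (isHomogeneous_X i),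
        e3, smul_mul_assoc, map_smul, mul_add, add_mul]
      rw [← mul_assoc (D.liftDT (P (X i))) x0, e1, ← mul_assoc (x0 * _) x0, e2, zero_mul, add_zero,
        smul_mul_assoc, mul_smul_comm]
      simp only [mul_assoc]
      abel
  have := LinearMap.congr_fun key O
  rw [substL_apply, hΘ] at this
  rw [pullbackWithDT]
  refine Eq.trans ?_ this.symm
  congr 1
  funext i
  simp only [g, hΘ]
  rw [κL_X, map_linForm, map_sum]
  simp only [map_smul, P, substL_apply, subst_X φ.isMap]
  rfl

theorem dTPart_pullbackWithDT (φ : FormalMap 𝕜 D.gh D.gh) (O : FormalFun 𝕜 D.gh) :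
    D.dTPart (D.pullbackWithDT φ O) = φ.pullback (D.κL O) := by
  rw [pullbackWithDT_eq, dTPart_lift]

end FreeBVRetract

/-! ## Formal power series in `ħ` -/

section HSeries

variable {𝕜 : Type*} [Field 𝕜] {n n' : ℕ} {gh : Fin n → ℤ} {gh' : Fin n' → ℤ}

/-- The filtration of formal functions depending on `ħ` for which `ħ` has weight `2`. -/
def HFil (N : ℕ) (u : ℕ → FormalFun 𝕜 gh) : Prop := ∀ j, u j ∈ Fil 𝕜 gh (N - 2 * j)

theorem HFil.neg {N : ℕ} {u : ℕ → FormalFun 𝕜 gh} (hu : HFil N u) : HFil N (-u) :=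
  fun j => Submodule.neg_mem _ (hu j)

theorem hFil_zero (u : ℕ → FormalFun 𝕜 gh) : HFil 0 u := fun j => by
  rw [Nat.zero_sub]; exact mem_Fil_zero _

theorem HFil.hlift {N : ℕ} {u : ℕ → FormalFun 𝕜 gh} (hu : HFil N u)
    {L : FormalFun 𝕜 gh → FormalFun 𝕜 gh'} (hL : ∀ N f, f ∈ Fil 𝕜 gh N → L f ∈ Fil 𝕜 gh' N) :
    HFil N (FreeBVRetract.hlift L u) := fun j => hL _ _ (hu j)

/-- The terms of order less than `k` in `ħ` vanish. -/
def HVanish (k : ℕ) (u : ℕ → FormalFun 𝕜 gh) : Prop := ∀ j, j < k → u j = 0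

theorem HVanish.neg {k : ℕ} {u : ℕ → FormalFun 𝕜 gh} (hu : HVanish k u) : HVanish k (-u) :=
  fun j hj => by rw [Pi.neg_apply, hu j hj, neg_zero]

theorem HVanish.hlift {k : ℕ} {u : ℕ → FormalFun 𝕜 gh} (hu : HVanish k u)
    {L : FormalFun 𝕜 gh → FormalFun 𝕜 gh'} (hL : L 0 = 0) : HVanish k (FreeBVRetract.hlift L u) :=
  fun j hj => by rw [FreeBVRetract.hlift, hu j hj, hL]

variable [TopologicalSpace 𝕜]

/-- For each order in `ħ` and each monomial the series has only finitely many nonzero terms. -/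
theorem summable_of_coeff {u : ℕ → ℕ → FormalFun 𝕜 gh}
    (hu : ∀ j m, ∃ N, ∀ k, N ≤ k → coeff m (u k j) = 0) : Summable u := by
  rw [Pi.summable]
  intro j
  choose N hN using hu j
  refine ⟨FormalFun.mk gh fun m => ∑ k ∈ Finset.range (N m), coeff m (u k j),
    hasSum_iff_coeff.2 fun m => ?_⟩
  by_cases hm : Admissible gh m
  · rw [coeff_mk _ hm]
    exact hasSum_sum_of_ne_finset_zero fun k hk => hN m k (by simpa using hk)
  · simp only [coeff_of_not _ hm]
    exact hasSum_zero

theorem summable_of_hFil {u : ℕ → ℕ → FormalFun 𝕜 gh} (hu : ∀ k, HFil k (u k)) : Summable u :=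
  summable_of_coeff fun j m => ⟨m.degree + 2 * j + 1, fun k hk => hu k j m (by omega)⟩

theorem summable_of_hVanish {u : ℕ → ℕ → FormalFun 𝕜 gh} (hu : ∀ k, HVanish k (u k)) : Summable u :=
  summable_of_coeff fun j m => ⟨j + 1, fun k hk => by rw [hu k j (by omega), coeff_zero]⟩

variable [T2Space 𝕜]

theorem HFil.tsum {N : ℕ} {u : ℕ → ℕ → FormalFun 𝕜 gh} (hu : ∀ k, HFil N (u k)) :
    HFil N (∑' k, u k) := by
  by_cases hs : Summable u
  · intro j m hm
    have h1 := hasSum_iff_coeff.1 (Pi.hasSum.1 hs.hasSum j) m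
    simp only [hu _ j m hm] at h1
    exact h1.unique hasSum_zero
  -- A divergent sum has the default value zero, which lies in every step of the filtration.
  · rw [tsum_eq_zero_of_not_summable hs]
    exact fun j => Submodule.zero_mem _

omit [TopologicalSpace 𝕜] [T2Space 𝕜] in
theorem iterate_hVanish {T : (ℕ → FormalFun 𝕜 gh) → ℕ → FormalFun 𝕜 gh}
    (hT : ∀ k u, HVanish k u → HVanish (k + 1) (T u)) (k : ℕ) (u : ℕ → FormalFun 𝕜 gh) :
    HVanish k (T^[k] u) := by
  induction k with
  | zero => exact fun j hj => absurd hj (Nat.not_lt_zero j)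
  | succ k ih => rw [Function.iterate_succ_apply']; exact hT k _ ih

omit [TopologicalSpace 𝕜] [T2Space 𝕜] in
theorem iterate_hFil {T : (ℕ → FormalFun 𝕜 gh) → ℕ → FormalFun 𝕜 gh}
    (hT : ∀ k u, HFil k u → HFil (k + 1) (T u)) (k : ℕ) (u : ℕ → FormalFun 𝕜 gh) :
    HFil k (T^[k] u) := by
  induction k with
  | zero => exact hFil_zero _
  | succ k ih => rw [Function.iterate_succ_apply']; exact hT k _ ih

omit [TopologicalSpace 𝕜] [T2Space 𝕜] in
theorem iterate_hFil' {T : (ℕ → FormalFun 𝕜 gh) → ℕ → FormalFun 𝕜 gh}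
    (hT : ∀ N u, HFil N u → HFil N (T u)) (k : ℕ) {N : ℕ} {u : ℕ → FormalFun 𝕜 gh} (hu : HFil N u) :
    HFil N (T^[k] u) := by
  induction k with
  | zero => exact hu
  | succ k ih => rw [Function.iterate_succ_apply']; exact hT N _ ih

omit [Field 𝕜] [TopologicalSpace 𝕜] [T2Space 𝕜] in
theorem iterate_apply_zero {T : (ℕ → FormalFun 𝕜 gh) → ℕ → FormalFun 𝕜 gh}
    {T₀ : FormalFun 𝕜 gh → FormalFun 𝕜 gh} (hT : ∀ u, T u 0 = T₀ (u 0)) (k : ℕ)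
    (u : ℕ → FormalFun 𝕜 gh) : T^[k] u 0 = T₀^[k] (u 0) := by
  induction k with
  | zero => rfl
  | succ k ih => rw [Function.iterate_succ_apply', Function.iterate_succ_apply', hT, ih]

theorem tsum_hVanish_apply_zero {u : ℕ → ℕ → FormalFun 𝕜 gh} (hu : ∀ k, HVanish k (u k)) :
    (∑' k, u k) 0 = u 0 0 := by
  rw [tsum_apply (summable_of_hVanish hu)]
  exact tsum_eq_single 0 fun k hk => hu k 0 (Nat.pos_of_ne_zero hk)

end HSeries

namespace FreeBVRetract

variable {𝕜 : Type*} [Field 𝕜] {n n' : ℕ} (D : FreeBVRetract 𝕜 n n')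

/-! ## The interacting quantum retraction -/

section Perturbations

variable (c : 𝕜)

theorem laplacian_mem_Fil {N : ℕ} {f : FormalFun 𝕜 D.gh} (hf : f ∈ Fil 𝕜 D.gh N) :
    laplacian D.ω f ∈ Fil 𝕜 D.gh (N - 2) := by
  obtain hN | ⟨M, rfl⟩ : N < 2 ∨ ∃ M, N = M + 1 + 1 := by
    by_cases h : N < 2
    · exact Or.inl h
    · exact Or.inr ⟨N - 2, by omega⟩
  · rw [Nat.sub_eq_zero_of_le (by omega)]; exact mem_Fil_zero _
  · exact Submodule.smul_mem _ _ (Submodule.sum_mem _ fun i _ => Submodule.sum_mem _ fun j _ =>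
      Submodule.smul_mem _ _ (dL_mem_Fil (dL_mem_Fil hf)))

/-- The Laplacian lowers the polynomial degree by two, exactly compensated by the weight of the
additional `ħ`. -/
theorem hΔ_hFil {N : ℕ} {u : ℕ → FormalFun 𝕜 D.gh} (hu : HFil N u) : HFil N (D.hΔ c u)
  | 0 => Submodule.zero_mem _
  | k + 1 => by
    have := D.laplacian_mem_Fil (hu k)
    rw [show N - 2 * k - 2 = N - 2 * (k + 1) by omega] at this
    exact Submodule.smul_mem _ _ this

theorem laplacian_zero : laplacian D.ω (0 : FormalFun 𝕜 D.gh) = 0 := by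
  have : ∀ i, dL i (0 : FormalFun 𝕜 D.gh) = 0 := fun i => map_zero (dLL i)
  simp [laplacian, this]

theorem hΔ_hVanish {k : ℕ} {u : ℕ → FormalFun 𝕜 D.gh} (hu : HVanish k u) :
    HVanish (k + 1) (D.hΔ c u)
  | 0, _ => rfl
  | j + 1, hj => by
    rw [hΔ, hu j (by omega), laplacian_zero, smul_zero]

theorem K_fil (N : ℕ) (f : FormalFun 𝕜 D.gh) (hf : f ∈ Fil 𝕜 D.gh N) : D.K f ∈ Fil 𝕜 D.gh N :=
  D.KL_graded.fil _ _ hf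

theorem p_fil (N : ℕ) (f : FormalFun 𝕜 D.gh) (hf : f ∈ Fil 𝕜 D.gh N) : D.p f ∈ Fil 𝕜 D.gh' N :=
  D.pL_graded.fil _ _ hf

theorem K_zero : D.K 0 = 0 := map_zero D.KL

theorem p_zero : D.p 0 = 0 := map_zero D.pL

theorem i_series_hVanish (k : ℕ) (u : ℕ → FormalFun 𝕜 D.gh) :
    HVanish k ((fun v => -hlift D.K (D.hΔ c v))^[k] u) :=
  iterate_hVanish (fun _ _ hu => ((D.hΔ_hVanish c hu).hlift D.K_zero).neg) k u

theorem p_series_hVanish (k : ℕ) (u : ℕ → FormalFun 𝕜 D.gh) :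
    HVanish k ((fun v => -D.hΔ c (hlift D.K v))^[k] u) :=
  iterate_hVanish (fun _ _ hu => (D.hΔ_hVanish c (hu.hlift D.K_zero)).neg) k u

theorem p_series_hFil (k : ℕ) {N : ℕ} {u : ℕ → FormalFun 𝕜 D.gh} (hu : HFil N u) :
    HFil N ((fun v => -D.hΔ c (hlift D.K v))^[k] u) :=
  iterate_hFil' (fun _ _ hu => (D.hΔ_hFil c (hu.hlift D.K_fil)).neg) k hu

/-- Each interaction starts in cubic order, so its bracket raises the degree by one; powers of `ħ`
in the interaction only add weight. -/
theorem hbracket_hFil {SintQ : ℕ → FormalFun 𝕜 D.gh} (hS : ∀ k, D.IsInteraction (SintQ k)) {N : ℕ}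
    {u : ℕ → FormalFun 𝕜 D.gh} (hu : HFil N u) : HFil (N + 1) (D.hbracket SintQ u) := fun j =>
  Submodule.sum_mem _ fun q hq => by
    have h1 := D.QintL_raises (hS q.1) _ _ (hu q.2)
    rw [← D.Qint_eq (hS q.1)] at h1
    have := Finset.HasAntidiagonal.mem_antidiagonal.1 hq
    exact Fil_antitone (by omega) h1

theorem hbracket_apply_zero (SintQ u : ℕ → FormalFun 𝕜 D.gh) :
    D.hbracket SintQ u 0 = D.Qint (SintQ 0) (u 0) := by
  simp [hbracket, Qint]

variable [TopologicalSpace 𝕜]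

/-- Convergence here comes from the order in `ħ`, which every application of `ħ Δ` raises, rather
than from the weight, which it only preserves. -/
theorem hplConverges_free : HPLConverges (hlift D.p) (hlift D.K) (D.hΔ c) (hlift D.i) where
  conv_i _ := summable_of_hVanish fun k => D.i_series_hVanish c k _
  conv_p f := summable_of_hVanish fun k => (D.p_series_hVanish c k f).hlift D.p_zero
  conv_K f := summable_of_hVanish fun k => (D.p_series_hVanish c k f).hlift D.K_zero
  conv_d _ := summable_of_hVanish fun k => (D.p_series_hVanish c k _).hlift D.p_zero

variable [T2Space 𝕜]

theorem ph_hFil {N : ℕ} {u : ℕ → FormalFun 𝕜 D.gh} (hu : HFil N u) : HFil N (D.ph c u) :=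
  HFil.tsum fun k => (D.p_series_hFil c k hu).hlift D.p_fil

theorem Kh_hFil {N : ℕ} {u : ℕ → FormalFun 𝕜 D.gh} (hu : HFil N u) : HFil N (D.Kh c u) :=
  HFil.tsum fun k => (D.p_series_hFil c k hu).hlift D.K_fil

theorem ih_apply_zero (f : ℕ → FormalFun 𝕜 D.gh') : D.ih c f 0 = D.i (f 0) :=
  tsum_hVanish_apply_zero fun k => D.i_series_hVanish c k _

theorem ph_apply_zero (f : ℕ → FormalFun 𝕜 D.gh) : D.ph c f 0 = D.p (f 0) :=
  tsum_hVanish_apply_zero fun k => (D.p_series_hVanish c k f).hlift D.p_zero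

theorem Kh_apply_zero (f : ℕ → FormalFun 𝕜 D.gh) : D.Kh c f 0 = D.K (f 0) :=
  tsum_hVanish_apply_zero fun k => (D.p_series_hVanish c k f).hlift D.K_zero

theorem Q'₀h_apply_zero (f : ℕ → FormalFun 𝕜 D.gh') : D.Q'₀h c f 0 = D.Q'₀ (f 0) := by
  have : (∑' k : ℕ, hlift D.p ((fun v => -D.hΔ c (hlift D.K v))^[k] (D.hΔ c (hlift D.i f)))) 0 = 0 :=
    (tsum_hVanish_apply_zero fun k => (D.p_series_hVanish c k _).hlift D.p_zero).trans D.p_zero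
  rw [Q'₀h, hplD, Pi.add_apply, this, add_zero]
  rfl

variable {SintQ : ℕ → FormalFun 𝕜 D.gh} (hS : ∀ k, D.IsInteraction (SintQ k))

include hS

theorem i_int_series_hFil (k : ℕ) (u : ℕ → FormalFun 𝕜 D.gh) :
    HFil k ((fun v => -D.Kh c (D.hbracket SintQ v))^[k] u) :=
  iterate_hFil (fun _ _ hu => (D.Kh_hFil c (D.hbracket_hFil hS hu)).neg) k u

theorem p_int_series_hFil (k : ℕ) (u : ℕ → FormalFun 𝕜 D.gh) :
    HFil k ((fun v => -D.hbracket SintQ (D.Kh c v))^[k] u) :=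
  iterate_hFil (fun _ _ hu => (D.hbracket_hFil hS (D.Kh_hFil c hu)).neg) k u

/-- Convergence comes from the weight, since the free quantum homotopy preserves it and the bracket
with the interaction raises it. -/
theorem hplConverges_int : HPLConverges (D.ph c) (D.Kh c) (D.hbracket SintQ) (D.ih c) where
  conv_i _ := summable_of_hFil fun k => D.i_int_series_hFil c hS k _
  conv_p f := summable_of_hFil fun k => D.ph_hFil c (D.p_int_series_hFil c hS k f)
  conv_K f := summable_of_hFil fun k => D.Kh_hFil c (D.p_int_series_hFil c hS k f)
  conv_d _ := summable_of_hFil fun k => D.ph_hFil c (D.p_int_series_hFil c hS k _)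

omit hS in
theorem p_int_series_apply_zero (k : ℕ) (u : ℕ → FormalFun 𝕜 D.gh) :
    (fun v => -D.hbracket SintQ (D.Kh c v))^[k] u 0 =
      (fun v => -D.Qint (SintQ 0) (D.K v))^[k] (u 0) :=
  iterate_apply_zero (fun u => by rw [Pi.neg_apply, hbracket_apply_zero, Kh_apply_zero]) k u

omit hS in
theorem i_int_series_apply_zero (k : ℕ) (u : ℕ → FormalFun 𝕜 D.gh) :
    (fun v => -D.Kh c (D.hbracket SintQ v))^[k] u 0 =
      (fun v => -D.K (D.Qint (SintQ 0) v))^[k] (u 0) :=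
  iterate_apply_zero (fun u => by rw [Pi.neg_apply, Kh_apply_zero, hbracket_apply_zero]) k u

/-- The quantum retraction exists and reduces to the classical one. -/
theorem reducesModH : D.ReducesModH c SintQ where
  conv_free := D.hplConverges_free c
  conv_int := D.hplConverges_int c hS
  red_i f := by
    rw [ihInt, hplI, tsum_apply ((D.hplConverges_int c hS).conv_i f)]
    simp only [i_int_series_apply_zero, ih_apply_zero]
    rfl
  red_p f := by
    rw [phInt, hplP, tsum_apply ((D.hplConverges_int c hS).conv_p f)]
    simp only [ph_apply_zero, p_int_series_apply_zero]
    rfl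
  red_K f := by
    rw [KhInt, hplK, tsum_apply ((D.hplConverges_int c hS).conv_K f)]
    simp only [Kh_apply_zero, p_int_series_apply_zero]
    rfl
  red_Q' f := by
    rw [QhInt', hplD, Pi.add_apply, tsum_apply ((D.hplConverges_int c hS).conv_d f), Q'₀h_apply_zero]
    simp only [ph_apply_zero, p_int_series_apply_zero, hbracket_apply_zero, ih_apply_zero]
    rfl

end Perturbations

end FreeBVRetract

end

end BV

/-! ### The main theorem, assembled from the preceding parts. -/

theorem corollary7p1 {𝕜 : Type*} [RCLike 𝕜] {n n' : ℕ} (D : FreeBVRetract 𝕜 n n')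
    (Sint : FormalFun 𝕜 D.gh) (hSint : D.IsInteraction Sint)
    (hCME : bracket D.ω (D.S Sint) (D.S Sint) = 0) :
    -- the interacting classical retraction
    HPLConverges D.p D.K (D.Qint Sint) D.i ∧
    IsDGCommAlgebra (D.Q Sint) ∧
    IsDGCommAlgebra (D.QInt' Sint) ∧
    IsSDR (D.Q Sint) (D.QInt' Sint) (D.iInt Sint) (D.pInt Sint) (D.KInt Sint) ∧
    -- it is the reduction modulo `ħ` of the interacting quantum retraction
    (∀ (c : 𝕜) (SintQ : ℕ → FormalFun 𝕜 D.gh), (∀ k, D.IsInteraction (SintQ k)) →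
      D.QME c SintQ → SintQ 0 = Sint → D.ReducesModH c SintQ) ∧
    -- the flow of `-H`, the map `cr`, and the limit maps
    ∃ (Φ : ℝ → FormalMap 𝕜 D.gh D.gh) (cr : FormalMap 𝕜 D.gh' D.gh)
      (ιInt : FormalMap 𝕜 D.gh' D.gh) (πInt : FormalMap 𝕜 D.gh D.gh'),
      (D.IsFlow Sint Φ ∧ ∀ Ψ, D.IsFlow Sint Ψ → Ψ = Φ) ∧
      (D.IsCr Sint cr ∧ ∀ cr', D.IsCr Sint cr' → cr' = cr) ∧
      -- (a)
      IsDGAlgHom (D.Q Sint) (D.QInt' Sint) (D.pInt Sint) ∧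
      D.pInt Sint = ιInt.pullback ∧
      (∀ O, Tendsto (fun T => D.p ((Φ T).pullback O)) atTop (𝓝 (D.pInt Sint O))) ∧
      (∀ i, Tendsto (fun T => subst (linForm D.gh' D.inc) ((Φ T).comp i)) atTop
        (𝓝 (ιInt.comp i))) ∧
      D.IsInverseOfPrOnZ Sint ιInt ∧
      (∀ i, ιInt.comp i = linForm D.gh' D.inc i + cr.comp i) ∧
      IsLInfinityMorphism (D.QInt' Sint) (D.Q Sint) ιInt ∧
      D.QInt' Sint = bracket D.ω' (ιInt.pullback (D.S Sint)) ∧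
      -- (b)
      IsDGAlgHom (D.QInt' Sint) (D.Q Sint) (D.iInt Sint) ∧
      D.iInt Sint = πInt.pullback ∧
      (∀ O', Tendsto (fun T => (Φ T).pullback (D.i O')) atTop (𝓝 (D.iInt Sint O'))) ∧
      (∀ a, Tendsto (fun T => ∑ i, D.pr a i • (Φ T).comp i) atTop (𝓝 (πInt.comp a))) ∧
      IsLInfinityMorphism (D.Q Sint) (D.QInt' Sint) πInt ∧
      -- (c)
      (∀ O m,
        MeasureTheory.IntegrableOn
          (fun T => FormalFun.coeff m (D.κhat ((Φ T).pullback O))) (Set.Ioi 0) ∧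
        FormalFun.coeff m (D.KInt Sint O) =
          ∫ T in Set.Ioi (0 : ℝ), FormalFun.coeff m (D.κhat ((Φ T).pullback O))) ∧
      (∀ O m,
        MeasureTheory.IntegrableOn
          (fun T => FormalFun.coeff m (D.dTPart (D.pullbackWithDT (Φ T) O))) (Set.Ioi 0) ∧
        FormalFun.coeff m (D.KInt Sint O) =
          ∫ T in Set.Ioi (0 : ℝ),
            FormalFun.coeff m (D.dTPart (D.pullbackWithDT (Φ T) O))) := by
  -- The master equation enters the rest of the argument only in the form `Q² = 0`.
  have hsq : ∀ f, D.QL Sint (D.QL Sint f) = 0 := ham_sq D.ω_deg D.ω_symm D.ω_nondeg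
    (D.S_homogeneous hSint) (D.S_mem_Fil hSint) hCME
  have eQ : D.Q Sint = ⇑(D.QL Sint) := funext (D.Q_eq hSint)
  have eQ' : D.QInt' Sint = ⇑(D.QIntL' Sint) := funext (D.QInt'_eq hSint)
  have eκ : ∀ f, D.κhat f = D.κL f := fun f => (D.κL_apply f).symm
  refine ⟨D.hplConverges hSint, D.isDGCommAlgebra hSint hsq, D.isDGCommAlgebra' hSint hsq,
    D.isSDR hSint hsq, fun c SintQ hS _ _ => D.reducesModH c hS,
    D.flow hSint, D.cr hSint, D.ιInt hSint, D.πInt hSint,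
    ⟨D.isFlow_flow hSint, fun Ψ hΨ => D.isFlow_unique hSint hΨ⟩,
    ⟨D.isCr_cr hSint hsq, fun cr' hcr => D.isCr_unique hSint hsq hcr⟩,
    D.isDGAlgHom_pInt hSint hsq,
    funext fun f => (D.pInt_eq hSint f).trans (D.ιInt_pullback hSint hsq f).symm,
    fun O => ?_, fun i => ?_, D.isInverseOfPrOnZ hSint hsq, D.ιInt_comp hSint, fun f => ?_,
    D.QInt'_eq_bracket hSint hsq, D.isDGAlgHom_iInt hSint hsq,
    funext fun f => (D.iInt_eq hSint f).trans (D.πInt_pullback hSint hsq f).symm,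
    fun O' => ?_, fun a => ?_, fun f => ?_, fun O m => ?_, fun O m => ?_⟩
  · rw [D.pInt_eq hSint]
    simp only [D.pullback_flow]
    exact tendsto_iff_coeff.2 (D.tendsto_pL_flow hSint hsq O)
  · exact tendsto_iff_coeff.2 (D.tendsto_pL_flow hSint hsq (X i))
  · rw [eQ, eQ', D.ιInt_pullback hSint hsq, D.ιInt_pullback hSint hsq, D.pIntL_QL hSint hsq]
  · rw [D.iInt_eq hSint]
    simp only [D.pullback_flow]
    exact tendsto_iff_coeff.2 (D.tendsto_flow_iL hSint hsq O')
  · have e : ∀ T, ∑ i, D.pr a i • (D.flow hSint T).comp i = D.flowPullback hSint T (D.iL (X a)) :=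
      fun T => by rw [D.iL_X, map_linForm]; rfl
    simp only [e]
    exact tendsto_iff_coeff.2 (D.tendsto_flow_iL hSint hsq (X a))
  · rw [eQ, eQ', D.πInt_pullback hSint hsq, D.πInt_pullback hSint hsq, D.QL_iIntL hSint hsq]
  · simp only [D.pullback_flow, eκ, D.KInt_eq hSint]
    exact ⟨D.integrableOn_flow hSint hsq O m, D.integral_flow hSint hsq O m⟩
  · simp only [D.dTPart_pullbackWithDT, D.pullback_flow, ← D.flowPullback_κL, D.KInt_eq hSint]
    exact ⟨D.integrableOn_flow hSint hsq O m, D.integral_flow hSint hsq O m⟩
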